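/- Let $n\ge 1$ and let $M$ be a smooth $n$-dimensional manifold. A $GL(2,\mathbb R)$ structure on $M$ is a field of rational normal curves of degree $n-1$ in $\mathbb P T^*M$, given locally as $\lambda\mapsto[\omega(\lambda)]$, $\omega(\lambda)=\omega_0+\lambda\omega_1+\dots+\lambda^{n-1}\omega_{n-1}$, $\lambda\in\mathbb R\cup\{\infty\}$, with $\omega_0,\dots,\omega_{n-1}$ a smooth coframe. The hyperplanes $\ker\omega(\lambda)\subset T_xM$ are called $\alpha$-hyperplanes; an $\alpha$-manifold is a hypersurface of $M$ all of whose tangent spaces are $\alpha$-hyperplanes; the structure is involutive if every $\alpha$-hyperplane is tangent to some $\alpha$-manifold. For smooth functions $u,v$ on an open subset of $\mathbb R^n$ with coordinates $x^1,\dots,x^n$, let subscripts denote partial derivatives, and suppose that all $u_i$ and $v_i$ are nowhere zero and that the functions $a_i=u_i/v_i$ are pairwise distinct at every point. Put $b_i=v_i/u_i$, $$\omega(\lambda)=\sum_{i=1}^n\frac{u_i}{\lambda-\frac{u_i}{v_i}}\,dx^i ,\qquad(1)$$ and, for pairwise distinct $i,j,k,l$, $$E_{ijkl}=\mathop{\mathfrak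 S}_{(jkl)}(a_i-a_j)(a_k-a_l)\left(\frac{2u_{ij}-(a_i+a_j)v_{ij}}{u_iu_j}+\frac{2u_{kl}-(a_k+a_l)v_{kl}}{u_ku_l}\right),$$ $$F_{ijkl}=\mathop{\mathfrak S}_{(jkl)}(b_i-b_j)(b_k-b_l)\left(\frac{2v_{ij}-(b_i+b_j)u_{ij}}{v_iv_j}+\frac{2v_{kl}-(b_k+b_l)u_{kl}}{v_kv_l}\right),$$ where $\mathfrak S$ denotes the cyclic sum over the indicated indices. (a) For every involutive $GL(2,\mathbb R)$ structure on $M$, near every point of $M$ there are local coordinates $x^1,\dots,x^n$ and functions $u,v$ of them as above such that the structure is given by (1), that is, after clearing denominators, by $$\sum_{i=1}^n\Big[\prod_{j\ne i}\Big(\lambda-\frac{u_j}{v_j}\Big)\Big]u_i\,dx^i=\prod_{j}\Big(\lambda-\frac{u_j}{v_j}\Big)\,\omega(\lambda).$$ Whenever an involutive $GL(2,\mathbb R)$ structure is given in this way, $u$ and $v$ satisfy the system $E_{ijkl}=0$, $F_{ijkl}=0$ for all pairwise distinct $i,j,k,l$. (b) For all $u,v$ as above this system is the result of eliminating the derivatives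 of $\lambda$ from the integrability condition $d\omega(\lambda)\wedge\omega(\lambda)=0$, in which $\lambda$ is a function of $x$. That is, at every point $x$ the following are equivalent: (i) $E_{ijkl}(x)=F_{ijkl}(x)=0$ for all pairwise distinct $i,j,k,l$; (ii) for every value $\ell\notin\{a_1(x),\dots,a_n(x)\}$ of $\lambda$ at $x$, every linear combination of the coefficients of $d\omega(\lambda)\wedge\omega(\lambda)$ at $x$ that does not contain the derivatives of $\lambda$ vanishes; (iii) for every such $\ell$ there is a smooth function $\lambda$ near $x$ with $\lambda(x)=\ell$ for which $d\omega(\lambda)\wedge\omega(\lambda)$ vanishes at $x$. -/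

import Mathlib

open scoped Manifold ContDiff

noncomputable section

namespace ParaconformalGeometry

/-! ## `GL(2, ℝ)` structures on manifolds -/

section Structures

variable {n : ℕ} {M : Type*} [TopologicalSpace M] [ChartedSpace (EuclideanSpace ℝ (Fin n)) M]

/-- A 1-form on `M` (a section of the cotangent bundle) is smooth on the set `V`. -/
def SmoothOneFormOn [IsManifold (𝓡 n) ∞ M]
    (θ : (x : M) → (TangentSpace (𝓡 n) x →L[ℝ] ℝ)) (V : Set M) : Prop :=
  ContMDiffOn (𝓡 n) ((𝓡 n).prod 𝓘(ℝ, EuclideanSpace ℝ (Fin n) →L[ℝ] ℝ)) ∞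
    (fun x => Bundle.TotalSpace.mk' (EuclideanSpace ℝ (Fin n) →L[ℝ] ℝ)
      (E := fun y : M => TangentSpace (𝓡 n) y →L[ℝ] Bundle.Trivial M ℝ y) x (θ x)) V

/-- The cone of nonzero covectors over a parametrised curve in a projective space of covectors:
all `r • γ(s, t)` with `r ≠ 0` and homogeneous coordinates `(s, t) ≠ (0, 0)`; the affine
parameter is `λ = s / t`, and `t = 0` is the point `λ = ∞`. -/
def coneOver {F : Type*} [SMul ℝ F] (γ : ℝ → ℝ → F) : Set F :=
  {η | ∃ r s t : ℝ, r ≠ 0 ∧ (s ≠ 0 ∨ t ≠ 0) ∧ η = r • γ s t}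

variable (n M) in
/-- A `GL(2, ℝ)` structure on the `n`-dimensional manifold `M`: a field of rational normal curves
of degree `n - 1` in the projectivised cotangent bundle. The curve at `x` is recorded by the set
`cone x` of all nonzero covectors whose class lies on it. Locally there is a smooth coframe
`ω₀, …, ωₙ₋₁` such that the curve is `ω(λ) = ω₀ + λ ω₁ + ⋯ + λⁿ⁻¹ ωₙ₋₁`, `λ ∈ ℝ ∪ {∞}`. -/
structure GL2Structure [IsManifold (𝓡 n) ∞ M] where
  /-- the nonzero covectors at `x` on the cone over the rational normal curve at `x` -/
  cone : (x : M) → Set (TangentSpace (𝓡 n) x →L[ℝ] ℝ)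
  exists_coframe : ∀ x₀ : M, ∃ V : Set M, IsOpen V ∧ x₀ ∈ V ∧
    ∃ w : Fin n → (x : M) → (TangentSpace (𝓡 n) x →L[ℝ] ℝ),
      (∀ i, SmoothOneFormOn (w i) V) ∧
      ∀ x ∈ V, LinearIndependent ℝ (fun i => w i x) ∧
        cone x = coneOver fun s t : ℝ => ∑ i : Fin n, (s ^ (i : ℕ) * t ^ (n - 1 - (i : ℕ))) • w i x

/-- The set `N ⊆ M` is, near its point `x`, a smooth embedded hypersurface with tangent
hyperplane `H` at `x`: near `x` it is the zero set of a smooth function `g` with `dg(x) ≠ 0`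
and `H = ker dg(x)`. -/
def IsHypersurfaceAt (N : Set M) (x : M) (H : Submodule ℝ (TangentSpace (𝓡 n) x)) : Prop :=
  x ∈ N ∧ ∃ V : Set M, IsOpen V ∧ x ∈ V ∧ ∃ g : M → ℝ,
    ContMDiffOn (𝓡 n) 𝓘(ℝ, ℝ) ∞ g V ∧ (∀ y ∈ V, y ∈ N ↔ g y = 0) ∧
    mfderiv (𝓡 n) 𝓘(ℝ, ℝ) g x ≠ 0 ∧
    ∀ X : TangentSpace (𝓡 n) x, X ∈ H ↔ mfderiv (𝓡 n) 𝓘(ℝ, ℝ) g x X = 0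

namespace GL2Structure

variable [IsManifold (𝓡 n) ∞ M] (S : GL2Structure n M)

/-- The `α`-hyperplanes at `x` are the kernels of the covectors `ω(λ)` at `x`. -/
def IsAlphaHyperplane (x : M) (H : Submodule ℝ (TangentSpace (𝓡 n) x)) : Prop :=
  ∃ η ∈ S.cone x, ∀ X : TangentSpace (𝓡 n) x, X ∈ H ↔ η X = 0

/-- An `α`-manifold is a hypersurface all of whose tangent spaces are `α`-hyperplanes. -/
def IsAlphaManifold (N : Set M) : Prop :=
  ∀ y ∈ N, ∃ H : Submodule ℝ (TangentSpace (𝓡 n) y),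
    S.IsAlphaHyperplane y H ∧ IsHypersurfaceAt N y H

/-- A `GL(2, ℝ)` structure is involutive if every `α`-hyperplane is tangent to
some `α`-manifold. -/
def IsInvolutive : Prop :=
  ∀ (x : M) (H : Submodule ℝ (TangentSpace (𝓡 n) x)), S.IsAlphaHyperplane x H →
    ∃ N : Set M, S.IsAlphaManifold N ∧ IsHypersurfaceAt N x H

end GL2Structure

end Structures

/-! ## The normal form and the system for `u`, `v` in coordinates -/

section Coordinates

variable {n : ℕ}

/-- The partial derivative `∂f/∂xⁱ`. -/
def pd (i : Fin n) (f : EuclideanSpace ℝ (Fin n) → ℝ) (x : EuclideanSpace ℝ (Fin n)) : ℝ :=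
  fderiv ℝ f x (EuclideanSpace.single i 1)

/-- `aᵢ = uᵢ / vᵢ`. -/
def ratio (u v : EuclideanSpace ℝ (Fin n) → ℝ) (i : Fin n) (x : EuclideanSpace ℝ (Fin n)) : ℝ :=
  pd i u x / pd i v x

/-- `u` and `v` are smooth on `U`, their first derivatives do not vanish there, and the ratios
`aᵢ = uᵢ / vᵢ` are pairwise distinct at every point of `U`. -/
def Admissible (u v : EuclideanSpace ℝ (Fin n) → ℝ) (U : Set (EuclideanSpace ℝ (Fin n))) : Prop :=
  ContDiffOn ℝ ∞ u U ∧ ContDiffOn ℝ ∞ v U ∧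
    ∀ x ∈ U, (∀ i, pd i u x ≠ 0) ∧ (∀ i, pd i v x ≠ 0) ∧
      ∀ i j, i ≠ j → ratio u v i x ≠ ratio u v j x

/-- The value at `x` of `ω(λ) = ∑ᵢ uᵢ / (λ - uᵢ / vᵢ) dxⁱ`. -/
def normalForm (u v : EuclideanSpace ℝ (Fin n) → ℝ) (lam : ℝ) (x : EuclideanSpace ℝ (Fin n)) :
    EuclideanSpace ℝ (Fin n) →L[ℝ] ℝ :=
  ∑ i, (pd i u x / (lam - ratio u v i x)) • EuclideanSpace.proj (𝕜 := ℝ) i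

/-- The value at `x` of `∑ᵢ [∏_{j ≠ i} (s - t uⱼ / vⱼ)] uᵢ dxⁱ`: the normal form with cleared
denominators, in homogeneous coordinates `λ = s / t` (for `t = 1` it is
`∑ᵢ [∏_{j ≠ i} (λ - uⱼ / vⱼ)] uᵢ dxⁱ` at `λ = s`). -/
def clearedForm (u v : EuclideanSpace ℝ (Fin n) → ℝ) (s t : ℝ) (x : EuclideanSpace ℝ (Fin n)) :
    EuclideanSpace ℝ (Fin n) →L[ℝ] ℝ :=
  ∑ i, ((∏ j ∈ Finset.univ.erase i, (s - t * ratio u v j x)) * pd i u x) •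
    EuclideanSpace.proj (𝕜 := ℝ) i

/-- One summand of the cyclic sum,
`(aᵢ - aⱼ)(aₖ - aₗ) ((2uᵢⱼ - (aᵢ + aⱼ)vᵢⱼ) / (uᵢuⱼ) + (2uₖₗ - (aₖ + aₗ)vₖₗ) / (uₖuₗ))`. -/
def cyclicTerm (u v : EuclideanSpace ℝ (Fin n) → ℝ) (i j k l : Fin n)
    (x : EuclideanSpace ℝ (Fin n)) : ℝ :=
  (ratio u v i x - ratio u v j x) * (ratio u v k x - ratio u v l x) *
    ((2 * pd i (pd j u) x - (ratio u v i x + ratio u v j x) * pd i (pd j v) x)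
        / (pd i u x * pd j u x) +
      (2 * pd k (pd l u) x - (ratio u v k x + ratio u v l x) * pd k (pd l v) x)
        / (pd k u x * pd l u x))

/-- `E_{ijkl}`: the cyclic sum over `(j, k, l)` of the above terms. -/
def exprE (u v : EuclideanSpace ℝ (Fin n) → ℝ) (i j k l : Fin n)
    (x : EuclideanSpace ℝ (Fin n)) : ℝ :=
  cyclicTerm u v i j k l x + cyclicTerm u v i k l j x + cyclicTerm u v i l j k x

/-- `F_{ijkl}`: the expression `E_{ijkl}` with `u` and `v` interchanged (so that
`aᵢ = uᵢ / vᵢ` is replaced by `bᵢ = vᵢ / uᵢ`). -/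
def exprF (u v : EuclideanSpace ℝ (Fin n) → ℝ) (i j k l : Fin n)
    (x : EuclideanSpace ℝ (Fin n)) : ℝ :=
  exprE v u i j k l x

/-- The system `E_{ijkl} = 0`, `F_{ijkl} = 0` at the point `x`,
for all pairwise distinct `i, j, k, l`. -/
def SystemAt (u v : EuclideanSpace ℝ (Fin n) → ℝ) (x : EuclideanSpace ℝ (Fin n)) : Prop :=
  ∀ i j k l : Fin n, i ≠ j → i ≠ k → i ≠ l → j ≠ k → j ≠ l → k ≠ l →
    exprE u v i j k l x = 0 ∧ exprF u v i j k l x = 0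

/-- The exterior derivative of a 1-form on `ℝⁿ`, evaluated on two vectors. -/
def extD (w : EuclideanSpace ℝ (Fin n) → (EuclideanSpace ℝ (Fin n) →L[ℝ] ℝ))
    (x X Y : EuclideanSpace ℝ (Fin n)) : ℝ :=
  extDeriv (fun y => ContinuousAlternatingMap.ofSubsingleton ℝ (EuclideanSpace ℝ (Fin n)) ℝ
    (0 : Fin 1) (w y)) x ![X, Y]

/-- The coefficient of `dω ∧ ω` at `dxⁱ ∧ dxʲ ∧ dxᵏ`, at the point `x`. -/
def dWedgeCoeff (w : EuclideanSpace ℝ (Fin n) → (EuclideanSpace ℝ (Fin n) →L[ℝ] ℝ))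
    (i j k : Fin n) (x : EuclideanSpace ℝ (Fin n)) : ℝ :=
  extD w x (EuclideanSpace.single i 1) (EuclideanSpace.single j 1) *
      w x (EuclideanSpace.single k 1) +
    extD w x (EuclideanSpace.single j 1) (EuclideanSpace.single k 1) *
      w x (EuclideanSpace.single i 1) +
    extD w x (EuclideanSpace.single k 1) (EuclideanSpace.single i 1) *
      w x (EuclideanSpace.single j 1)

/-- The coefficient at `dxⁱ ∧ dxʲ ∧ dxᵏ` of `dω(λ) ∧ ω(λ)` for the normal form `ω(λ)`, where
`λ` is a function of `x`. -/
def integrabilityCoeff (u v lam : EuclideanSpace ℝ (Fin n) → ℝ) (i j k : Fin n)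
    (x : EuclideanSpace ℝ (Fin n)) : ℝ :=
  dWedgeCoeff (fun y => normalForm u v (lam y) y) i j k x

/-- Elimination of the derivatives of `λ` from `dω(λ) ∧ ω(λ) = 0`, at the point `x` and for the
value `ℓ` of `λ` there: some linear combination of the coefficients of `dω(λ) ∧ ω(λ)` at `x` has
the same value `κ` for all smooth `λ` with `λ(x) = ℓ` (it contains no derivatives of `λ`), so that
the relation `κ = 0` is a consequence of `dω(λ) ∧ ω(λ) = 0` free of derivatives of `λ`. -/
def IsDerivativeFreeCombination (u v : EuclideanSpace ℝ (Fin n) → ℝ)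
    (x : EuclideanSpace ℝ (Fin n)) (ℓ κ : ℝ) : Prop :=
  ∃ c : Fin n → Fin n → Fin n → ℝ, ∀ lam : EuclideanSpace ℝ (Fin n) → ℝ,
    ContDiffAt ℝ ∞ lam x → lam x = ℓ →
      ∑ i, ∑ j, ∑ k, c i j k * integrabilityCoeff u v lam i j k x = κ

end Coordinates

section Representation

variable {n : ℕ} {M : Type*} [TopologicalSpace M] [ChartedSpace (EuclideanSpace ℝ (Fin n)) M]
  [IsManifold (𝓡 n) ∞ M]

/-- In the local coordinates `(x¹, …, xⁿ) = φ`, the structure `S` has the normal form given by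
the functions `u` and `v` of `(x¹, …, xⁿ)`: over the domain of `φ`, its rational normal curves
are parametrised by the normal form (with cleared denominators, including `λ = ∞`). -/
def GL2Structure.HasNormalForm (S : GL2Structure n M)
    (φ : OpenPartialHomeomorph M (EuclideanSpace ℝ (Fin n)))
    (u v : EuclideanSpace ℝ (Fin n) → ℝ) : Prop :=
  φ ∈ IsManifold.maximalAtlas (𝓡 n) ∞ M ∧ Admissible u v φ.target ∧
    ∀ y ∈ φ.source, S.cone y = coneOver fun s t : ℝ =>
      (clearedForm u v s t (φ y)).comp (mfderiv (𝓡 n) (𝓡 n) φ y)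

end Representation

end ParaconformalGeometry

end

/-! The proof has three parts.

**The system and elimination.** For the normal form `ω(λ)` with `λ` a function of `x`, the
coefficient of `dω ∧ ω` at `dxⁱ ∧ dxʲ ∧ dxᵏ` is a nonzero multiple of
`∑ (λ - a_k) (q_j - q_i + ρ_ij)` (cyclic sum), where `q_i` is a multiple of `λ_i` and `ρ_ij`
collects the second derivatives of `u` and `v` (`integrabilityCoeff_eq`). For four indices the
alternating sum of these expressions is free of `q`, and equals `-λ (λ E + a_i a_j a_k a_l F)`
(`eliminant_secondOrderTerm`); their alternating sum with weights `λ - a_i` is zero identically.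
Vanishing of the first sum for all `λ` is the system (`systemAt_of_forall_combination`). Conversely, if the system
holds, then `q` can be found with two of its entries zero (`exists_reducedCoeff_eq_zero`), which is
realised by an affine function `λ` (`exists_integrabilityCoeff_eq_zero`).

**Involutivity implies the system.** If a hypersurface `g = 0` has conormals `dg = c W` for a 1-form
`W`, then `dW` vanishes on its tangent spaces (`fderiv_symm_of_proportional`). Along an α-manifold
the conormals are `ω(λ)` with a smooth function `λ` that can be read off from two components of
`dg`; so `dω(λ) ∧ ω(λ) = 0` at the given point, for every value of `λ` there
(`exists_integrabilityCoeff_eq_zero_of_hypersurface`).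

**Existence of the normal form.** Let `n ≥ 2`. For a coframe `w`, the argument just given shows that
`dω(l)` vanishes on `ker ω(l) ∩ ker ω'(l)`, the prime denoting the derivative in `l`
(`fderiv_curveForm_symm_of_hypersurface`). By the method of characteristics on the space of pairs
`(x, l)` every value `l₀` at a point extends to a function `Λ` such that `ω(Λ)` is proportional to a
differential `df` (`exists_function_fderiv_proportional`). This uses smooth dependence of
the solutions of ordinary differential equations on initial values and parameters, obtained from the
inverse function theorem in the space of continuous functions on the unit interval
(`exists_smooth_solution`). Take `n + 2` such functions, with distinct values of `Λ`: `n` of them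
are coordinates `x¹, …, xⁿ`, since distinct points of a rational normal curve are independent, and the
other two are `u` and `v`. The normal form is then Lagrange interpolation on the rational normal
curve: a suitably scaled projective change of parameter, sending the point `du` to `∞` and `dv` to
`0`, turns the parameter of `dxⁱ` into `u_i / v_i` (`coneOver_rnc_eq`). For `n = 1` the cone consists of all nonzero covectors. -/

noncomputable section

namespace ParaconformalGeometry

open Set Filter Topology

/-! ### The inverse function theorem -/

section InverseFunction

variable {E F : Type*} [NormedAddCommGroup E] [NormedSpace ℝ E] [CompleteSpace E]
  [NormedAddCommGroup F] [NormedSpace ℝ F]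

/-- The inverse function theorem with an inverse that is smooth on its whole domain: the source is
shrunk until the derivative is invertible at all of its points. -/
theorem exists_smooth_localInverse {f : E → F} {U : Set E} (hU : IsOpen U) {a : E} (ha : a ∈ U)
    (hf : ContDiffOn ℝ ∞ f U) {f' : E ≃L[ℝ] F} (hf' : HasFDerivAt f (f' : E →L[ℝ] F) a) :
    ∃ e : OpenPartialHomeomorph E F, a ∈ e.source ∧ e.source ⊆ U ∧ (e : E → F) = f ∧
      ContDiffOn ℝ ∞ e.symm e.target := by
  have hfa : ContDiffAt ℝ ∞ f a := hf.contDiffAt (hU.mem_nhds ha)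
  set e₀ := hfa.toOpenPartialHomeomorph f hf' (by simp) with he₀
  have hcont : ContinuousOn (fderiv ℝ f) U := hf.continuousOn_fderiv_of_isOpen hU (by simp)
  have hinv : ∀ᶠ x in 𝓝 a,
      fderiv ℝ f x ∈ range (ContinuousLinearEquiv.toContinuousLinearMap : (E ≃L[ℝ] F) → _) := by
    apply (hcont.continuousAt (hU.mem_nhds ha)).eventually
    rw [hf'.fderiv]
    exact ContinuousLinearEquiv.nhds f'
  obtain ⟨t, ht, hto, hat⟩ := eventually_nhds_iff.1 (hinv.and (hU.mem_nhds ha))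
  have hsrc : ∀ x ∈ (e₀.restrOpen t hto).source, x ∈ e₀.source ∧ x ∈ t := by
    intro x hx
    simpa using hx
  have hder : ∀ x ∈ t, ∃ g : E ≃L[ℝ] F, HasFDerivAt f (g : E →L[ℝ] F) x := by
    intro x hx
    obtain ⟨⟨g, hg⟩, hxU⟩ := ht x hx
    refine ⟨g, ?_⟩
    rw [show (g : E →L[ℝ] F) = fderiv ℝ f x from hg]
    exact ((hf.contDiffAt (hU.mem_nhds hxU)).differentiableAt (by simp)).hasFDerivAt
  have hcoe : ((e₀.restrOpen t hto : OpenPartialHomeomorph E F) : E → F) = f := rfl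
  refine ⟨e₀.restrOpen t hto, ?_, fun x hx => (ht x (hsrc x hx).2).2, hcoe, ?_⟩
  · simp only [OpenPartialHomeomorph.restrOpen_source]
    exact ⟨hfa.mem_toOpenPartialHomeomorph_source hf' (by simp), hat⟩
  · intro y hy
    have hx := (e₀.restrOpen t hto).map_target hy
    obtain ⟨g, hg⟩ := hder _ (hsrc _ hx).2
    refine ((e₀.restrOpen t hto).contDiffAt_symm (f₀' := g) hy ?_ ?_).contDiffWithinAt
    · rw [hcoe]; exact hg
    · rw [hcoe]
      exact hf.contDiffAt (hU.mem_nhds (ht _ (hsrc _ hx).2).2)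

end InverseFunction

/-! ### Composition operators between spaces of continuous functions -/

section Nemytskii

variable {K : Type} [TopologicalSpace K] [CompactSpace K]
  {E F : Type} [NormedAddCommGroup E] [NormedSpace ℝ E]
  [NormedAddCommGroup F] [NormedSpace ℝ F]

variable (K E F) in
/-- Pointwise application of a continuous family of operators to a continuous family of vectors,
as a continuous bilinear map. -/
def pointwiseApply : C(K, E →L[ℝ] F) →L[ℝ] C(K, E) →L[ℝ] C(K, F) :=
  LinearMap.mkContinuous₂
    (LinearMap.mk₂ ℝ (fun (A : C(K, E →L[ℝ] F)) (α : C(K, E)) =>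
        (⟨fun t => A t (α t), A.continuous.clm_apply α.continuous⟩ : C(K, F)))
      (fun _ _ _ => by ext; simp) (fun _ _ _ => by ext; simp)
      (fun _ _ _ => by ext; simp) (fun _ _ _ => by ext; simp)) 1 (by
    intro A α
    rw [ContinuousMap.norm_le _ (by positivity)]
    intro t
    simp only [LinearMap.mk₂_apply, ContinuousMap.coe_mk, one_mul]
    refine ((A t).le_opNorm _).trans ?_
    gcongr
    · exact A.norm_coe_le_norm t
    · exact α.norm_coe_le_norm t)

@[simp] theorem pointwiseApply_apply (A : C(K, E →L[ℝ] F)) (α : C(K, E)) (t : K) :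
    pointwiseApply K E F A α t = A t (α t) := rfl

/-- Composition with a differentiable map with continuous derivative is differentiable for the
supremum norm. -/
theorem hasFDerivAt_postcomp {g : E → F} (hg : ContDiff ℝ 1 g) (α : C(K, E)) :
    HasFDerivAt (fun β : C(K, E) => (⟨g, hg.continuous⟩ : C(E, F)).comp β)
      (pointwiseApply K E F
        ((⟨fderiv ℝ g, hg.continuous_fderiv (by simp)⟩ : C(E, E →L[ℝ] F)).comp α)) α := by
  rw [hasFDerivAt_iff_isLittleO_nhds_zero, Asymptotics.isLittleO_iff]
  intro c hc
  set dg : C(E, E →L[ℝ] F) := ⟨fderiv ℝ g, hg.continuous_fderiv (by simp)⟩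
  have hcont : Continuous fun β : C(K, E) => dg.comp β := ContinuousMap.continuous_postcomp dg
  obtain ⟨δ, hδ, H⟩ := (Metric.continuous_iff (α := C(K, E)) (β := C(K, E →L[ℝ] F))).1 hcont α c hc
  filter_upwards [Metric.ball_mem_nhds (0 : C(K, E)) hδ] with h hh
  rw [ContinuousMap.norm_le _ (by positivity)]
  intro t
  have hht : ‖h t‖ < δ := (h.norm_coe_le_norm t).trans_lt (by simpa using hh)
  have key : ∀ z ∈ Metric.ball (α t) δ, ‖fderiv ℝ g z - fderiv ℝ g (α t)‖ ≤ c := by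
    intro z hz
    -- test the continuity of `β ↦ dg ∘ β` on the translate of `α` through `z`
    have h1 : dist (α + ContinuousMap.const K (z - α t)) α < δ := by
      rw [dist_eq_norm, add_sub_cancel_left]
      refine lt_of_le_of_lt ?_ (mem_ball_iff_norm.1 hz)
      rw [ContinuousMap.norm_le _ (norm_nonneg _)]
      intro s
      simp
    have h2 := H _ h1
    have h3 := (ContinuousMap.dist_apply_le_dist t).trans h2.le
    rw [dist_eq_norm] at h3
    simpa [dg] using h3
  have := Convex.norm_image_sub_le_of_norm_hasFDerivWithin_le' (𝕜 := ℝ) (f := g)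
    (s := Metric.ball (α t) δ) (x := α t) (y := α t + h t) (f' := fderiv ℝ g)
    (φ := fderiv ℝ g (α t)) (C := c)
    (fun z _ => ((hg.differentiable (by simp)) z).hasFDerivAt.hasFDerivWithinAt) key
    (convex_ball _ _) (Metric.mem_ball_self hδ) (by simpa using hht)
  simp only [add_sub_cancel_left] at this
  calc _ = ‖g (α t + h t) - g (α t) - fderiv ℝ g (α t) (h t)‖ := by simp [dg]
    _ ≤ c * ‖h t‖ := this
    _ ≤ c * ‖h‖ := by gcongr; exact h.norm_coe_le_norm t

theorem contDiff_pointwiseApply {m : WithTop ℕ∞} : ContDiff ℝ m (pointwiseApply K E F) := by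
  fun_prop

/-- Finite-order version of `contDiff_postcomp`. The spaces vary in the induction, since the
derivative of `g` takes values in `E →L[ℝ] F`; hence they live in a fixed universe. -/
theorem contDiff_postcomp_nat (m : ℕ) : ∀ {E F : Type} [NormedAddCommGroup E] [NormedSpace ℝ E]
    [NormedAddCommGroup F] [NormedSpace ℝ F] {g : E → F} (hg : ContDiff ℝ ∞ g),
    ContDiff ℝ m (fun β : C(K, E) => (⟨g, hg.continuous⟩ : C(E, F)).comp β) := by
  induction m with
  | zero =>
    intro E F _ _ _ _ g hg
    exact contDiff_zero.2 (ContinuousMap.continuous_postcomp _)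
  | succ m ih =>
    intro E F _ _ _ _ g hg
    have hg' : ContDiff ℝ ∞ (fderiv ℝ g) := hg.fderiv_right (by simp)
    rw [show ((m + 1 : ℕ) : WithTop ℕ∞) = (m : WithTop ℕ∞) + 1 by simp]
    exact contDiff_succ_iff_hasFDerivAt.2 ⟨fun α => pointwiseApply K E F
        ((⟨fderiv ℝ g, hg'.continuous⟩ : C(E, E →L[ℝ] F)).comp α),
      ContDiff.comp (g := pointwiseApply K E F) contDiff_pointwiseApply (ih hg'),
      fun α => hasFDerivAt_postcomp (hg.of_le (by simp)) α⟩

/-- Composition with a smooth map is a smooth map between spaces of continuous functions. -/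
theorem contDiff_postcomp {g : E → F} (hg : ContDiff ℝ ∞ g) :
    ContDiff ℝ ∞ (fun β : C(K, E) => (⟨g, hg.continuous⟩ : C(E, F)).comp β) :=
  contDiff_infty.2 fun m => contDiff_postcomp_nat m hg

end Nemytskii

/-! ### Primitives of continuous functions -/

section Integral

variable {Q : Type} [NormedAddCommGroup Q] [NormedSpace ℝ Q]

variable (Q) in
/-- The operator `α ↦ (t ↦ ∫₀ᵗ α)` on continuous functions on the unit interval. -/
def primitiveL : C(unitInterval, Q) →L[ℝ] C(unitInterval, Q) :=
  LinearMap.mkContinuous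
    { toFun := fun α => ⟨fun t => ∫ τ in (0 : ℝ)..t, α (projIcc 0 1 zero_le_one τ), by
        have hc : Continuous fun τ : ℝ => α (projIcc 0 1 zero_le_one τ) :=
          α.continuous.comp continuous_projIcc
        exact (intervalIntegral.continuous_primitive
          (fun a b => hc.intervalIntegrable a b) 0).comp continuous_subtype_val⟩
      map_add' := fun α β => by
        ext t
        have hc : ∀ γ : C(unitInterval, Q), Continuous fun τ : ℝ => γ (projIcc 0 1 zero_le_one τ) :=
          fun γ => γ.continuous.comp continuous_projIcc
        simp only [ContinuousMap.coe_mk, ContinuousMap.add_apply]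
        exact intervalIntegral.integral_add ((hc α).intervalIntegrable _ _)
          ((hc β).intervalIntegrable _ _)
      map_smul' := fun c α => by
        ext t
        simp } 1 (by
    intro α
    rw [ContinuousMap.norm_le _ (by positivity)]
    intro t
    simp only [LinearMap.coe_mk, AddHom.coe_mk, ContinuousMap.coe_mk]
    refine (intervalIntegral.norm_integral_le_of_norm_le_const (C := ‖α‖)
      (fun τ _ => α.norm_coe_le_norm _)).trans ?_
    rw [mul_comm]
    refine mul_le_mul_of_nonneg_right ?_ (norm_nonneg _)
    rw [sub_zero, abs_of_nonneg t.2.1]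
    exact t.2.2)

theorem primitiveL_apply (α : C(unitInterval, Q)) (t : unitInterval) :
    primitiveL Q α t = ∫ τ in (0 : ℝ)..t, α (projIcc 0 1 zero_le_one τ) := rfl

/-- A function which equals the primitive of `α` plus a constant on the unit interval has
derivative `α`. -/
theorem hasDerivAt_add_primitive [CompleteSpace Q] (c : Q) (α : C(unitInterval, Q)) (t : ℝ) :
    HasDerivAt (fun s : ℝ => c + ∫ τ in (0 : ℝ)..s, α (projIcc 0 1 zero_le_one τ))
      (α (projIcc 0 1 zero_le_one t)) t := by
  have hc : Continuous fun τ : ℝ => α (projIcc 0 1 zero_le_one τ) :=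
    α.continuous.comp continuous_projIcc
  exact (intervalIntegral.integral_hasDerivAt_right (hc.intervalIntegrable _ _)
    (hc.stronglyMeasurableAtFilter _ _) hc.continuousAt).const_add c

end Integral

/-! ### Smooth dependence for ordinary differential equations -/

section Flow

variable {Q P : Type} [NormedAddCommGroup Q] [NormedSpace ℝ Q]
  [NormedAddCommGroup P] [NormedSpace ℝ P]

variable (Q) in
/-- The inclusion of constants into the continuous functions on the unit interval. -/
def constantL : Q →L[ℝ] C(unitInterval, Q) :=
  LinearMap.mkContinuous
    { toFun := fun q => ContinuousMap.const _ q
      map_add' := fun _ _ => by ext; simp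
      map_smul' := fun _ _ => by ext; simp } 1 (by
    intro q
    rw [ContinuousMap.norm_le _ (by positivity)]
    intro t
    simp)

@[simp] theorem constantL_apply (q : Q) (t : unitInterval) : constantL Q q t = q := rfl

/-- The curve `t ↦ V (y t) Z`, as a function of the continuous curve `y` and the vector `Z`. -/
def velocity {V : Q → P →L[ℝ] Q} (hV : ContDiff ℝ ∞ V) (y : C(unitInterval, Q)) (Z : P) :
    C(unitInterval, Q) :=
  pointwiseApply unitInterval P Q ((⟨V, hV.continuous⟩ : C(Q, P →L[ℝ] Q)).comp y) (constantL P Z)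

@[simp] theorem velocity_apply {V : Q → P →L[ℝ] Q} (hV : ContDiff ℝ ∞ V)
    (y : C(unitInterval, Q)) (Z : P) (t : unitInterval) : velocity hV y Z t = V (y t) Z := rfl

theorem contDiff_velocity {V : Q → P →L[ℝ] Q} (hV : ContDiff ℝ ∞ V) :
    ContDiff ℝ ∞ fun p : C(unitInterval, Q) × P => velocity hV p.1 p.2 := by
  have h1 : ContDiff ℝ ∞ fun p : C(unitInterval, Q) × P =>
      pointwiseApply unitInterval P Q ((⟨V, hV.continuous⟩ : C(Q, P →L[ℝ] Q)).comp p.1) :=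
    contDiff_pointwiseApply.comp ((contDiff_postcomp hV).comp contDiff_fst)
  have h2 : ContDiff ℝ ∞ fun p : C(unitInterval, Q) × P => constantL P p.2 := by fun_prop
  exact h1.clm_apply h2

/-- The derivative of the velocity is the right-hand side of the linearised equation. -/
theorem fderiv_velocity {V : Q → P →L[ℝ] Q} (hV : ContDiff ℝ ∞ V) (y : C(unitInterval, Q)) (Z : P)
    (J : C(unitInterval, Q)) (Y : P) (t : unitInterval) :
    fderiv ℝ (fun p : C(unitInterval, Q) × P => velocity hV p.1 p.2) (y, Z) (J, Y) t =
      fderiv ℝ V (y t) (J t) Z + V (y t) Y := by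
  set ev : C(unitInterval, Q) →L[ℝ] Q := ContinuousMap.evalCLM ℝ t with hev
  have h1 : HasFDerivAt (fun p : C(unitInterval, Q) × P => ev (velocity hV p.1 p.2))
      (ev.comp (fderiv ℝ (fun p : C(unitInterval, Q) × P => velocity hV p.1 p.2) (y, Z))) (y, Z) :=
    ev.hasFDerivAt.comp (y, Z) ((contDiff_velocity hV).differentiable (by simp) (y, Z)).hasFDerivAt
  have h2 : HasFDerivAt (fun p : C(unitInterval, Q) × P => V (ev p.1))
      ((fderiv ℝ V (ev y)).comp (ev.comp (ContinuousLinearMap.fst ℝ _ _))) (y, Z) :=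
    HasFDerivAt.comp (y, Z) (hV.differentiable (by simp) (ev y)).hasFDerivAt
      (ev.hasFDerivAt.comp (y, Z) hasFDerivAt_fst)
  have h3 := h2.clm_apply (hasFDerivAt_snd (𝕜 := ℝ) (p := (y, Z)))
  have h4 := congrArg (fun L => L (J, Y)) (h1.unique h3)
  simp only [ContinuousLinearMap.comp_apply] at h4
  refine Eq.trans h4 ?_
  simp [hev, add_comm]

variable [CompleteSpace Q] [CompleteSpace P]

/-- The differential equation `y' = V(y) Z` has a solution on the unit interval for all initial
values close to `q₀` and all small `Z`, and it depends smoothly on both, as a curve in the space of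
continuous functions. Since the equation is trivial for `Z = 0`, the inverse function theorem
applies to the integral equation at the constant solution. -/
theorem exists_smooth_solution {V : Q → P →L[ℝ] Q} (hV : ContDiff ℝ ∞ V) (q₀ : Q) :
    ∃ (W : Set (Q × P)) (y : Q × P → C(unitInterval, Q)), IsOpen W ∧ (q₀, 0) ∈ W ∧
      ContDiffOn ℝ ∞ y W ∧ y (q₀, 0) = constantL Q q₀ ∧
      ∀ p ∈ W, y p = constantL Q p.1 + primitiveL Q (velocity hV (y p) p.2) := by
  set Φ : C(unitInterval, Q) × (Q × P) → C(unitInterval, Q) × (Q × P) := fun z =>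
    (z.1 - constantL Q z.2.1 - primitiveL Q (velocity hV z.1 z.2.2), z.2) with hΦ
  have hvel : ContDiff ℝ ∞ fun z : C(unitInterval, Q) × (Q × P) =>
      primitiveL Q (velocity hV z.1 z.2.2) :=
    (primitiveL Q).contDiff.comp ((contDiff_velocity hV).comp
      (contDiff_fst.prodMk (contDiff_snd.comp contDiff_snd)))
  have hΦs : ContDiff ℝ ∞ Φ := by
    refine ContDiff.prodMk (ContDiff.sub ?_ hvel) contDiff_snd
    fun_prop
  -- at the constant solution the derivative of `Φ` is the shear `(α, p) ↦ (α - A p, p)`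
  set A : Q × P →L[ℝ] C(unitInterval, Q) :=
    (constantL Q).comp (ContinuousLinearMap.fst ℝ Q P) +
      ((primitiveL Q).comp (pointwiseApply unitInterval P Q
        (constantL _ (V q₀)))).comp ((constantL P).comp (ContinuousLinearMap.snd ℝ Q P)) with hA
  set T : (C(unitInterval, Q) × (Q × P)) ≃L[ℝ] (C(unitInterval, Q) × (Q × P)) :=
    ContinuousLinearEquiv.equivOfInverse
      ((ContinuousLinearMap.fst ℝ _ _ - A.comp (ContinuousLinearMap.snd ℝ _ _)).prod
        (ContinuousLinearMap.snd ℝ _ _))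
      ((ContinuousLinearMap.fst ℝ _ _ + A.comp (ContinuousLinearMap.snd ℝ _ _)).prod
        (ContinuousLinearMap.snd ℝ _ _))
      (fun z => by ext <;> simp) (fun z => by ext <;> simp) with hT
  set z₀ : C(unitInterval, Q) × (Q × P) := (constantL Q q₀, (q₀, 0)) with hz₀
  have hder : HasFDerivAt Φ (T : _ →L[ℝ] _) z₀ := by
    have h0 := (hΦs.differentiable (by simp) z₀).hasFDerivAt
    suffices fderiv ℝ Φ z₀ = (T : _ →L[ℝ] _) by rwa [this] at h0
    have hv : HasFDerivAt (fun z : C(unitInterval, Q) × (Q × P) => velocity hV z.1 z.2.2)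
        ((fderiv ℝ (fun p : C(unitInterval, Q) × P => velocity hV p.1 p.2)
          (constantL Q q₀, 0)).comp ((ContinuousLinearMap.fst ℝ _ _).prod
            ((ContinuousLinearMap.snd ℝ Q P).comp (ContinuousLinearMap.snd ℝ _ _)))) z₀ :=
      HasFDerivAt.comp z₀ (f := fun z : C(unitInterval, Q) × (Q × P) => (z.1, z.2.2))
        ((contDiff_velocity hV).differentiable (by simp) (constantL Q q₀, (0 : P))).hasFDerivAt
        (hasFDerivAt_fst.prodMk (hasFDerivAt_snd.comp z₀ hasFDerivAt_snd))
    have hc : HasFDerivAt (fun z : C(unitInterval, Q) × (Q × P) => z.1 - constantL Q z.2.1)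
        (ContinuousLinearMap.fst ℝ _ _ - (constantL Q).comp
          ((ContinuousLinearMap.fst ℝ Q P).comp (ContinuousLinearMap.snd ℝ _ _))) z₀ :=
      (ContinuousLinearMap.fst ℝ _ _ - (constantL Q).comp
          ((ContinuousLinearMap.fst ℝ Q P).comp (ContinuousLinearMap.snd ℝ _ _))).hasFDerivAt
    have h1 := (hc.sub ((primitiveL Q).hasFDerivAt.comp z₀ hv)).prodMk
      (ContinuousLinearMap.snd ℝ C(unitInterval, Q) (Q × P)).hasFDerivAt
    refine (HasFDerivAt.fderiv (f := Φ) h1).trans ?_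
    refine ContinuousLinearMap.ext fun z => ?_
    have hkey : fderiv ℝ (fun p : C(unitInterval, Q) × P => velocity hV p.1 p.2)
        (constantL Q q₀, 0) (z.1, z.2.2) =
        pointwiseApply unitInterval P Q (constantL _ (V q₀)) (constantL P z.2.2) := by
      ext t
      rw [fderiv_velocity]
      simp
    refine Prod.ext ?_ rfl
    simp [hT, hA, hkey, sub_sub]
  obtain ⟨e, hze, -, hcoe, hsymm⟩ := exists_smooth_localInverse (f := Φ) isOpen_univ
    (mem_univ z₀) hΦs.contDiffOn hder
  have hz₀' : Φ z₀ = (0, (q₀, 0)) := by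
    refine Prod.ext ?_ rfl
    simp only [hΦ, hz₀]
    have : velocity hV (constantL Q q₀) (0 : P) = 0 := by ext t; simp
    simp [this]
  have hinc : ContDiff ℝ ∞ fun p : Q × P => ((0 : C(unitInterval, Q)), p) :=
    contDiff_const.prodMk contDiff_id
  refine ⟨(fun p : Q × P => ((0 : C(unitInterval, Q)), p)) ⁻¹' e.target,
    fun p => (e.symm (0, p)).1, e.open_target.preimage hinc.continuous, ?_, ?_, ?_, ?_⟩
  · rw [mem_preimage, ← hz₀', ← hcoe]
    exact e.map_source hze
  · exact contDiff_fst.comp_contDiffOn (hsymm.comp hinc.contDiffOn fun p hp => hp)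
  · simp only
    rw [← hz₀', ← hcoe, e.left_inv hze]
  · intro p hp
    have h1 : Φ (e.symm (0, p)) = (0, p) := by rw [← hcoe]; exact e.right_inv hp
    have h2 : (e.symm (0, p)).2 = p := congrArg Prod.snd h1
    have h3 := congrArg Prod.fst h1
    simp only [hΦ, h2] at h3
    rw [sub_sub, sub_eq_zero] at h3
    exact h3

omit [CompleteSpace Q] [CompleteSpace P] in
/-- The derivative of a smooth family of solutions with respect to initial value and parameter
solves the linearised equation. -/
theorem fderiv_solution_eq {V : Q → P →L[ℝ] Q} (hV : ContDiff ℝ ∞ V) {W : Set (Q × P)}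
    {y : Q × P → C(unitInterval, Q)} (hW : IsOpen W) (hy : ContDiffOn ℝ ∞ y W)
    (hsol : ∀ p ∈ W, y p = constantL Q p.1 + primitiveL Q (velocity hV (y p) p.2))
    {p : Q × P} (hp : p ∈ W) (δ : Q × P) :
    fderiv ℝ y p δ = constantL Q δ.1 + primitiveL Q
      (fderiv ℝ (fun p : C(unitInterval, Q) × P => velocity hV p.1 p.2) (y p, p.2)
        (fderiv ℝ y p δ, δ.2)) := by
  have hyp : HasFDerivAt y (fderiv ℝ y p) p :=
    ((hy.contDiffAt (hW.mem_nhds hp)).differentiableAt (by simp)).hasFDerivAt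
  have hv : HasFDerivAt (fun p : Q × P => velocity hV (y p) p.2)
      ((fderiv ℝ (fun p : C(unitInterval, Q) × P => velocity hV p.1 p.2) (y p, p.2)).comp
        ((fderiv ℝ y p).prod (ContinuousLinearMap.snd ℝ Q P))) p :=
    HasFDerivAt.comp p (f := fun p : Q × P => (y p, p.2))
      ((contDiff_velocity hV).differentiable (by simp) (y p, p.2)).hasFDerivAt
      (hyp.prodMk (ContinuousLinearMap.snd ℝ Q P).hasFDerivAt)
  have h1 := (((constantL Q).comp (ContinuousLinearMap.fst ℝ Q P)).hasFDerivAt (x := p)).add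
    ((primitiveL Q).hasFDerivAt.comp p hv)
  have h2 := h1.congr_of_eventuallyEq (f₁ := y)
    (by filter_upwards [hW.mem_nhds hp] with p' hp'; exact hsol p' hp')
  have h3 := congrArg (fun L => L δ) (hyp.unique h2)
  simpa using h3

end Flow

/-! ### Flows along the characteristics of a 1-form -/

section CharacteristicFlow

variable {Q P : Type} [NormedAddCommGroup Q] [NormedSpace ℝ Q] [FiniteDimensional ℝ Q]
  [NormedAddCommGroup P] [NormedSpace ℝ P]

/-- A map that is smooth near a point agrees near that point with a globally smooth map. -/
theorem exists_contDiff_eventuallyEq {f : Q → P} {O : Set Q} (hO : IsOpen O) {q₀ : Q}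
    (hq₀ : q₀ ∈ O) (hf : ContDiffOn ℝ ∞ f O) : ∃ g : Q → P, ContDiff ℝ ∞ g ∧ g =ᶠ[𝓝 q₀] f := by
  obtain ⟨r, hr, hrO⟩ := Metric.nhds_basis_closedBall.mem_iff.1 (hO.mem_nhds hq₀)
  let b : ContDiffBump q₀ := ⟨r / 2, r, by positivity, by linarith⟩
  refine ⟨fun x => b x • f x, ?_, ?_⟩
  · rw [contDiff_iff_contDiffAt]
    intro x
    by_cases hx : x ∈ O
    · exact b.contDiffAt.smul (hf.contDiffAt (hO.mem_nhds hx))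
    · have hx' : x ∉ tsupport b := by
        rw [b.tsupport_eq]
        exact fun h => hx (hrO h)
      have h0 : (fun x => b x • f x) =ᶠ[𝓝 x] fun _ => 0 := by
        filter_upwards [notMem_tsupport_iff_eventuallyEq.1 hx'] with z hz
        simp [hz]
      exact contDiffAt_const.congr_of_eventuallyEq h0
  · filter_upwards [b.eventuallyEq_one] with x hx
    simp [hx]

/-- Transport of the kernel of a 1-form `θ` along its characteristics. If the vectors `V q Z` are
characteristic, i.e. are killed by `θ` and by `dθ` modulo `θ`, then the map `Ψ` sending `(q, Z)` to
the endpoint of the solution of `y' = V(y) Z`, `y(0) = q`, maps the kernel of `θ` at `q`, together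
with all variations of `Z`, into the kernel of `θ` at the endpoint: along the solution the value
`m` of `θ` on a variation satisfies the linear equation `m' = h m`. -/
theorem exists_characteristic_flow [CompleteSpace P] {O : Set Q} (hO : IsOpen O) {q₀ : Q}
    (hq₀ : q₀ ∈ O) {V : Q → P →L[ℝ] Q} (hV : ContDiffOn ℝ ∞ V O) {θ : Q → Q →L[ℝ] ℝ}
    (hθ : ContDiffOn ℝ ∞ θ O) {h : Q → P → ℝ} (hh : ∀ Z, ContinuousOn (fun q => h q Z) O)
    (hker : ∀ q ∈ O, ∀ Z, θ q (V q Z) = 0)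
    (hchar : ∀ q ∈ O, ∀ Z Y, fderiv ℝ θ q (V q Z) Y - fderiv ℝ θ q Y (V q Z) = h q Z * θ q Y) :
    ∃ (W : Set (Q × P)) (Ψ : Q × P → Q), IsOpen W ∧ (q₀, 0) ∈ W ∧ ContDiffOn ℝ ∞ Ψ W ∧
      MapsTo Ψ W O ∧ Ψ (q₀, 0) = q₀ ∧ (∀ δ, fderiv ℝ Ψ (q₀, 0) δ = δ.1 + V q₀ δ.2) ∧
      ∀ p ∈ W, ∀ δ : Q × P, θ p.1 δ.1 = 0 → θ (Ψ p) (fderiv ℝ Ψ p δ) = 0 := by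
  have : CompleteSpace Q := FiniteDimensional.complete ℝ Q
  -- solve for a globally defined extension `V'` of the germ of `V`, and keep the solutions that
  -- stay where `V'` agrees with `V`
  obtain ⟨V', hV', hVV'⟩ := exists_contDiff_eventuallyEq hO hq₀ hV
  obtain ⟨O', hO'V, hO', hq₀'⟩ := eventually_nhds_iff.1 (hVV'.and (hO.mem_nhds hq₀))
  obtain ⟨W₀, y, hW₀, hmem, hy, hy0, hsol⟩ := exists_smooth_solution hV' q₀
  have hopen : IsOpen {α : C(unitInterval, Q) | MapsTo α univ O'} :=
    ContinuousMap.isOpen_setOfPred_mapsTo isCompact_univ hO'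
  set W := W₀ ∩ y ⁻¹' {α : C(unitInterval, Q) | MapsTo α univ O'} with hWdef
  have hW : IsOpen W := hy.continuousOn.isOpen_inter_preimage hW₀ hopen
  set ev : C(unitInterval, Q) →L[ℝ] Q := ContinuousMap.evalCLM ℝ 1 with hev
  have hyO : ∀ p ∈ W, ∀ t, y p t ∈ O' := fun p hp t => hp.2 (mem_univ t)
  have hyW : ContDiffOn ℝ ∞ y W := hy.mono inter_subset_left
  have hderiv : ∀ p ∈ W, ∀ δ, fderiv ℝ (fun p => ev (y p)) p δ = fderiv ℝ y p δ 1 := by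
    intro p hp δ
    have h1 : HasFDerivAt y (fderiv ℝ y p) p :=
      ((hyW.contDiffAt (hW.mem_nhds hp)).differentiableAt (by simp)).hasFDerivAt
    have h2 := (ev.hasFDerivAt.comp p h1).fderiv
    exact congrArg (fun L => L δ) h2
  have hmemW : (q₀, (0 : P)) ∈ W := by
    refine ⟨hmem, ?_⟩
    rw [mem_preimage, hy0]
    intro t _
    exact hq₀'
  refine ⟨W, fun p => ev (y p), hW, hmemW, ev.contDiff.comp_contDiffOn hyW, ?_, ?_, ?_, ?_⟩
  · intro p hp
    exact (hO'V _ (hyO p hp 1)).2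
  · simp [hy0, hev]
  · intro δ
    rw [hderiv _ hmemW, fderiv_solution_eq hV' hW₀ hy hsol hmem]
    have hz : fderiv ℝ (fun p : C(unitInterval, Q) × P => velocity hV' p.1 p.2)
        (y (q₀, 0), (q₀, (0 : P)).2) (fderiv ℝ y (q₀, 0) δ, δ.2) = constantL Q (V q₀ δ.2) := by
      ext t
      rw [fderiv_velocity]
      simp [hy0, (hO'V _ hq₀').1]
    rw [hz]
    simp [primitiveL_apply]
  · intro p hp δ hδ
    simp only
    rw [hderiv _ hp]
    set J := fderiv ℝ y p δ with hJ
    set β := velocity hV' (y p) p.2 with hβ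
    set γ := fderiv ℝ (fun p : C(unitInterval, Q) × P => velocity hV' p.1 p.2) (y p, p.2)
      (J, δ.2) with hγ
    have hJeq : J = constantL Q δ.1 + primitiveL Q γ :=
      fderiv_solution_eq hV' hW₀ hy hsol hp.1 δ
    have hyeq : y p = constantL Q p.1 + primitiveL Q β := hsol p hp.1
    -- the solution and its variation, continued to the real line
    set yy : ℝ → Q := fun s => p.1 + ∫ τ in (0 : ℝ)..s, β (projIcc 0 1 zero_le_one τ) with hyy
    set jj : ℝ → Q := fun s => δ.1 + ∫ τ in (0 : ℝ)..s, γ (projIcc 0 1 zero_le_one τ) with hjj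
    have hyy' : ∀ t (ht : t ∈ Icc (0 : ℝ) 1), yy t = y p ⟨t, ht⟩ := by
      intro t ht
      rw [hyeq]
      simp [hyy, primitiveL_apply]
    have hjj' : ∀ t (ht : t ∈ Icc (0 : ℝ) 1), jj t = J ⟨t, ht⟩ := by
      intro t ht
      rw [hJeq]
      simp [hjj, primitiveL_apply]
    have hyyd : ∀ t, HasDerivAt yy (β (projIcc 0 1 zero_le_one t)) t :=
      hasDerivAt_add_primitive _ _
    have hjjd : ∀ t, HasDerivAt jj (γ (projIcc 0 1 zero_le_one t)) t :=
      hasDerivAt_add_primitive _ _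
    have hyyO : ∀ t ∈ Icc (0 : ℝ) 1, yy t ∈ O' := fun t ht => by
      rw [hyy' t ht]; exact hyO p hp _
    have hm : ∀ t ∈ Icc (0 : ℝ) 1, HasDerivAt (fun t => θ (yy t) (jj t))
        (h (yy t) p.2 * θ (yy t) (jj t)) t := by
      intro t ht
      have hO't := hyyO t ht
      obtain ⟨hVt, hOt⟩ := hO'V _ hO't
      have hθd : DifferentiableAt ℝ θ (yy t) :=
        (hθ.contDiffAt (hO.mem_nhds hOt)).differentiableAt (by simp)
      have hVd : DifferentiableAt ℝ V' (yy t) := hV'.differentiable (by simp) _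
      have e1 : β (projIcc 0 1 zero_le_one t) = V' (yy t) p.2 := by
        rw [projIcc_of_mem zero_le_one ht, hβ, velocity_apply, hyy' t ht]
      have e2 : γ (projIcc 0 1 zero_le_one t) =
          fderiv ℝ V' (yy t) (jj t) p.2 + V' (yy t) δ.2 := by
        rw [projIcc_of_mem zero_le_one ht, hγ, fderiv_velocity, hyy' t ht, hjj' t ht]
      -- differentiate the identity `θ q (V q Z) = 0` in the direction `jj t`
      have e3 : fderiv ℝ θ (yy t) (jj t) (V' (yy t) p.2) +
          θ (yy t) (fderiv ℝ V' (yy t) (jj t) p.2) = 0 := by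
        have hd := hθd.hasFDerivAt.clm_apply
          (hVd.hasFDerivAt.clm_apply (hasFDerivAt_const p.2 (yy t)))
        have hz : (fun q => θ q (V' q p.2)) =ᶠ[𝓝 (yy t)] fun _ => 0 := by
          filter_upwards [hO'.mem_nhds hO't] with q hq
          rw [(hO'V q hq).1]
          exact hker q (hO'V q hq).2 p.2
        have hd' := hd.congr_of_eventuallyEq hz.symm
        have := congrArg (fun L => L (jj t)) (hd'.unique (hasFDerivAt_const (0 : ℝ) (yy t)))
        simp at this
        linarith
      have hd : HasDerivAt (fun t => θ (yy t) (jj t))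
          (fderiv ℝ θ (yy t) (β (projIcc 0 1 zero_le_one t)) (jj t) +
            θ (yy t) (γ (projIcc 0 1 zero_le_one t))) t :=
        (hθd.hasFDerivAt.comp_hasDerivAt t (hyyd t)).clm_apply (hjjd t)
      convert hd using 1
      have e4 := hchar _ hOt p.2 (jj t)
      have e5 := hker _ hOt δ.2
      rw [hVt] at e1 e2 e3
      rw [e1, e2, (θ (yy t)).map_add (fderiv ℝ V' (yy t) (jj t) p.2)]
      linarith
    obtain ⟨C, hC⟩ : ∃ C, ∀ t ∈ Icc (0 : ℝ) 1, ‖h (yy t) p.2‖ ≤ C := by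
      have hc : ContinuousOn (fun t => h (yy t) p.2) (Icc (0 : ℝ) 1) :=
        (hh p.2).comp (fun t _ => (hyyd t).continuousAt.continuousWithinAt)
          fun t ht => (hO'V _ (hyyO t ht)).2
      exact isCompact_Icc.exists_bound_of_continuousOn hc
    have hzero := eq_zero_of_abs_deriv_le_mul_abs_self_of_eq_zero_right
      (f := fun t => θ (yy t) (jj t)) (f' := fun t => h (yy t) p.2 * θ (yy t) (jj t)) (K := C)
      (a := 0) (b := 1) (fun t ht => (hm t ht).continuousAt.continuousWithinAt)
      (fun t ht => (hm t (Ico_subset_Icc_self ht)).hasDerivWithinAt)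
      (by simpa [hyy, hjj] using hδ)
      (fun t ht => by
        rw [norm_mul]
        exact mul_le_mul_of_nonneg_right (hC t (Ico_subset_Icc_self ht)) (norm_nonneg _))
      1 (right_mem_Icc.2 zero_le_one)
    simp only [hyy' 1 (right_mem_Icc.2 zero_le_one), hjj' 1 (right_mem_Icc.2 zero_le_one)] at hzero
    exact hzero

end CharacteristicFlow

/-! ### The method of characteristics for a one-parameter family of 1-forms -/

section Foliation

/-- A nonzero functional vanishing on the kernel of `ξ` is proportional to `ξ`. -/
theorem exists_eq_smul_of_ker_le {E : Type*} [AddCommGroup E] [Module ℝ E] [TopologicalSpace E]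
    {ξ η : E →L[ℝ] ℝ} (hη : η ≠ 0) (h : ∀ X, ξ X = 0 → η X = 0) : ∃ c : ℝ, c ≠ 0 ∧ ξ = c • η := by
  obtain ⟨X₀, hX₀⟩ : ∃ X, η X ≠ 0 := by
    by_contra hcon
    push Not at hcon
    exact hη (ContinuousLinearMap.ext fun X => by simp [hcon X])
  have hξ : ξ X₀ ≠ 0 := fun h0 => hX₀ (h _ h0)
  refine ⟨ξ X₀ / η X₀, div_ne_zero hξ hX₀, ContinuousLinearMap.ext fun X => ?_⟩
  have h1 : η (X - (ξ X / ξ X₀) • X₀) = 0 := h _ (by simp [hξ])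
  simp only [map_sub, map_smul, smul_eq_mul, sub_eq_zero] at h1
  simp only [smul_apply, smul_eq_mul, h1]
  field_simp

variable {E : Type} [NormedAddCommGroup E] [NormedSpace ℝ E] [FiniteDimensional ℝ E]

/-- Let `Ω(x, λ)` be a family of 1-forms with `λ`-derivative `Ω'`, such that `dΩ(λ)` vanishes on
`ker Ω(λ) ∩ ker Ω'(λ)`. Then for every `(x₀, λ₀)` there are functions `f` and `Λ` near `x₀`
with `df` proportional to `Ω(Λ)` and `Λ(x₀) = λ₀`: the level sets of `f` are hypersurfaces tangent
to the hyperplanes `ker Ω(Λ)`. The vectors `e`, `e'` are dual to `Ω'`, `Ω`.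

This is the method of characteristics: on the space of pairs `(x, λ)` the form `Ω` has
characteristic directions projecting onto `ker Ω ∩ ker Ω'`; a solution on a surface transversal
to them, which is obtained from the implicit function theorem, is spread along the
characteristics. -/
theorem exists_function_fderiv_proportional {O : Set (E × ℝ)} (hO : IsOpen O) {x₀ : E} {l₀ : ℝ}
    (hmem : (x₀, l₀) ∈ O) {Ω Ω' : E × ℝ → E →L[ℝ] ℝ} {e e' : E × ℝ → E}
    (hΩ : ContDiffOn ℝ ∞ Ω O) (hΩ' : ContDiffOn ℝ ∞ Ω' O) (he : ContDiffOn ℝ ∞ e O)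
    (he' : ContDiffOn ℝ ∞ e' O) (hderiv : ∀ q ∈ O, fderiv ℝ Ω q (0, 1) = Ω' q)
    (h00 : ∀ q ∈ O, Ω q (e q) = 0) (h10 : ∀ q ∈ O, Ω' q (e q) = 1)
    (h01 : ∀ q ∈ O, Ω q (e' q) = 1) (h11 : ∀ q ∈ O, Ω' q (e' q) = 0)
    (hint : ∀ q ∈ O, ∀ X Y, Ω q X = 0 → Ω' q X = 0 → Ω q Y = 0 → Ω' q Y = 0 →
      fderiv ℝ Ω q (X, 0) Y = fderiv ℝ Ω q (Y, 0) X) :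
    ∃ (U : Set E) (f Λ : E → ℝ), IsOpen U ∧ x₀ ∈ U ∧ ContDiffOn ℝ ∞ f U ∧ ContinuousOn Λ U ∧
      Λ x₀ = l₀ ∧ ∀ x ∈ U, (x, Λ x) ∈ O ∧ ∃ r : ℝ, r ≠ 0 ∧ fderiv ℝ f x = r • Ω (x, Λ x) := by
  have : CompleteSpace E := FiniteDimensional.complete ℝ E
  -- the projection onto `ker Ω ∩ ker Ω'`
  set π : E × ℝ → E →L[ℝ] E := fun q =>
    ContinuousLinearMap.id ℝ E - (Ω q).smulRight (e' q) - (Ω' q).smulRight (e q) with hπ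
  have hπa : ∀ q Z, π q Z = Z - Ω q Z • e' q - Ω' q Z • e q := fun q Z => by simp [hπ]
  have hπ0 : ∀ q ∈ O, ∀ Z, Ω q (π q Z) = 0 := fun q hq Z => by
    simp [hπa, h00 q hq, h01 q hq]
  have hπ1 : ∀ q ∈ O, ∀ Z, Ω' q (π q Z) = 0 := fun q hq Z => by
    simp [hπa, h10 q hq, h11 q hq]
  have hdΩ : ContDiffOn ℝ ∞ (fderiv ℝ Ω) O := hΩ.fderiv_of_isOpen hO (by simp)
  have hπs : ContDiffOn ℝ ∞ π O :=
    (contDiffOn_const.sub (hΩ.smulRight he')).sub (hΩ'.smulRight he)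
  -- the contraction of `dΩ(λ)` with the vector `v`
  set B : E × ℝ → E → E →L[ℝ] ℝ := fun q v =>
    (ContinuousLinearMap.apply ℝ ℝ v).comp
      ((fderiv ℝ Ω q).comp (ContinuousLinearMap.inl ℝ E ℝ)) - fderiv ℝ Ω q (v, 0) with hB
  have hBa : ∀ q v X, B q v X = fderiv ℝ Ω q (X, 0) v - fderiv ℝ Ω q (v, 0) X := fun q v X => by
    simp [hB]
  have hBs : ∀ v : E × ℝ → E, ContDiffOn ℝ ∞ v O → ContDiffOn ℝ ∞ (fun q => B q (v q)) O := by
    intro v hv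
    have h0 : ContDiff ℝ ∞ fun v : E => ContinuousLinearMap.apply ℝ ℝ v := by fun_prop
    have h1 : ContDiffOn ℝ ∞ (fun q => ContinuousLinearMap.apply ℝ ℝ (v q)) O :=
      h0.comp_contDiffOn hv
    exact (h1.clm_comp (hdΩ.clm_comp contDiffOn_const)).sub
      (hdΩ.clm_apply (hv.prodMk contDiffOn_const))
  -- the characteristic vector over `π q Z`
  set V : E × ℝ → E →L[ℝ] E × ℝ := fun q =>
    (ContinuousLinearMap.inl ℝ E ℝ).comp (π q) -
      (ContinuousLinearMap.inr ℝ E ℝ).comp ((B q (e q)).comp (π q)) with hV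
  have hVs : ContDiffOn ℝ ∞ V O :=
    (contDiffOn_const.clm_comp hπs).sub (contDiffOn_const.clm_comp ((hBs e he).clm_comp hπs))
  set θ : E × ℝ → E × ℝ →L[ℝ] ℝ := fun q => (Ω q).comp (ContinuousLinearMap.fst ℝ E ℝ) with hθ
  have hθs : ContDiffOn ℝ ∞ θ O := hΩ.clm_comp contDiffOn_const
  have hdiff : ∀ q ∈ O, HasFDerivAt Ω (fderiv ℝ Ω q) q := fun q hq =>
    ((hΩ.contDiffAt (hO.mem_nhds hq)).differentiableAt (by simp)).hasFDerivAt
  have hθd : ∀ q ∈ O, ∀ X Y, fderiv ℝ θ q X Y = fderiv ℝ Ω q X Y.1 := by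
    intro q hq X Y
    have h1 := (hdiff q hq).clm_comp
      (hasFDerivAt_const (ContinuousLinearMap.fst ℝ E ℝ) q)
    rw [show fderiv ℝ θ q = _ from h1.fderiv]
    simp
  have hsplit : ∀ q ∈ O, ∀ (X : E) (μ : ℝ),
      fderiv ℝ Ω q (X, μ) = fderiv ℝ Ω q (X, 0) + μ • Ω' q := by
    intro q hq X μ
    rw [← hderiv q hq, ← map_smul, ← map_add]
    simp
  obtain ⟨W, Ψ, hW, hmemW, hΨ, hΨO, hΨ0, hΨd, hΨk⟩ := exists_characteristic_flow (P := E) hO hmem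
    hVs hθs (h := fun q Z => B q (e' q) (π q Z))
    (fun Z => ((hBs e' he').clm_apply (hπs.clm_apply contDiffOn_const)).continuousOn)
    (fun q hq Z => by simp [hθ, hV, hπ0 q hq])
    (by
      intro q hq Z Y
      set X := π q Z with hX
      have hX0 := hπ0 q hq Z
      have hX1 := hπ1 q hq Z
      have hi := hint q hq X (π q Y.1) hX0 hX1 (hπ0 q hq _) (hπ1 q hq _)
      have e1 : V q Z = (X, -(B q (e q) X)) := by simp [hV, hX]
      rw [hθd q hq, hθd q hq, e1, hsplit q hq X, ← Prod.mk.eta (p := Y), hsplit q hq Y.1]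
      simp only [hπa q Y.1, hθ, ContinuousLinearMap.comp_apply, ContinuousLinearMap.coe_fst',
        add_apply, smul_apply, smul_eq_mul, hBa] at hi ⊢
      have hlin : fderiv ℝ Ω q (Y.1 - Ω q Y.1 • e' q - Ω' q Y.1 • e q, 0) =
          fderiv ℝ Ω q (Y.1, 0) - Ω q Y.1 • fderiv ℝ Ω q (e' q, 0)
            - Ω' q Y.1 • fderiv ℝ Ω q (e q, 0) := by
        rw [← map_smul, ← map_smul, ← map_sub, ← map_sub]
        simp
      rw [hlin] at hi
      simp only [map_sub, map_smul, smul_eq_mul, sub_apply,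
        smul_apply] at hi
      rw [hX1]
      linear_combination hi)
  -- `F (y, l)` consists of the endpoint in `E` of the characteristic over `π (x₀, l₀) y` issuing
  -- from `(x₀ + S y, l)`, and of the value `Ω (x₀ + S y, l) e₀`, whose vanishing determines `l`
  -- along the transversal surface `x₀ + S y`
  set o := Ω (x₀, l₀)
  set o' := Ω' (x₀, l₀)
  set e₀ := e (x₀, l₀)
  set e₀' := e' (x₀, l₀)
  set S : E →L[ℝ] E := o.smulRight e₀' + o'.smulRight e₀ with hS
  have hSa : ∀ y, S y = o y • e₀' + o' y • e₀ := fun y => by simp [hS]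
  have hπS : ∀ y, π (x₀, l₀) y = y - S y := fun y => by rw [hπa, hSa]; abel
  set A : E × ℝ → (E × ℝ) × E := fun z => ((x₀ + S z.1, z.2), π (x₀, l₀) z.1) with hA
  have hAs : ContDiff ℝ ∞ A := by
    refine ContDiff.prodMk (ContDiff.prodMk ?_ contDiff_snd) ?_ <;> fun_prop
  have hAd : ∀ z, HasFDerivAt A (((S.comp (ContinuousLinearMap.fst ℝ E ℝ)).prod
      (ContinuousLinearMap.snd ℝ E ℝ)).prod
        ((π (x₀, l₀)).comp (ContinuousLinearMap.fst ℝ E ℝ))) z := by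
    intro z
    exact (((S.hasFDerivAt.comp z hasFDerivAt_fst).const_add x₀).prodMk hasFDerivAt_snd).prodMk
      ((π (x₀, l₀)).hasFDerivAt.comp z hasFDerivAt_fst)
  have hA0 : A (0, l₀) = ((x₀, l₀), 0) := by simp [hA]
  set D : Set (E × ℝ) := A ⁻¹' (W ∩ Prod.fst ⁻¹' O) with hD
  have hDo : IsOpen D := (hW.inter (hO.preimage continuous_fst)).preimage hAs.continuous
  have hD0 : (0, l₀) ∈ D := by
    rw [hD, mem_preimage, hA0]
    exact ⟨hmemW, hmem⟩
  set F : E × ℝ → E × ℝ := fun z => ((Ψ (A z)).1, Ω (A z).1 e₀) with hF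
  have hFs : ContDiffOn ℝ ∞ F D := by
    refine ContDiffOn.prodMk (contDiff_fst.comp_contDiffOn
      (hΨ.comp hAs.contDiffOn fun z hz => hz.1)) ?_
    exact (hΩ.comp (contDiff_fst.comp hAs).contDiffOn fun z hz => hz.2).clm_apply contDiffOn_const
  have hFd : ∀ z ∈ D, ∀ δ : E × ℝ, fderiv ℝ F z δ =
      ((fderiv ℝ Ψ (A z) ((S δ.1, δ.2), π (x₀, l₀) δ.1)).1,
        fderiv ℝ Ω (A z).1 (S δ.1, δ.2) e₀) := by
    intro z hz δ
    have h1 : HasFDerivAt Ψ (fderiv ℝ Ψ (A z)) (A z) :=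
      ((hΨ.contDiffAt (hW.mem_nhds hz.1)).differentiableAt (by simp)).hasFDerivAt
    have h2 := (hasFDerivAt_fst (𝕜 := ℝ)).comp z (h1.comp z (hAd z))
    have h3 := ((hdiff _ hz.2).comp z ((hasFDerivAt_fst (𝕜 := ℝ)).comp z (hAd z))).clm_apply
      (hasFDerivAt_const e₀ z)
    rw [show fderiv ℝ F z = _ from (h2.prodMk h3).fderiv]
    simp
  -- the derivative of `F` at `(0, l₀)` is the shear `(y, l) ↦ (y, l + c y)`
  set c : E →L[ℝ] ℝ :=
    (((fderiv ℝ Ω (x₀, l₀)).comp (ContinuousLinearMap.inl ℝ E ℝ)).flip e₀).comp S with hc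
  set T : (E × ℝ) ≃L[ℝ] (E × ℝ) := ContinuousLinearEquiv.equivOfInverse
    ((ContinuousLinearMap.fst ℝ E ℝ).prod (ContinuousLinearMap.snd ℝ E ℝ +
      c.comp (ContinuousLinearMap.fst ℝ E ℝ)))
    ((ContinuousLinearMap.fst ℝ E ℝ).prod (ContinuousLinearMap.snd ℝ E ℝ -
      c.comp (ContinuousLinearMap.fst ℝ E ℝ)))
    (fun z => by ext <;> simp) (fun z => by ext <;> simp) with hT
  have hF0 : HasFDerivAt F (T : E × ℝ →L[ℝ] E × ℝ) (0, l₀) := by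
    have h1 := ((hFs.contDiffAt (hDo.mem_nhds hD0)).differentiableAt (by simp)).hasFDerivAt
    suffices fderiv ℝ F (0, l₀) = T by rwa [this] at h1
    refine ContinuousLinearMap.ext fun δ => ?_
    rw [hFd _ hD0, hA0, hΨd, hsplit _ hmem]
    have hπ2 : π (x₀, l₀) (π (x₀, l₀) δ.1) = π (x₀, l₀) δ.1 := by
      rw [hπa _ (π (x₀, l₀) δ.1), hπ0 _ hmem, hπ1 _ hmem]
      simp
    refine Prod.ext ?_ ?_
    · simp [hV, hT, hπ2]
      rw [hπS]
      abel
    · simp [hT, hc, show Ω' (x₀, l₀) e₀ = 1 from h10 _ hmem]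
      ring
  obtain ⟨Θ, hΘ0, hΘD, hΘF, hΘs⟩ := exists_smooth_localInverse hDo hD0 hFs hF0
  have hF00 : F (0, l₀) = (x₀, 0) := by
    simp only [hF, hA0, hΨ0]
    rw [show Ω (x₀, l₀) e₀ = 0 from h00 _ hmem]
  have hj : ContDiff ℝ ∞ fun x : E => (x, (0 : ℝ)) := contDiff_id.prodMk contDiff_const
  set U : Set E := (fun x : E => (x, (0 : ℝ))) ⁻¹' Θ.target with hU
  have hUo : IsOpen U := Θ.open_target.preimage hj.continuous
  have hζ : ContDiffOn ℝ ∞ (fun x => Θ.symm (x, 0)) U := hΘs.comp hj.contDiffOn fun x hx => hx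
  have hzD : ∀ x ∈ U, Θ.symm (x, 0) ∈ D := fun x hx => hΘD (Θ.map_target hx)
  have hright : ∀ x ∈ U, F (Θ.symm (x, 0)) = (x, 0) := fun x hx => by
    rw [← hΘF]; exact Θ.right_inv hx
  have hΘx₀ : Θ.symm (x₀, 0) = (0, l₀) := by rw [← hF00, ← hΘF]; exact Θ.left_inv hΘ0
  refine ⟨U, fun x => o (Θ.symm (x, 0)).1, fun x => (Ψ (A (Θ.symm (x, 0)))).2, hUo, ?_, ?_, ?_,
    ?_, ?_⟩
  · rw [hU, mem_preimage, ← hF00, ← hΘF]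
    exact Θ.map_source hΘ0
  · exact o.contDiff.comp_contDiffOn (contDiff_fst.comp_contDiffOn hζ)
  · refine continuous_snd.comp_continuousOn
      (hΨ.continuousOn.comp (hAs.continuous.comp_continuousOn hζ.continuousOn) ?_)
    intro x hx
    exact (hzD x hx).1
  · simp only
    rw [hΘx₀, hA0, hΨ0]
  · intro x hx
    set z := Θ.symm (x, 0) with hz
    have hz1 : (Ψ (A z)).1 = x := congrArg Prod.fst (hright x hx)
    have hz2 : Ω (A z).1 e₀ = 0 := congrArg Prod.snd (hright x hx)
    have hΨz : (x, (Ψ (A z)).2) = Ψ (A z) := Prod.ext hz1.symm rfl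
    have hmemO : (x, (Ψ (A z)).2) ∈ O := by rw [hΨz]; exact hΨO (hzD x hx).1
    refine ⟨hmemO, ?_⟩
    have hne : Ω (x, (Ψ (A z)).2) ≠ 0 := fun h0 => by
      have := h01 _ hmemO
      rw [h0] at this
      simp at this
    refine exists_eq_smul_of_ker_le hne fun X hX => ?_
    have hζd : HasFDerivAt (fun x => Θ.symm (x, 0)) (fderiv ℝ (fun x => Θ.symm (x, 0)) x) x :=
      ((hζ.contDiffAt (hUo.mem_nhds hx)).differentiableAt (by simp)).hasFDerivAt
    set δ := fderiv ℝ (fun x => Θ.symm (x, 0)) x X with hδ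
    have h1 : o δ.1 = 0 := by
      have h2 := (o.hasFDerivAt.comp x ((hasFDerivAt_fst (𝕜 := ℝ)).comp x hζd)).fderiv
      have h3 := congrArg (fun L => L X) h2
      simp only [ContinuousLinearMap.comp_apply, ContinuousLinearMap.coe_fst'] at h3
      rw [← h3]
      exact hX
    have h2 : fderiv ℝ F z δ = (X, 0) := by
      have hFz : HasFDerivAt F (fderiv ℝ F z) z :=
        ((hFs.contDiffAt (hDo.mem_nhds (hzD x hx))).differentiableAt (by simp)).hasFDerivAt
      have h3 := hFz.comp x hζd
      have h4 : HasFDerivAt (fun x : E => (x, (0 : ℝ))) (ContinuousLinearMap.inl ℝ E ℝ) x :=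
        (ContinuousLinearMap.inl ℝ E ℝ).hasFDerivAt
      have h5 := h4.congr_of_eventuallyEq (f₁ := F ∘ fun x => Θ.symm (x, 0))
        (by filter_upwards [hUo.mem_nhds hx] with x' hx'; exact hright x' hx')
      have h6 := congrArg (fun L => L X) (h3.unique h5)
      simpa using h6
    rw [hFd z (hzD x hx)] at h2
    have h3 := hΨk (A z) (hzD x hx).1 ((S δ.1, δ.2), π (x₀, l₀) δ.1) (by
      simp only [hθ, ContinuousLinearMap.comp_apply, ContinuousLinearMap.coe_fst', hSa, h1]
      simp [hz2])
    rw [hΨz]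
    simp only [hθ, ContinuousLinearMap.comp_apply, ContinuousLinearMap.coe_fst'] at h3
    rwa [congrArg Prod.fst h2] at h3

end Foliation

/-! ### Hypersurfaces given by an equation -/

section Hypersurface

variable {E : Type*} [NormedAddCommGroup E] [NormedSpace ℝ E] [CompleteSpace E]

/-- A function vanishing on the hypersurface `g = 0` has differential proportional to `dg` there. -/
theorem exists_fderiv_eq_smul_of_vanishing {g τ : E → ℝ} {x : E} (hg : ContDiffAt ℝ 1 g x)
    (hgx : g x = 0) (hdg : fderiv ℝ g x ≠ 0) (hτ : ContDiffAt ℝ 1 τ x)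
    (h : ∀ᶠ y in 𝓝 x, g y = 0 → τ y = 0) : ∃ a : ℝ, fderiv ℝ τ x = a • fderiv ℝ g x := by
  have hτx : τ x = 0 := h.self_of_nhds hgx
  have hext : IsLocalExtrOn τ {y | g y = g x} x := by
    left
    filter_upwards [nhdsWithin_le_nhds h, self_mem_nhdsWithin] with y hy hy'
    rw [hτx, hy (by rw [← hgx]; exact hy')]
  obtain ⟨a, b, hab, hsum⟩ := hext.exists_multipliers_of_hasStrictFDerivAt_1d
    (hg.hasStrictFDerivAt (by simp)) (hτ.hasStrictFDerivAt (by simp))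
  have hb : b ≠ 0 := by
    rintro rfl
    rw [zero_smul, add_zero] at hsum
    rcases smul_eq_zero.1 hsum with ha | ha
    · exact hab (by rw [ha]; rfl)
    · exact hdg ha
  refine ⟨-(a / b), ?_⟩
  have h1 : b • fderiv ℝ τ x = b • (-(a / b)) • fderiv ℝ g x := by
    rw [smul_smul, mul_neg, mul_div_cancel₀ _ hb, neg_smul]
    exact eq_neg_of_add_eq_zero_right hsum
  exact smul_right_injective _ hb h1

/-- If the hypersurface `g = 0` has conormals proportional to the 1-form `w`, then `dw` vanishes on
its tangent spaces. -/
theorem fderiv_symm_of_proportional {g c : E → ℝ} {w : E → E →L[ℝ] ℝ} {x : E}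
    (hg : ContDiffAt ℝ ∞ g x) (hgx : g x = 0) (hdg : fderiv ℝ g x ≠ 0) (hc : ContDiffAt ℝ ∞ c x)
    (hw : ContDiffAt ℝ ∞ w x) (h : ∀ᶠ y in 𝓝 x, g y = 0 → fderiv ℝ g y = c y • w y) {X Y : E}
    (hX : fderiv ℝ g x X = 0) (hY : fderiv ℝ g x Y = 0) :
    fderiv ℝ w x X Y = fderiv ℝ w x Y X := by
  have hx : fderiv ℝ g x = c x • w x := h.self_of_nhds hgx
  have hcx : c x ≠ 0 := fun h0 => hdg (by rw [hx, h0, zero_smul])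
  have hker : ∀ Z, fderiv ℝ g x Z = 0 → w x Z = 0 := fun Z hZ => by
    rw [hx] at hZ
    exact (mul_eq_zero.1 hZ).resolve_left hcx
  have hdg' : ContDiffAt ℝ ∞ (fderiv ℝ g) x := hg.fderiv_right (by simp)
  have key : ∀ Z T, fderiv ℝ g x Z = 0 → fderiv ℝ g x T = 0 →
      fderiv ℝ (fderiv ℝ g) x T Z = c x * fderiv ℝ w x T Z := by
    intro Z T hZ hT
    have hτ : ContDiffAt ℝ ∞ (fun y => fderiv ℝ g y Z - c y * w y Z) x :=
      (hdg'.clm_apply contDiffAt_const).sub (hc.mul (hw.clm_apply contDiffAt_const))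
    obtain ⟨a, ha⟩ := exists_fderiv_eq_smul_of_vanishing (hg.of_le (by simp)) hgx hdg
      (hτ.of_le (by simp)) (by
        filter_upwards [h] with y hy hgy
        simp [hy hgy])
    have h1 := ((hdg'.differentiableAt (by simp)).hasFDerivAt.clm_apply
      (hasFDerivAt_const Z x)).sub ((hc.differentiableAt (by simp)).hasFDerivAt.mul
        ((hw.differentiableAt (by simp)).hasFDerivAt.clm_apply (hasFDerivAt_const Z x)))
    have h2 := congrArg (fun L => L T) (h1.fderiv.symm.trans ha)
    simp [hT, hker Z hZ] at h2
    linarith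
  have hsymm : IsSymmSndFDerivAt ℝ g x := hg.isSymmSndFDerivAt (by
    simp only [minSmoothness_of_isRCLikeNormedField]
    exact WithTop.coe_le_coe.2 (le_top (a := (2 : ℕ∞))))
  have h1 := key Y X hY hX
  have h2 := key X Y hX hY
  rw [hsymm X Y] at h1
  exact mul_left_cancel₀ hcx (h1.symm.trans h2)

end Hypersurface

/-! ### Rational normal curves through given points -/

section RationalNormalCurve

variable {n : ℕ} {F : Type*} [AddCommGroup F] [Module ℝ F]

/-- The rational normal curve with coefficients `w`, in homogeneous coordinates `(s, t)`. -/
def rnc (w : Fin n → F) (s t : ℝ) : F :=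
  ∑ i : Fin n, (s ^ (i : ℕ) * t ^ (n - 1 - (i : ℕ))) • w i

/-- The homogeneous Lagrange basis polynomials with nodes `p`. -/
def lagrangeForm (p : Fin n → ℝ) (k : Fin n) (s t : ℝ) : ℝ :=
  ∏ j ∈ Finset.univ.erase k, (s - t * p j) / (p k - p j)

/-- Lagrange interpolation of the monomials, in homogeneous form. -/
theorem pow_mul_pow_eq_sum_lagrangeForm {p : Fin n → ℝ} (hp : Function.Injective p) (i : Fin n)
    (s t : ℝ) :
    s ^ (i : ℕ) * t ^ (n - 1 - (i : ℕ)) = ∑ k, lagrangeForm p k s t * p k ^ (i : ℕ) := by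
  -- both sides are continuous in `t`, so that it suffices to treat `t ≠ 0`
  have hcont : Continuous fun t : ℝ => ∑ k, lagrangeForm p k s t * p k ^ (i : ℕ) := by
    unfold lagrangeForm
    refine continuous_finsetSum _ fun k _ => (continuous_finsetProd _ fun j _ => ?_).mul
      continuous_const
    exact (continuous_const.sub (continuous_id.mul continuous_const)).div_const _
  have hcont' : Continuous fun t : ℝ => s ^ (i : ℕ) * t ^ (n - 1 - (i : ℕ)) := by fun_prop
  refine congrFun (hcont'.ext_on (dense_compl_singleton (0 : ℝ)) hcont ?_) t
  intro t ht
  have ht : t ≠ 0 := ht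
  have hdeg : ((Polynomial.X : Polynomial ℝ) ^ (i : ℕ)).degree <
      (Finset.univ : Finset (Fin n)).card := by
    rw [Polynomial.degree_X_pow, Finset.card_univ, Fintype.card_fin]
    exact_mod_cast i.2
  have h1 := Lagrange.eq_interpolate (v := p) (s := Finset.univ) (fun a _ b _ h => hp h) hdeg
  have h2 := congrArg (Polynomial.eval (s / t)) h1
  rw [Lagrange.interpolate_apply, Polynomial.eval_finsetSum] at h2
  simp only [Polynomial.eval_pow, Polynomial.eval_X, Polynomial.eval_mul, Polynomial.eval_C] at h2
  have h3 : ∀ k, lagrangeForm p k s t =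
      t ^ (n - 1) * (Lagrange.basis Finset.univ p k).eval (s / t) := by
    intro k
    rw [Lagrange.basis, Polynomial.eval_prod, lagrangeForm]
    have hcard : (Finset.univ.erase k).card = n - 1 := by simp
    rw [← hcard, ← Finset.prod_const, ← Finset.prod_mul_distrib]
    refine Finset.prod_congr rfl fun j _ => ?_
    rw [Lagrange.basisDivisor]
    simp only [Polynomial.eval_mul, Polynomial.eval_C, Polynomial.eval_sub, Polynomial.eval_X]
    field_simp
  simp only [h3]
  have h4 : n - 1 = (n - 1 - (i : ℕ)) + i := by have := i.2; omega
  calc s ^ (i : ℕ) * t ^ (n - 1 - (i : ℕ)) = t ^ (n - 1) * (s / t) ^ (i : ℕ) := by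
        conv_rhs => rw [h4, pow_add]
        rw [div_pow]
        field_simp
    _ = _ := by
        rw [h2, Finset.mul_sum]
        refine Finset.sum_congr rfl fun k _ => by ring

theorem rnc_eq_sum_lagrangeForm {p : Fin n → ℝ} (hp : Function.Injective p) (w : Fin n → F)
    (s t : ℝ) : rnc w s t = ∑ k, lagrangeForm p k s t • rnc w (p k) 1 := by
  simp only [rnc, one_pow, mul_one, Finset.smul_sum, smul_smul]
  rw [Finset.sum_comm]
  refine Finset.sum_congr rfl fun i _ => ?_
  rw [← Finset.sum_smul, pow_mul_pow_eq_sum_lagrangeForm hp]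

/-- Distinct points of a rational normal curve are linearly independent. -/
theorem linearIndependent_rnc {p : Fin n → ℝ} (hp : Function.Injective p) {w : Fin n → F}
    (hw : LinearIndependent ℝ w) : LinearIndependent ℝ fun k => rnc w (p k) 1 := by
  rw [Fintype.linearIndependent_iff] at hw ⊢
  intro g hg
  have h1 : ∑ i : Fin n, (∑ k, g k * p k ^ (i : ℕ)) • w i = 0 := by
    rw [← hg]
    simp only [rnc, one_pow, mul_one, Finset.smul_sum, smul_smul]
    rw [Finset.sum_comm]
    exact Finset.sum_congr rfl fun i _ => Finset.sum_smul
  have h2 := hw _ h1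
  have h3 : Matrix.vecMul g (Matrix.vandermonde p) = 0 := by
    ext i
    simpa [Matrix.vecMul, dotProduct, Matrix.vandermonde_apply] using h2 i
  have h4 := Matrix.eq_zero_of_vecMul_eq_zero
    (Matrix.det_vandermonde_ne_zero_iff.2 hp) h3
  exact fun i => congrFun h4 i

/-- Let `ξ k` (`k < n`), `η` and `ζ` be nonzero multiples of distinct points of a rational normal
curve, and let `a k` be the ratios of the coefficients of `η` and `ζ` in the basis `ξ`. Then the
curve is `(s, t) ↦ ∑ (∏_{j ≠ k} (s - t a_j)) u_k ξ_k`. The ratios `a k` are the images of the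
parameters of the `ξ k` under the projective transformation that sends the parameters of `η` and
`ζ` to `∞` and `0`, suitably scaled. -/
theorem coneOver_rnc_eq {p : Fin n → ℝ} (hp : Function.Injective p) {pu pv : ℝ}
    (hpu : ∀ k, pu ≠ p k) (hpv : ∀ k, pv ≠ p k) (huv : pu ≠ pv) {w : Fin n → F}
    (hw : LinearIndependent ℝ w) {ξ : Fin n → F} {η ζ : F} {r : Fin n → ℝ} {ru rv : ℝ}
    (hr : ∀ k, r k ≠ 0) (hru : ru ≠ 0) (hrv : rv ≠ 0) (hξ : ∀ k, ξ k = r k • rnc w (p k) 1)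
    (hη : η = ru • rnc w pu 1) (hζ : ζ = rv • rnc w pv 1) {u v : Fin n → ℝ}
    (hu : η = ∑ k, u k • ξ k) (hv : ζ = ∑ k, v k • ξ k) :
    (∀ k, u k ≠ 0) ∧ (∀ k, v k ≠ 0) ∧ (∀ i j, i ≠ j → u i / v i ≠ u j / v j) ∧
      coneOver (rnc w) = coneOver fun s t : ℝ =>
        ∑ k, ((∏ j ∈ Finset.univ.erase k, (s - t * (u j / v j))) * u k) • ξ k := by
  have hind := linearIndependent_rnc hp hw
  -- the coordinates of a multiple of a point of the curve, by interpolation at the nodes `p`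
  have coef : ∀ {q rq : ℝ} {θ : F} {c : Fin n → ℝ}, θ = rq • rnc w q 1 → θ = ∑ k, c k • ξ k →
      ∀ k, c k = rq / r k * lagrangeForm p k q 1 := by
    intro q rq θ c h1 h2 k
    have h3 : ∑ k, (c k * r k) • rnc w (p k) 1 =
        ∑ k, (rq * lagrangeForm p k q 1) • rnc w (p k) 1 := by
      calc _ = θ := by
            rw [h2]
            exact Finset.sum_congr rfl fun k _ => by rw [hξ, smul_smul]
        _ = _ := by
            rw [h1, rnc_eq_sum_lagrangeForm hp w q 1, Finset.smul_sum]
            exact Finset.sum_congr rfl fun k _ => by rw [smul_smul]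
    have h4 := Fintype.linearIndependent_iff.1 hind
      (fun k => c k * r k - rq * lagrangeForm p k q 1) (by
        simp only [sub_smul, Finset.sum_sub_distrib]
        rw [h3, sub_self]) k
    have := hr k
    field_simp
    linarith
  have hpk : ∀ k, ∀ j ∈ Finset.univ.erase k, p k - p j ≠ 0 := fun k j hj h0 =>
    Finset.ne_of_mem_erase hj (hp (sub_eq_zero.1 h0)).symm
  have hLne : ∀ {q : ℝ}, (∀ k, q ≠ p k) → ∀ k, lagrangeForm p k q 1 ≠ 0 := by
    intro q hq k
    refine Finset.prod_ne_zero_iff.2 fun j hj => div_ne_zero ?_ (hpk k j hj)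
    rw [one_mul]
    exact sub_ne_zero.2 (hq j)
  have huk := coef hη hu
  have hvk := coef hζ hv
  have hu0 : ∀ k, u k ≠ 0 := fun k => by
    rw [huk]; exact mul_ne_zero (div_ne_zero hru (hr k)) (hLne hpu k)
  have hv0 : ∀ k, v k ≠ 0 := fun k => by
    rw [hvk]; exact mul_ne_zero (div_ne_zero hrv (hr k)) (hLne hpv k)
  have hpu' : ∀ k, pu - p k ≠ 0 := fun k => sub_ne_zero.2 (hpu k)
  have hpv' : ∀ k, pv - p k ≠ 0 := fun k => sub_ne_zero.2 (hpv k)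
  set C := ru / rv * ∏ j, (pu - p j) / (pv - p j) with hC
  have hC0 : C ≠ 0 := mul_ne_zero (div_ne_zero hru hrv)
    (Finset.prod_ne_zero_iff.2 fun j _ => div_ne_zero (hpu' j) (hpv' j))
  have ha : ∀ k, u k / v k = C * (pv - p k) / (pu - p k) := by
    intro k
    have h1 : lagrangeForm p k pu 1 / lagrangeForm p k pv 1 =
        ∏ j ∈ Finset.univ.erase k, (pu - p j) / (pv - p j) := by
      rw [lagrangeForm, lagrangeForm, ← Finset.prod_div_distrib]
      refine Finset.prod_congr rfl fun j hj => ?_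
      have := hpk k j hj
      have := hpv' j
      field_simp
    have h2 := Finset.mul_prod_erase Finset.univ (fun j => (pu - p j) / (pv - p j))
      (Finset.mem_univ k)
    rw [hC, ← h2, ← h1, huk, hvk]
    have := hLne hpv k
    have := hpu' k
    have := hpv' k
    have := hr k
    field_simp
  set D := C * (pv - pu) with hD
  have hD0 : D ≠ 0 := mul_ne_zero hC0 (sub_ne_zero.2 huv.symm)
  -- the curve in the new parameter `C (pv t - s) / (pu t - s)`
  have hN : ∀ s t : ℝ, ∑ k, ((∏ j ∈ Finset.univ.erase k,
      (C * (pv * t - s) - (pu * t - s) * (u j / v j))) * u k) • ξ k =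
      (D ^ (n - 1) * ru) • rnc w s t := by
    intro s t
    rw [rnc_eq_sum_lagrangeForm hp w s t, Finset.smul_sum]
    refine Finset.sum_congr rfl fun k _ => ?_
    rw [hξ, smul_smul, smul_smul]
    congr 1
    have h1 : ∀ j, C * (pv * t - s) - (pu * t - s) * (u j / v j) =
        D * ((s - t * p j) / (pu - p j)) := by
      intro j
      rw [ha, hD]
      have := hpu' j
      field_simp
      ring
    have hcard : (Finset.univ.erase k).card = n - 1 := by simp
    simp only [h1]
    rw [Finset.prod_mul_distrib, Finset.prod_const, hcard, huk, mul_assoc, mul_assoc]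
    have h2 : (∏ j ∈ Finset.univ.erase k, (s - t * p j) / (pu - p j)) * lagrangeForm p k pu 1 =
        lagrangeForm p k s t := by
      rw [lagrangeForm, lagrangeForm, ← Finset.prod_mul_distrib]
      refine Finset.prod_congr rfl fun j hj => ?_
      have := hpk k j hj
      have := hpu' j
      field_simp
    rw [← h2]
    have := hr k
    field_simp
  refine ⟨hu0, hv0, fun i j hij h => hij (hp ?_), ?_⟩
  · rw [ha, ha, div_eq_div_iff (hpu' i) (hpu' j)] at h
    have h1 : (pv - p i) * (pu - p j) = (pv - p j) * (pu - p i) :=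
      mul_left_cancel₀ hC0 (by linear_combination h)
    have h2 : (pv - pu) * (p j - p i) = 0 := by linear_combination -h1
    have h3 := (mul_eq_zero.1 h2).resolve_left (sub_ne_zero.2 huv.symm)
    linarith
  · have hDn : D ^ (n - 1) * ru ≠ 0 := mul_ne_zero (pow_ne_zero _ hD0) hru
    ext θ
    constructor
    · rintro ⟨c, s, t, hc, hst, rfl⟩
      refine ⟨c / (D ^ (n - 1) * ru), C * (pv * t - s), pu * t - s, div_ne_zero hc hDn, ?_, ?_⟩
      · by_contra hcon
        push Not at hcon
        have h1 := (mul_eq_zero.1 hcon.1).resolve_left hC0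
        have h2 : (pv - pu) * t = 0 := by linear_combination h1 - hcon.2
        have h3 := (mul_eq_zero.1 h2).resolve_left (sub_ne_zero.2 huv.symm)
        have h4 : s = 0 := by rw [h3] at h1; linarith
        exact hst.elim (fun h => h h4) (fun h => h h3)
      · simp only
        rw [hN, smul_smul, div_mul_cancel₀ _ hDn]
    · rintro ⟨c, s', t', hc, hst, rfl⟩
      -- the inverse of the change of parameters
      have hw0 : pv - pu ≠ 0 := sub_ne_zero.2 huv.symm
      set t := (s' / C - t') / (pv - pu) with ht
      set s := pu * t - t' with hs
      have e1 : C * (pv * t - s) = s' := by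
        have h1 : (pv - pu) * t = s' / C - t' := by rw [ht]; field_simp
        have h2 : pv * t - s = s' / C := by rw [hs]; linear_combination h1
        rw [h2]; field_simp
      have e2 : pu * t - s = t' := by rw [hs]; ring
      have h1 := hN s t
      rw [e1, e2] at h1
      refine ⟨c * (D ^ (n - 1) * ru), s, t, mul_ne_zero hc hDn, ?_, ?_⟩
      · by_contra hcon
        push Not at hcon
        rw [hcon.1, hcon.2] at e1 e2
        simp only [mul_zero, sub_self] at e1 e2
        exact hst.elim (fun h => h e1.symm) (fun h => h e2.symm)
      · simp only
        rw [h1, smul_smul]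

end RationalNormalCurve

/-! ### Exterior and partial derivatives in coordinates -/

section ExteriorDerivative

variable {n : ℕ}

theorem extD_eq {w : EuclideanSpace ℝ (Fin n) → (EuclideanSpace ℝ (Fin n) →L[ℝ] ℝ)}
    {x : EuclideanSpace ℝ (Fin n)} (hw : DifferentiableAt ℝ w x) (X Y : EuclideanSpace ℝ (Fin n)) :
    extD w x X Y = fderiv ℝ w x X Y - fderiv ℝ w x Y X := by
  have h1 : DifferentiableAt ℝ (fun y => ContinuousAlternatingMap.ofSubsingleton ℝ
      (EuclideanSpace ℝ (Fin n)) ℝ (0 : Fin 1) (w y)) x :=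
    ((ContinuousAlternatingMap.ofSubsingletonLIE (𝕜 := ℝ) (E := EuclideanSpace ℝ (Fin n)) (F := ℝ)
      (0 : Fin 1)).differentiableAt).comp x hw
  have h2 : ∀ Y, fderiv ℝ (fun y => w y Y) x = (fderiv ℝ w x).flip Y := by
    intro Y
    have h3 := hw.hasFDerivAt.clm_apply (hasFDerivAt_const Y x)
    rw [h3.fderiv]
    ext; simp
  rw [extD, extDeriv_apply h1]
  simp [Fin.sum_univ_two, h2, sub_eq_add_neg, Fin.removeNth]

theorem smooth_pd {u : EuclideanSpace ℝ (Fin n) → ℝ} {x : EuclideanSpace ℝ (Fin n)}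
    (hu : ContDiffAt ℝ ∞ u x) (i : Fin n) : ContDiffAt ℝ ∞ (pd i u) x :=
  ContDiffAt.clm_apply (hu.fderiv_right (by simp)) contDiffAt_const

theorem pd_comm {u : EuclideanSpace ℝ (Fin n) → ℝ} {x : EuclideanSpace ℝ (Fin n)}
    (hu : ContDiffAt ℝ ∞ u x) (i j : Fin n) : pd i (pd j u) x = pd j (pd i u) x := by
  have hsymm : IsSymmSndFDerivAt ℝ u x := hu.isSymmSndFDerivAt (by
    simp only [minSmoothness_of_isRCLikeNormedField]
    exact WithTop.coe_le_coe.2 (le_top (a := (2 : ℕ∞))))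
  have h1 : ∀ k l : Fin n, pd k (pd l u) x =
      fderiv ℝ (fderiv ℝ u) x (EuclideanSpace.single k 1) (EuclideanSpace.single l 1) := by
    intro k l
    have h2 : DifferentiableAt ℝ (fderiv ℝ u) x :=
      (hu.fderiv_right (m := ∞) (by simp)).differentiableAt (by simp)
    have h3 := h2.hasFDerivAt.clm_apply (hasFDerivAt_const (EuclideanSpace.single l (1 : ℝ)) x)
    rw [pd, show fderiv ℝ (pd l u) x = _ from h3.fderiv]
    simp
  rw [h1, h1]
  exact hsymm _ _

end ExteriorDerivative

/-! ### The linear algebra of the elimination -/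

section Elimination

variable {n : ℕ}

/-- The expression `∑ (λ - a_k) (q_j - q_i + ρ_ij)` (cyclic sum over `i, j, k`) to which the
coefficients of `dω ∧ ω` reduce; `d_i` stands for `λ - a_i`, and the unknowns `q_i` for the rescaled
derivatives of `λ`. -/
def reducedCoeff (d : Fin n → ℝ) (ρ : Fin n → Fin n → ℝ) (q : Fin n → ℝ) (i j k : Fin n) : ℝ :=
  d k * (q j - q i + ρ i j) + d i * (q k - q j + ρ j k) + d j * (q i - q k + ρ k i)

/-- The alternating sum of reduced coefficients from which the unknowns `q` drop out. -/
def eliminant (d : Fin n → ℝ) (ρ : Fin n → Fin n → ℝ) (i j k l : Fin n) : ℝ :=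
  (d l - d k) * ρ i j + (d j - d i) * ρ k l + (d j - d l) * ρ i k + (d k - d i) * ρ l j +
    (d k - d j) * ρ i l + (d l - d i) * ρ j k

theorem eliminant_eq {d : Fin n → ℝ} {ρ : Fin n → Fin n → ℝ} (hρ : ∀ i j, ρ j i = -ρ i j)
    (q : Fin n → ℝ) (i j k l : Fin n) :
    reducedCoeff d ρ q j k l - reducedCoeff d ρ q i k l + reducedCoeff d ρ q i j l -
      reducedCoeff d ρ q i j k = eliminant d ρ i j k l := by
  simp only [reducedCoeff, eliminant]
  rw [hρ j l, hρ i l, hρ i k]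
  ring

/-- A second relation between the reduced coefficients of four indices, valid without conditions
on `ρ` beyond antisymmetry. -/
theorem reducedCoeff_weighted_sum {d : Fin n → ℝ} {ρ : Fin n → Fin n → ℝ}
    (hρ : ∀ i j, ρ j i = -ρ i j) (q : Fin n → ℝ) (i j k l : Fin n) :
    d i * reducedCoeff d ρ q j k l - d j * reducedCoeff d ρ q i k l +
      d k * reducedCoeff d ρ q i j l - d l * reducedCoeff d ρ q i j k = 0 := by
  simp only [reducedCoeff]
  rw [hρ j l, hρ i l, hρ i k]
  ring

/-- The linear system for `q` given by all reduced coefficients is solvable as soon as the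
eliminants vanish: two of the unknowns may be put to zero, a third index then determines the
corresponding unknown, and the remaining equations follow from the two linear relations between
the reduced coefficients. -/
theorem exists_reducedCoeff_eq_zero {d : Fin n → ℝ} {ρ : Fin n → Fin n → ℝ}
    (hd : Function.Injective d) (hρ : ∀ i j, ρ j i = -ρ i j)
    (helim : ∀ i j k l, i ≠ j → i ≠ k → i ≠ l → j ≠ k → j ≠ l → k ≠ l → eliminant d ρ i j k l = 0) :
    ∃ q : Fin n → ℝ, ∀ i j k, reducedCoeff d ρ q i j k = 0 := by
  have hρ0 : ∀ i, ρ i i = 0 := fun i => by linarith [hρ i i]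
  have swap₁ : ∀ q i j k, reducedCoeff d ρ q j i k = -reducedCoeff d ρ q i j k := fun q i j k => by
    simp only [reducedCoeff]; rw [hρ i j, hρ i k, hρ k j]; ring
  have swap₂ : ∀ q i j k, reducedCoeff d ρ q i k j = -reducedCoeff d ρ q i j k := fun q i j k => by
    simp only [reducedCoeff]; rw [hρ j k, hρ k i, hρ i j]; ring
  have diag : ∀ q i j, reducedCoeff d ρ q i j j = 0 := fun q i j => by linarith [swap₂ q i j j]
  have diag' : ∀ q i k, reducedCoeff d ρ q i i k = 0 := fun q i k => by linarith [swap₁ q i i k]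
  have diag'' : ∀ q i k, reducedCoeff d ρ q i k i = 0 := fun q i k => by
    rw [swap₂, diag', neg_zero]
  rcases lt_or_ge n 2 with hn | hn
  · refine ⟨0, fun i j k => ?_⟩
    have : j = k := Fin.ext (by have := j.2; have := k.2; omega)
    rw [this]
    exact diag _ _ _
  set o : Fin n := ⟨0, by omega⟩
  set p : Fin n := ⟨1, by omega⟩
  have hop : o ≠ p := by simp [o, p]
  have hdop : d o - d p ≠ 0 := sub_ne_zero.2 fun h => hop (hd h)
  set q : Fin n → ℝ := fun k => if k = o ∨ k = p then 0 else
    -(d k * ρ o p + d o * ρ p k + d p * ρ k o) / (d o - d p) with hq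
  have hqo : q o = 0 := by simp [hq]
  have hqp : q p = 0 := by simp [hq]
  have h0 : ∀ k, reducedCoeff d ρ q o p k = 0 := by
    intro k
    by_cases hko : k = o
    · rw [hko]; exact diag'' _ _ _
    by_cases hkp : k = p
    · rw [hkp]; exact diag _ _ _
    have hqk : q k * (d o - d p) = -(d k * ρ o p + d o * ρ p k + d p * ρ k o) := by
      simp only [hq, hko, hkp, or_self, if_false]
      field_simp
    simp only [reducedCoeff, hqo, hqp]
    linear_combination hqk
  have h1 : ∀ j k, reducedCoeff d ρ q o j k = 0 := by
    intro j k
    by_cases hjp : j = p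
    · rw [hjp]; exact h0 k
    by_cases hkp : k = p
    · rw [hkp, swap₂, h0, neg_zero]
    by_cases hjo : j = o
    · rw [hjo]; exact diag' _ _ _
    by_cases hko : k = o
    · rw [hko]; exact diag'' _ _ _
    by_cases hjk : j = k
    · rw [hjk]; exact diag _ _ _
    have e1 := eliminant_eq (d := d) hρ q o p j k
    rw [helim o p j k hop (Ne.symm hjo) (Ne.symm hko) (Ne.symm hjp) (Ne.symm hkp) hjk, h0, h0] at e1
    have e2 := reducedCoeff_weighted_sum (d := d) hρ q o p j k
    rw [h0, h0] at e2
    have e3 : (d o - d p) * reducedCoeff d ρ q o j k = 0 := by linear_combination e2 - d o * e1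
    exact (mul_eq_zero.1 e3).resolve_left hdop
  refine ⟨q, fun i j k => ?_⟩
  by_cases hio : i = o
  · rw [hio]; exact h1 j k
  by_cases hjo : j = o
  · rw [hjo, swap₁, h1, neg_zero]
  by_cases hko : k = o
  · rw [hko, swap₂, swap₁, h1, neg_zero, neg_zero]
  by_cases hij : i = j
  · rw [hij]; exact diag' _ _ _
  by_cases hik : i = k
  · rw [hik]; exact diag'' _ _ _
  by_cases hjk : j = k
  · rw [hjk]; exact diag _ _ _
  have e1 := eliminant_eq (d := d) hρ q o i j k
  rw [helim o i j k (Ne.symm hio) (Ne.symm hjo) (Ne.symm hko) hij hik hjk, h1, h1, h1] at e1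
  linarith

end Elimination

/-! ### The integrability condition for the normal form -/

section NormalForm

variable {n : ℕ} {u v lam : EuclideanSpace ℝ (Fin n) → ℝ} {x : EuclideanSpace ℝ (Fin n)}

/-- The part `λ (a_j - a_i) (λ P_ij - Q_ij)` of the reduced coefficients of `dω ∧ ω` that contains
the second derivatives of `u` and `v`, where `P_ij = (2 u_ij - (a_i + a_j) v_ij) / (u_i u_j)` and
`Q_ij = ((a_i + a_j) u_ij - 2 a_i a_j v_ij) / (u_i u_j)`. -/
def secondOrderTerm (u v : EuclideanSpace ℝ (Fin n) → ℝ) (x : EuclideanSpace ℝ (Fin n)) (l : ℝ)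
    (i j : Fin n) : ℝ :=
  l * (ratio u v j x - ratio u v i x) *
    (l * ((2 * pd i (pd j u) x - (ratio u v i x + ratio u v j x) * pd i (pd j v) x) /
        (pd i u x * pd j u x)) -
      ((ratio u v i x + ratio u v j x) * pd i (pd j u) x -
        2 * ratio u v i x * ratio u v j x * pd i (pd j v) x) / (pd i u x * pd j u x))

theorem secondOrderTerm_swap (hu : ContDiffAt ℝ ∞ u x) (hv : ContDiffAt ℝ ∞ v x) (l : ℝ)
    (i j : Fin n) : secondOrderTerm u v x l j i = -secondOrderTerm u v x l i j := by
  simp only [secondOrderTerm]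
  rw [pd_comm hu j i, pd_comm hv j i, mul_comm (pd j u x)]
  ring

theorem smooth_ratio (hu : ContDiffAt ℝ ∞ u x) (hv : ContDiffAt ℝ ∞ v x) {i : Fin n}
    (hvi : pd i v x ≠ 0) : ContDiffAt ℝ ∞ (ratio u v i) x :=
  (smooth_pd hu i).div (smooth_pd hv i) hvi

theorem smooth_normalForm (hu : ContDiffAt ℝ ∞ u x) (hv : ContDiffAt ℝ ∞ v x)
    (hlam : ContDiffAt ℝ ∞ lam x) (hvi : ∀ i, pd i v x ≠ 0) (hl : ∀ i, lam x ≠ ratio u v i x) :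
    ContDiffAt ℝ ∞ (fun y => normalForm u v (lam y) y) x := by
  unfold normalForm
  refine ContDiffAt.sum fun i _ =>
    ContDiffAt.fun_smul (𝕜 := ℝ) (𝕜' := ℝ) ?_ contDiffAt_const
  exact (smooth_pd hu i).div (hlam.sub (smooth_ratio hu hv (hvi i))) (sub_ne_zero.2 (hl i))

theorem pd_normalForm_coeff (hu : ContDiffAt ℝ ∞ u x) (hv : ContDiffAt ℝ ∞ v x)
    (hlam : ContDiffAt ℝ ∞ lam x) (i : Fin n) {j : Fin n} (hvj : pd j v x ≠ 0)
    (hl : lam x ≠ ratio u v j x) :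
    pd i (fun y => pd j u y / (lam y - ratio u v j y)) x =
      (pd i (pd j u) x - pd j u x / (lam x - ratio u v j x) * (pd i lam x -
        (pd i (pd j u) x - ratio u v j x * pd i (pd j v) x) / pd j v x)) /
        (lam x - ratio u v j x) := by
  have hline : ∀ {f : EuclideanSpace ℝ (Fin n) → ℝ}, ContDiffAt ℝ ∞ f x →
      HasDerivAt (fun t : ℝ => f (x + t • EuclideanSpace.single i (1 : ℝ))) (pd i f x) 0 := by
    intro f hf
    have h1 : HasDerivAt (fun t : ℝ => x + t • EuclideanSpace.single i (1 : ℝ))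
        (EuclideanSpace.single i (1 : ℝ)) 0 := by
      simpa using ((hasDerivAt_id (0 : ℝ)).smul_const (EuclideanSpace.single i (1 : ℝ))).const_add x
    have h2 : HasFDerivAt f (fderiv ℝ f x) (x + (0 : ℝ) • EuclideanSpace.single i (1 : ℝ)) := by
      simpa using (hf.differentiableAt (by simp)).hasFDerivAt
    exact h2.comp_hasDerivAt (0 : ℝ) h1
  have hl' : lam x - ratio u v j x ≠ 0 := sub_ne_zero.2 hl
  have hm : ContDiffAt ℝ ∞ (fun y => pd j u y / (lam y - ratio u v j y)) x :=
    (smooth_pd hu j).div (hlam.sub (smooth_ratio hu hv hvj)) hl'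
  have h1 := (hline (smooth_pd hu j)).div ((hline hlam).sub
    ((hline (smooth_pd hu j)).div (hline (smooth_pd hv j)) (by simpa using hvj)))
    (by simpa [ratio] using hl')
  rw [(hline hm).unique h1]
  simp only [zero_smul, add_zero, Pi.sub_apply, Pi.div_apply]
  rw [show pd j u x / pd j v x = ratio u v j x from rfl]
  have hr : pd j u x = ratio u v j x * pd j v x := by rw [ratio]; field_simp
  generalize ratio u v j x = a at *
  rw [hr]
  field_simp

theorem fderiv_normalForm (hu : ContDiffAt ℝ ∞ u x) (hv : ContDiffAt ℝ ∞ v x)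
    (hlam : ContDiffAt ℝ ∞ lam x) (hvi : ∀ i, pd i v x ≠ 0) (hl : ∀ i, lam x ≠ ratio u v i x)
    (i j : Fin n) :
    fderiv ℝ (fun y => normalForm u v (lam y) y) x (EuclideanSpace.single i 1)
        (EuclideanSpace.single j 1) = pd i (fun y => pd j u y / (lam y - ratio u v j y)) x := by
  have h1 := ((smooth_normalForm hu hv hlam hvi hl).differentiableAt
    (by simp)).hasFDerivAt.clm_apply (hasFDerivAt_const (EuclideanSpace.single j (1 : ℝ)) x)
  have h2 : (fun y => normalForm u v (lam y) y (EuclideanSpace.single j (1 : ℝ))) =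
      fun y => pd j u y / (lam y - ratio u v j y) := by
    funext y
    simp [normalForm]
  rw [h2] at h1
  rw [pd, h1.fderiv]
  simp

/-- The coefficients of `dω ∧ ω`, up to a factor without derivatives of `λ`. -/
theorem integrabilityCoeff_eq (hu : ContDiffAt ℝ ∞ u x) (hv : ContDiffAt ℝ ∞ v x)
    (hlam : ContDiffAt ℝ ∞ lam x) (hui : ∀ i, pd i u x ≠ 0) (hvi : ∀ i, pd i v x ≠ 0)
    (hl : ∀ i, lam x ≠ ratio u v i x) (i j k : Fin n) :
    integrabilityCoeff u v lam i j k x =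
      pd i u x * pd j u x * pd k u x / ((lam x - ratio u v i x) * (lam x - ratio u v j x) *
          (lam x - ratio u v k x)) ^ 2 *
        reducedCoeff (fun i => lam x - ratio u v i x) (secondOrderTerm u v x (lam x))
          (fun i => pd i lam x * (lam x - ratio u v i x) ^ 2 / pd i u x) i j k := by
  have hdiff := (smooth_normalForm hu hv hlam hvi hl).differentiableAt (n := ∞) (by simp)
  have hval : ∀ j, normalForm u v (lam x) x (EuclideanSpace.single j (1 : ℝ)) =
      pd j u x / (lam x - ratio u v j x) := by
    intro j
    simp [normalForm]
  have hpair : ∀ i j, extD (fun y => normalForm u v (lam y) y) x (EuclideanSpace.single i 1)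
      (EuclideanSpace.single j 1) =
      pd i u x * pd j u x / ((lam x - ratio u v i x) * (lam x - ratio u v j x)) ^ 2 *
        (pd j lam x * (lam x - ratio u v j x) ^ 2 / pd j u x -
          pd i lam x * (lam x - ratio u v i x) ^ 2 / pd i u x +
          secondOrderTerm u v x (lam x) i j) := by
    intro i j
    rw [extD_eq hdiff, fderiv_normalForm hu hv hlam hvi hl, fderiv_normalForm hu hv hlam hvi hl,
      pd_normalForm_coeff hu hv hlam i (hvi j) (hl j),
      pd_normalForm_coeff hu hv hlam j (hvi i) (hl i), secondOrderTerm, pd_comm hu j i,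
      pd_comm hv j i]
    have hdi : lam x - ratio u v i x ≠ 0 := sub_ne_zero.2 (hl i)
    have hdj : lam x - ratio u v j x ≠ 0 := sub_ne_zero.2 (hl j)
    have hi := hui i
    have hj := hui j
    have hvi' := hvi i
    have hvj' := hvi j
    have hri : pd i u x = ratio u v i x * pd i v x := by rw [ratio]; field_simp
    have hrj : pd j u x = ratio u v j x * pd j v x := by rw [ratio]; field_simp
    have hai : ratio u v i x ≠ 0 := div_ne_zero hi hvi'
    have haj : ratio u v j x ≠ 0 := div_ne_zero hj hvj'
    rw [hri, hrj]
    generalize ratio u v i x = a at *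
    generalize ratio u v j x = b at *
    generalize pd i v x = vi at *
    generalize pd j v x = vj at *
    generalize pd i (pd j u) x = U at *
    generalize pd i (pd j v) x = V at *
    generalize lam x = l at *
    field_simp
    ring
  rw [integrabilityCoeff, dWedgeCoeff, hpair, hpair, hpair, hval, hval, hval, reducedCoeff]
  have hdi : lam x - ratio u v i x ≠ 0 := sub_ne_zero.2 (hl i)
  have hdj : lam x - ratio u v j x ≠ 0 := sub_ne_zero.2 (hl j)
  have hdk : lam x - ratio u v k x ≠ 0 := sub_ne_zero.2 (hl k)
  generalize pd j lam x * (lam x - ratio u v j x) ^ 2 / pd j u x = qj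
  generalize pd k lam x * (lam x - ratio u v k x) ^ 2 / pd k u x = qk
  generalize pd i lam x * (lam x - ratio u v i x) ^ 2 / pd i u x = qi
  field_simp

theorem clearedForm_eq_smul_normalForm {l : ℝ} (hl : ∀ i, l ≠ ratio u v i x) :
    clearedForm u v l 1 x = (∏ i, (l - ratio u v i x)) • normalForm u v l x := by
  rw [clearedForm, normalForm, Finset.smul_sum]
  refine Finset.sum_congr rfl fun i _ => ?_
  rw [smul_smul, ← Finset.mul_prod_erase Finset.univ _ (Finset.mem_univ i)]
  congr 1
  have := sub_ne_zero.2 (hl i)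
  simp only [one_mul]
  field_simp

/-- The eliminants of the coefficients of `dω ∧ ω` are quadratic polynomials in `λ` without
constant term; their remaining coefficients are `E` and a multiple of `F`. -/
theorem eliminant_secondOrderTerm (hui : ∀ i, pd i u x ≠ 0) (hvi : ∀ i, pd i v x ≠ 0)
    (l : ℝ) (i j k m : Fin n) :
    eliminant (fun i => l - ratio u v i x) (secondOrderTerm u v x l) i j k m =
      -(l * (l * exprE u v i j k m x + ratio u v i x * ratio u v j x * ratio u v k x *
        ratio u v m x * exprF u v i j k m x)) := by
  have hcyc : ∀ i j k m, ratio u v i x * ratio u v j x * ratio u v k x *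
        ratio u v m x * cyclicTerm v u i j k m x =
      -((ratio u v i x - ratio u v j x) * (ratio u v k x - ratio u v m x) *
        (((ratio u v i x + ratio u v j x) * pd i (pd j u) x -
          2 * ratio u v i x * ratio u v j x * pd i (pd j v) x) / (pd i u x * pd j u x) +
        ((ratio u v k x + ratio u v m x) * pd k (pd m u) x -
          2 * ratio u v k x * ratio u v m x * pd k (pd m v) x) / (pd k u x * pd m u x))) := by
    intro i j k m
    have h1 : ∀ i, ratio v u i x = (ratio u v i x)⁻¹ := fun i => by simp [ratio]
    have h2 : ∀ i, ratio u v i x ≠ 0 := fun i => div_ne_zero (hui i) (hvi i)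
    have h3 : ∀ i, pd i u x = ratio u v i x * pd i v x := fun i => by
      have := hvi i
      rw [ratio]; field_simp
    have := h2 i
    have := h2 j
    have := h2 k
    have := h2 m
    have := hvi i
    have := hvi j
    have := hvi k
    have := hvi m
    rw [cyclicTerm, h1 i, h1 j, h1 k, h1 m, h3 i, h3 j, h3 k, h3 m]
    field_simp
    ring
  have h1 := hcyc i j k m
  have h2 := hcyc i k m j
  have h3 := hcyc i m j k
  simp only [eliminant, secondOrderTerm, exprE, exprF]
  unfold cyclicTerm at h1 h2 h3 ⊢
  linear_combination l * (h1 + h2 + h3)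

/-- If the system holds at `x`, then all eliminants vanish, and for every value `l` of `λ` the
condition `dω ∧ ω = 0` at `x` can be solved for the derivatives of `λ`; an affine function `λ` with
these derivatives is taken. -/
theorem exists_integrabilityCoeff_eq_zero (hu : ContDiffAt ℝ ∞ u x) (hv : ContDiffAt ℝ ∞ v x)
    (hui : ∀ i, pd i u x ≠ 0) (hvi : ∀ i, pd i v x ≠ 0)
    (hdist : ∀ i j, i ≠ j → ratio u v i x ≠ ratio u v j x) (hsys : SystemAt u v x) {l : ℝ}
    (hl : ∀ i, l ≠ ratio u v i x) :
    ∃ lam : EuclideanSpace ℝ (Fin n) → ℝ, ContDiffAt ℝ ∞ lam x ∧ lam x = l ∧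
      ∀ i j k, integrabilityCoeff u v lam i j k x = 0 := by
  obtain ⟨q, hq⟩ := exists_reducedCoeff_eq_zero (d := fun i => l - ratio u v i x)
    (ρ := secondOrderTerm u v x l)
    (fun i j hij => by
      by_contra hne
      exact hdist i j hne (sub_right_injective hij))
    (secondOrderTerm_swap hu hv l)
    (fun i j k m hij hik him hjk hjm hkm => by
      have h := hsys i j k m hij hik him hjk hjm hkm
      rw [eliminant_secondOrderTerm hui hvi, h.1, h.2]
      ring)
  -- `q` are the rescaled derivatives of `λ`, as in `integrabilityCoeff_eq`
  set c : Fin n → ℝ := fun i => q i * pd i u x / (l - ratio u v i x) ^ 2 with hc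
  set L : EuclideanSpace ℝ (Fin n) →L[ℝ] ℝ :=
    ∑ i, c i • EuclideanSpace.proj (𝕜 := ℝ) i with hL
  set lam : EuclideanSpace ℝ (Fin n) → ℝ := fun y => l + (L y - L x) with hlam
  have hlamx : lam x = l := by simp [hlam]
  have hsm : ContDiff ℝ ∞ lam := by fun_prop
  have hpd : ∀ i, pd i lam x = c i := by
    intro i
    have h1 : HasFDerivAt lam L x := ((L.hasFDerivAt (x := x)).sub_const (L x)).const_add l
    rw [pd, h1.fderiv]
    simp [hL]
  refine ⟨lam, hsm.contDiffAt, hlamx, fun i j k => ?_⟩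
  rw [integrabilityCoeff_eq hu hv hsm.contDiffAt hui hvi (by rwa [hlamx])]
  have hqq : (fun i => pd i lam x * (lam x - ratio u v i x) ^ 2 / pd i u x) = q := by
    funext i
    rw [hpd, hlamx, hc]
    have := hui i
    have := sub_ne_zero.2 (hl i)
    field_simp
  rw [hqq, hlamx, hq, mul_zero]

/-- If all derivative-free combinations of the coefficients of `dω ∧ ω` vanish, then the system
holds: the eliminants are such combinations, and a polynomial `l (l E + c F)` that vanishes for
infinitely many `l` is zero. -/
theorem systemAt_of_forall_combination (hu : ContDiffAt ℝ ∞ u x) (hv : ContDiffAt ℝ ∞ v x)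
    (hui : ∀ i, pd i u x ≠ 0) (hvi : ∀ i, pd i v x ≠ 0)
    (h : ∀ l : ℝ, (∀ i, l ≠ ratio u v i x) →
      ∀ κ : ℝ, IsDerivativeFreeCombination u v x l κ → κ = 0) : SystemAt u v x := by
  intro i j k m hij hik him hjk hjm hkm
  have helim : ∀ l : ℝ, (∀ i, l ≠ ratio u v i x) →
      eliminant (fun i => l - ratio u v i x) (secondOrderTerm u v x l) i j k m = 0 := by
    intro l hl
    refine h l hl _ ?_
    set K : Fin n → Fin n → Fin n → ℝ := fun i j k => pd i u x * pd j u x * pd k u x /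
      ((l - ratio u v i x) * (l - ratio u v j x) * (l - ratio u v k x)) ^ 2 with hK
    have hK0 : ∀ i j k, K i j k ≠ 0 := fun i j k => by
      have hd : ∀ i, l - ratio u v i x ≠ 0 := fun i => sub_ne_zero.2 (hl i)
      exact div_ne_zero (mul_ne_zero (mul_ne_zero (hui i) (hui j)) (hui k))
        (pow_ne_zero _ (mul_ne_zero (mul_ne_zero (hd i) (hd j)) (hd k)))
    -- the indicator of a triple of indices, divided by the factor relating the coefficient to the
    -- reduced one
    set δ : Fin n → Fin n → Fin n → Fin n → Fin n → Fin n → ℝ := fun i j k a b c =>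
      if a = i then if b = j then if c = k then (K i j k)⁻¹ else 0 else 0 else 0 with hδ
    -- the combination of `eliminant_eq`
    refine ⟨fun a b c => δ j k m a b c - δ i k m a b c + δ i j m a b c - δ i j k a b c,
      fun lam hlam hlx => ?_⟩
    have hsum : ∀ i j k, ∑ a, ∑ b, ∑ c, δ i j k a b c * integrabilityCoeff u v lam a b c x =
        reducedCoeff (fun i => l - ratio u v i x) (secondOrderTerm u v x l)
          (fun i => pd i lam x * (lam x - ratio u v i x) ^ 2 / pd i u x) i j k := by
      intro i j k
      have h1 : ∑ a, ∑ b, ∑ c, δ i j k a b c * integrabilityCoeff u v lam a b c x =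
          (K i j k)⁻¹ * integrabilityCoeff u v lam i j k x := by
        simp [hδ, ite_mul]
      rw [h1, integrabilityCoeff_eq hu hv hlam hui hvi (by rwa [hlx]), hlx, ← mul_assoc,
        inv_mul_cancel₀ (hK0 i j k), one_mul]
    simp only [sub_mul, add_mul, Finset.sum_sub_distrib, Finset.sum_add_distrib, hsum]
    exact eliminant_eq (secondOrderTerm_swap hu hv l) _ i j k m
  obtain ⟨l₁, hl₁⟩ := Infinite.exists_notMem_finset
    (insert 0 (Finset.univ.image fun i => ratio u v i x))
  obtain ⟨l₂, hl₂⟩ := Infinite.exists_notMem_finset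
    (insert 0 (insert l₁ (Finset.univ.image fun i => ratio u v i x)))
  simp only [Finset.mem_insert, Finset.mem_image, Finset.mem_univ, true_and, not_or,
    not_exists] at hl₁ hl₂
  have e1 := helim l₁ fun i h => hl₁.2 i h.symm
  have e2 := helim l₂ fun i h => hl₂.2.2 i h.symm
  rw [eliminant_secondOrderTerm hui hvi, neg_eq_zero] at e1 e2
  have e1' := (mul_eq_zero.1 e1).resolve_left hl₁.1
  have e2' := (mul_eq_zero.1 e2).resolve_left hl₂.1
  have hE : exprE u v i j k m x = 0 := by
    have h3 : (l₂ - l₁) * exprE u v i j k m x = 0 := by linear_combination e2' - e1'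
    exact (mul_eq_zero.1 h3).resolve_left (sub_ne_zero.2 hl₂.2.1)
  refine ⟨hE, ?_⟩
  rw [hE, mul_zero, zero_add] at e1'
  have hr : ∀ i, ratio u v i x ≠ 0 := fun i => div_ne_zero (hui i) (hvi i)
  exact (mul_eq_zero.1 e1').resolve_left
    (mul_ne_zero (mul_ne_zero (mul_ne_zero (hr i) (hr j)) (hr k)) (hr m))

theorem eq_zero_of_isDerivativeFreeCombination {l κ : ℝ}
    (hκ : IsDerivativeFreeCombination u v x l κ)
    (h : ∃ lam : EuclideanSpace ℝ (Fin n) → ℝ, ContDiffAt ℝ ∞ lam x ∧ lam x = l ∧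
      ∀ i j k, integrabilityCoeff u v lam i j k x = 0) : κ = 0 := by
  obtain ⟨c, hc⟩ := hκ
  obtain ⟨lam, hs, hx, h0⟩ := h
  rw [← hc lam hs hx]
  simp [h0]

end NormalForm

/-! ### Involutivity in a chart -/

section Charts

variable {n : ℕ} {M : Type*} [TopologicalSpace M] [ChartedSpace (EuclideanSpace ℝ (Fin n)) M]
  [IsManifold (𝓡 n) ∞ M]

theorem GL2Structure.smul_mem_cone (S : GL2Structure n M) {y : M}
    {η : TangentSpace (𝓡 n) y →L[ℝ] ℝ} (hη : η ∈ S.cone y) {c : ℝ} (hc : c ≠ 0) :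
    c • η ∈ S.cone y := by
  obtain ⟨V, -, hyV, w, -, hw⟩ := S.exists_coframe y
  rw [(hw y hyV).2] at hη ⊢
  obtain ⟨r, s, t, hr, hst, rfl⟩ := hη
  exact ⟨c * r, s, t, mul_ne_zero hc hr, hst, by rw [smul_smul]⟩

/-- The cones of a `GL(2, ℝ)` structure read in a chart: the covector `η` at the point `x` of the
target belongs to the cone if its pullback under the chart does. -/
def chartCone (S : GL2Structure n M) (φ : OpenPartialHomeomorph M (EuclideanSpace ℝ (Fin n)))
    (x : EuclideanSpace ℝ (Fin n)) : Set (EuclideanSpace ℝ (Fin n) →L[ℝ] ℝ) :=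
  {η | (η.comp (mfderiv (𝓡 n) (𝓡 n) φ (φ.symm x)) : TangentSpace (𝓡 n) (φ.symm x) →L[ℝ] ℝ) ∈
    S.cone (φ.symm x)}

variable {φ : OpenPartialHomeomorph M (EuclideanSpace ℝ (Fin n))}

omit [IsManifold (𝓡 n) ∞ M] in
theorem mdifferentiable_of_mem_maximalAtlas (hφ : φ ∈ IsManifold.maximalAtlas (𝓡 n) ∞ M) :
    φ.MDifferentiable (𝓡 n) (𝓡 n) :=
  ⟨(contMDiffOn_of_mem_maximalAtlas hφ).mdifferentiableOn (by simp),
    (contMDiffOn_symm_of_mem_maximalAtlas hφ).mdifferentiableOn (by simp)⟩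

omit [IsManifold (𝓡 n) ∞ M] in
theorem mfderiv_chart_symm_apply (hφ : φ ∈ IsManifold.maximalAtlas (𝓡 n) ∞ M)
    {x : EuclideanSpace ℝ (Fin n)} (hx : x ∈ φ.target) (X : EuclideanSpace ℝ (Fin n)) :
    mfderiv (𝓡 n) (𝓡 n) φ (φ.symm x) (mfderiv (𝓡 n) (𝓡 n) φ.symm x X) = X := by
  have h := (mdifferentiable_of_mem_maximalAtlas hφ).comp_symm_deriv hx
  exact DFunLike.congr_fun h X

omit [IsManifold (𝓡 n) ∞ M] in
theorem mfderiv_symm_chart_apply (hφ : φ ∈ IsManifold.maximalAtlas (𝓡 n) ∞ M)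
    {x : EuclideanSpace ℝ (Fin n)} (hx : x ∈ φ.target) (X : TangentSpace (𝓡 n) (φ.symm x)) :
    mfderiv (𝓡 n) (𝓡 n) φ.symm x (mfderiv (𝓡 n) (𝓡 n) φ (φ.symm x) X) = X := by
  have h := (mdifferentiable_of_mem_maximalAtlas hφ).symm_comp_deriv (φ.map_target hx)
  rw [φ.right_inv hx] at h
  exact DFunLike.congr_fun h X

omit [IsManifold (𝓡 n) ∞ M] in
/-- A hypersurface with tangent hyperplane `H`, read in a chart. -/
theorem exists_defining_function_in_chart (hφ : φ ∈ IsManifold.maximalAtlas (𝓡 n) ∞ M)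
    {x : EuclideanSpace ℝ (Fin n)} (hx : x ∈ φ.target) {N : Set M}
    {H : Submodule ℝ (TangentSpace (𝓡 n) (φ.symm x))} (hN : IsHypersurfaceAt N (φ.symm x) H) :
    ∃ g : EuclideanSpace ℝ (Fin n) → ℝ, ContDiffAt ℝ ∞ g x ∧
      (∀ᶠ x' in 𝓝 x, φ.symm x' ∈ N ↔ g x' = 0) ∧ fderiv ℝ g x ≠ 0 ∧
      ∀ X : EuclideanSpace ℝ (Fin n),
        fderiv ℝ g x X = 0 ↔ mfderiv (𝓡 n) (𝓡 n) φ.symm x X ∈ H := by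
  obtain ⟨hxN, V, hV, hxV, g, hg, hgN, hdg, hH⟩ := hN
  have hcont : ContinuousAt φ.symm x := φ.continuousAt_symm hx
  have hVx : ∀ᶠ x' in 𝓝 x, φ.symm x' ∈ V := hcont.eventually (hV.mem_nhds hxV)
  have hgx : ContMDiffAt (𝓡 n) 𝓘(ℝ, ℝ) ∞ g (φ.symm x) := hg.contMDiffAt (hV.mem_nhds hxV)
  have hsx : ContMDiffAt (𝓡 n) (𝓡 n) ∞ φ.symm x :=
    (contMDiffOn_symm_of_mem_maximalAtlas hφ).contMDiffAt (φ.open_target.mem_nhds hx)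
  have hder : ∀ X : EuclideanSpace ℝ (Fin n), fderiv ℝ (g ∘ φ.symm) x X =
      mfderiv (𝓡 n) 𝓘(ℝ, ℝ) g (φ.symm x) (mfderiv (𝓡 n) (𝓡 n) φ.symm x X) := by
    intro X
    rw [← mfderiv_eq_fderiv]
    exact mfderiv_comp_apply x (hgx.mdifferentiableAt (by simp)) (hsx.mdifferentiableAt (by simp)) X
  refine ⟨g ∘ φ.symm, (hgx.comp x hsx).contDiffAt, ?_, ?_, ?_⟩
  · filter_upwards [hVx] with x' hx' using hgN _ hx'
  · intro h0
    apply hdg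
    ext X
    have := hder (mfderiv (𝓡 n) (𝓡 n) φ (φ.symm x) X)
    rw [mfderiv_symm_chart_apply hφ hx, h0] at this
    exact this.symm
  · intro X
    rw [hder]
    exact (hH _).symm

/-- In a chart, involutivity gives, through every covector of a cone, a function whose
differentials along its zero set lie in the cones. Locally defining functions of the
hypersurface at nearby points are compared with the given one by
`exists_fderiv_eq_smul_of_vanishing`. -/
theorem GL2Structure.IsInvolutive.exists_function_in_chart {S : GL2Structure n M}
    (hS : S.IsInvolutive) (hφ : φ ∈ IsManifold.maximalAtlas (𝓡 n) ∞ M)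
    {x : EuclideanSpace ℝ (Fin n)} (hx : x ∈ φ.target)
    {η : EuclideanSpace ℝ (Fin n) →L[ℝ] ℝ} (hη : η ∈ chartCone S φ x) :
    ∃ g : EuclideanSpace ℝ (Fin n) → ℝ, ContDiffAt ℝ ∞ g x ∧ g x = 0 ∧ fderiv ℝ g x ≠ 0 ∧
      (∃ c : ℝ, c ≠ 0 ∧ fderiv ℝ g x = c • η) ∧
      ∀ᶠ x' in 𝓝 x, g x' = 0 → fderiv ℝ g x' ∈ chartCone S φ x' := by
  set ηM : TangentSpace (𝓡 n) (φ.symm x) →L[ℝ] ℝ :=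
    η.comp (mfderiv (𝓡 n) (𝓡 n) φ (φ.symm x)) with hηM
  obtain ⟨N, hN, hNx⟩ := hS (φ.symm x) (LinearMap.ker ηM.toLinearMap)
    ⟨ηM, hη, fun X => LinearMap.mem_ker⟩
  obtain ⟨g, hg, hgN, hdg, hH⟩ := exists_defining_function_in_chart hφ hx hNx
  have hker : ∀ X, fderiv ℝ g x X = 0 ↔ η X = 0 := by
    intro X
    rw [hH, LinearMap.mem_ker]
    change η (mfderiv (𝓡 n) (𝓡 n) φ (φ.symm x) (mfderiv (𝓡 n) (𝓡 n) φ.symm x X)) = 0 ↔ _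
    rw [mfderiv_chart_symm_apply hφ hx]
  have hη0 : η ≠ 0 := by
    rintro rfl
    exact hdg (ContinuousLinearMap.ext fun X => (hker X).2 rfl)
  have hdg' : ∀ᶠ x' in 𝓝 x, fderiv ℝ g x' ≠ 0 := by
    have : ContinuousAt (fderiv ℝ g) x := hg.continuousAt_fderiv (by simp)
    exact this.eventually_ne hdg
  have hgs : ∀ᶠ x' in 𝓝 x, ContDiffAt ℝ 1 g x' :=
    (hg.of_le (by exact_mod_cast le_top) : ContDiffAt ℝ 1 g x).eventually (by simp)
  refine ⟨g, hg, hgN.self_of_nhds.1 hNx.1, hdg,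
    exists_eq_smul_of_ker_le hη0 fun X => (hker X).1, ?_⟩
  filter_upwards [hdg', hgs, hgN.eventually_nhds, φ.open_target.mem_nhds hx]
    with x' hdg1 hg1 hgN1 hx1 hg0
  have hyN : φ.symm x' ∈ N := hgN1.self_of_nhds.2 hg0
  obtain ⟨H', ⟨ζ, hζ, hζH⟩, hN'⟩ := hN _ hyN
  obtain ⟨g', hg', hgN', hdg'', hH'⟩ := exists_defining_function_in_chart hφ hx1 hN'
  obtain ⟨a, ha⟩ := exists_fderiv_eq_smul_of_vanishing
    (hg'.of_le (by exact_mod_cast le_top)) (hgN'.self_of_nhds.1 hyN) hdg'' hg1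
    (by filter_upwards [hgN', hgN1] with z h1 h2 h3 using h2.1 (h1.2 h3))
  have ha0 : a ≠ 0 := by
    rintro rfl
    exact hdg1 (by rw [ha, zero_smul])
  set ξ : TangentSpace (𝓡 n) (φ.symm x') →L[ℝ] ℝ :=
    (fderiv ℝ g x').comp (mfderiv (𝓡 n) (𝓡 n) φ (φ.symm x')) with hξ
  have hξζ : ∀ X, ξ X = 0 ↔ ζ X = 0 := by
    intro X
    have := hH' (mfderiv (𝓡 n) (𝓡 n) φ (φ.symm x') X)
    rw [mfderiv_symm_chart_apply hφ hx1] at this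
    refine Iff.trans ?_ (this.trans (hζH X))
    have e : ξ X = a * fderiv ℝ g' x' (mfderiv (𝓡 n) (𝓡 n) φ (φ.symm x') X) := by
      change fderiv ℝ g x' _ = _
      rw [ha]
      rfl
    rw [e, mul_eq_zero]
    exact or_iff_right ha0
  have hζ0 : ζ ≠ 0 := by
    rintro rfl
    refine hdg1 (ContinuousLinearMap.ext fun X => ?_)
    have := (hξζ (mfderiv (𝓡 n) (𝓡 n) φ.symm x' X)).2 rfl
    change fderiv ℝ g x' (mfderiv (𝓡 n) (𝓡 n) φ (φ.symm x')
      (mfderiv (𝓡 n) (𝓡 n) φ.symm x' X)) = 0 at this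
    rwa [mfderiv_chart_symm_apply hφ hx1] at this
  obtain ⟨c, hc, hcζ⟩ := exists_eq_smul_of_ker_le hζ0 fun X => (hξζ X).1
  change ξ ∈ S.cone (φ.symm x')
  rw [hcζ]
  exact S.smul_mem_cone hζ hc

end Charts

/-! ### The coframe in a chart -/

section ChartCoframe

variable {n : ℕ} {M : Type*} [TopologicalSpace M] [ChartedSpace (EuclideanSpace ℝ (Fin n)) M]
  [IsManifold (𝓡 n) ∞ M]

/-- A 1-form on `M` in a chart, i.e. its pullback under the inverse of the chart. -/
def chartForm (φ : OpenPartialHomeomorph M (EuclideanSpace ℝ (Fin n)))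
    (θ : (x : M) → (TangentSpace (𝓡 n) x →L[ℝ] ℝ)) (x : EuclideanSpace ℝ (Fin n)) :
    EuclideanSpace ℝ (Fin n) →L[ℝ] ℝ :=
  (θ (φ.symm x)).comp (mfderiv (𝓡 n) (𝓡 n) φ.symm x)

variable {φ : OpenPartialHomeomorph M (EuclideanSpace ℝ (Fin n))}

/-- Smoothness of a section of the cotangent bundle is tested on the vectors `dφ⁻¹(X)`, which form
a smooth section of the tangent bundle along the inverse chart. -/
theorem contDiffOn_chartForm (hφ : φ ∈ IsManifold.maximalAtlas (𝓡 n) ∞ M)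
    {θ : (x : M) → (TangentSpace (𝓡 n) x →L[ℝ] ℝ)} {V : Set M} (hV : IsOpen V)
    (hθ : SmoothOneFormOn θ V) :
    ContDiffOn ℝ ∞ (chartForm φ θ) (φ.target ∩ φ.symm ⁻¹' V) := by
  have hopen : IsOpen (φ.target ∩ φ.symm ⁻¹' V) := φ.isOpen_inter_preimage_symm hV
  rw [contDiffOn_clm_apply]
  intro X
  have hs : ContMDiffOn (𝓡 n) (𝓡 n) ∞ φ.symm (φ.target ∩ φ.symm ⁻¹' V) :=
    (contMDiffOn_symm_of_mem_maximalAtlas hφ).mono inter_subset_left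
  have hsec : ContMDiffOn (𝓡 n) (𝓡 n).tangent ∞
      (fun x => (⟨x, X⟩ : TangentBundle (𝓡 n) (EuclideanSpace ℝ (Fin n))))
      (φ.target ∩ φ.symm ⁻¹' V) := by
    apply (contMDiffOn_vectorSpace_iff_contDiffOn
      (V := fun x => (X : TangentSpace 𝓘(ℝ, EuclideanSpace ℝ (Fin n)) x))).2
    exact contDiffOn_const
  have htan := hs.contMDiffOn_tangentMapWithin (m := ∞) (by simp) hopen.uniqueMDiffOn
  have hv := htan.comp hsec (fun x hx => hx)
  have hθ' := hθ.comp hs (fun x hx => hx.2)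
  have hv' : ContMDiffOn (𝓡 n) (𝓡 n).tangent ∞
      (fun x => Bundle.TotalSpace.mk' (EuclideanSpace ℝ (Fin n))
        (E := fun y : M => TangentSpace (𝓡 n) y)
        (φ.symm x) (mfderiv (𝓡 n) (𝓡 n) φ.symm x X)) (φ.target ∩ φ.symm ⁻¹' V) := by
    refine hv.congr fun x hx => ?_
    simp only [Function.comp, tangentMapWithin, Bundle.TotalSpace.mk']
    rw [mfderivWithin_of_isOpen hopen hx]
  have h := ContMDiffOn.clm_bundle_apply (E₂ := Bundle.Trivial M ℝ) hθ' hv'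
  intro x hx
  exact contMDiffWithinAt_iff_contDiffWithinAt.1 (Bundle.contMDiffWithinAt_totalSpace.1 (h x hx)).2

omit [IsManifold (𝓡 n) ∞ M] in
/-- Pullback of covectors under a chart is inverse to pullback under the inverse chart. -/
theorem comp_mfderiv_chart_eq_iff (hφ : φ ∈ IsManifold.maximalAtlas (𝓡 n) ∞ M)
    {x : EuclideanSpace ℝ (Fin n)} (hx : x ∈ φ.target) {η : EuclideanSpace ℝ (Fin n) →L[ℝ] ℝ}
    {ξ : TangentSpace (𝓡 n) (φ.symm x) →L[ℝ] ℝ} :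
    η.comp (mfderiv (𝓡 n) (𝓡 n) φ (φ.symm x)) = ξ ↔
      η = ξ.comp (mfderiv (𝓡 n) (𝓡 n) φ.symm x) := by
  constructor
  · rintro rfl
    refine ContinuousLinearMap.ext fun X => ?_
    exact (congrArg η (mfderiv_chart_symm_apply hφ hx X)).symm
  · rintro rfl
    refine ContinuousLinearMap.ext fun X => ?_
    exact congrArg ξ (mfderiv_symm_chart_apply hφ hx X)

omit [IsManifold (𝓡 n) ∞ M] in
theorem sum_smul_chartForm (a : Fin n → ℝ) (w : Fin n → (x : M) → (TangentSpace (𝓡 n) x →L[ℝ] ℝ))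
    (x : EuclideanSpace ℝ (Fin n)) :
    ∑ i, a i • chartForm φ (w i) x =
      (∑ i, a i • w i (φ.symm x)).comp (mfderiv (𝓡 n) (𝓡 n) φ.symm x) := by
  refine ContinuousLinearMap.ext fun X => ?_
  have h : ∀ (F G : Type) [AddCommGroup F] [Module ℝ F] [TopologicalSpace F] [AddCommGroup G]
      [Module ℝ G] [TopologicalSpace G] (L : F →L[ℝ] G) (ξ : Fin n → (G →L[ℝ] ℝ)) (X : F),
      (∑ i, a i • (ξ i).comp L) X = (∑ i, a i • ξ i) (L X) := by
    intro F G _ _ _ _ _ _ L ξ X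
    simp
  exact h _ (TangentSpace (𝓡 n) (φ.symm x)) (mfderiv (𝓡 n) (𝓡 n) φ.symm x)
    (fun i => w i (φ.symm x)) X

/-- The local description of a `GL(2, ℝ)` structure by a coframe, read in a chart. -/
theorem GL2Structure.exists_coframe_in_chart (S : GL2Structure n M)
    (hφ : φ ∈ IsManifold.maximalAtlas (𝓡 n) ∞ M) {x₀ : EuclideanSpace ℝ (Fin n)}
    (hx₀ : x₀ ∈ φ.target) :
    ∃ V : Set (EuclideanSpace ℝ (Fin n)), IsOpen V ∧ x₀ ∈ V ∧ V ⊆ φ.target ∧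
      ∃ w : Fin n → EuclideanSpace ℝ (Fin n) → (EuclideanSpace ℝ (Fin n) →L[ℝ] ℝ),
        (∀ i, ContDiffOn ℝ ∞ (w i) V) ∧
        ∀ x ∈ V, LinearIndependent ℝ (fun i => w i x) ∧
          chartCone S φ x = coneOver (rnc fun i => w i x) := by
  obtain ⟨V, hV, hxV, w, hw, hwV⟩ := S.exists_coframe (φ.symm x₀)
  refine ⟨φ.target ∩ φ.symm ⁻¹' V, φ.isOpen_inter_preimage_symm hV, ⟨hx₀, hxV⟩,
    inter_subset_left, fun i => chartForm φ (w i), fun i => contDiffOn_chartForm hφ hV (hw i),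
    fun x hx => ?_⟩
  obtain ⟨hli, hcone⟩ := hwV _ hx.2
  constructor
  · rw [Fintype.linearIndependent_iff] at hli ⊢
    intro a ha
    refine hli a ?_
    rw [sum_smul_chartForm] at ha
    have := (comp_mfderiv_chart_eq_iff hφ hx.1 (η := 0)).2 ha.symm
    rw [← this]
    rfl
  · ext η
    change _ ∈ S.cone _ ↔ _
    rw [hcone]
    simp only [coneOver, mem_ofPred_eq]
    refine exists_congr fun r => exists_congr fun s => exists_congr fun t => ?_
    rw [comp_mfderiv_chart_eq_iff hφ hx.1, rnc, sum_smul_chartForm]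
    rfl

end ChartCoframe

/-! ### Integrability of the curve of forms -/

section Coframe

variable {n : ℕ}

/-- `n` independent covectors on `ℝⁿ` are the components of an isomorphism. -/
theorem exists_equiv_pi_of_linearIndependent {ξ : Fin n → (EuclideanSpace ℝ (Fin n) →L[ℝ] ℝ)}
    (hξ : LinearIndependent ℝ ξ) :
    ∃ e : EuclideanSpace ℝ (Fin n) ≃L[ℝ] (Fin n → ℝ),
      (e : EuclideanSpace ℝ (Fin n) →L[ℝ] (Fin n → ℝ)) = ContinuousLinearMap.pi ξ := by
  have hli : LinearIndependent ℝ
      (fun i => ((ξ i : EuclideanSpace ℝ (Fin n) →ₗ[ℝ] ℝ) :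
        Module.Dual ℝ (EuclideanSpace ℝ (Fin n)))) := by
    have := hξ.map' (ContinuousLinearMap.coeLM ℝ)
      (LinearMap.ker_eq_bot.2 ContinuousLinearMap.coe_injective)
    exact this
  have hspan := hli.span_eq_top_of_card_eq_finrank' (by
    rw [Subspace.dual_finrank_eq]; simp)
  have hinj : Function.Injective (ContinuousLinearMap.pi ξ) := by
    rw [injective_iff_map_eq_zero]
    intro X hX
    rw [← Module.forall_dual_apply_eq_zero_iff ℝ]
    intro f
    have hf : f ∈ Submodule.span ℝ (range fun i =>
        ((ξ i : EuclideanSpace ℝ (Fin n) →ₗ[ℝ] ℝ) : Module.Dual ℝ (EuclideanSpace ℝ (Fin n)))) := by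
      rw [hspan]; trivial
    induction hf using Submodule.span_induction with
    | mem f hf =>
      obtain ⟨i, rfl⟩ := hf
      exact congrFun hX i
    | zero => rfl
    | add f g _ _ hf hg => rw [LinearMap.add_apply, hf, hg, add_zero]
    | smul a f _ hf => rw [LinearMap.smul_apply, hf, smul_zero]
  refine ⟨(LinearEquiv.ofInjectiveOfFinrankEq
    (ContinuousLinearMap.pi ξ : EuclideanSpace ℝ (Fin n) →L[ℝ] (Fin n → ℝ)).toLinearMap
    hinj (by simp)).toContinuousLinearEquiv, ?_⟩
  ext X i
  rfl

/-- The vector fields dual to a smooth coframe are smooth. -/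
theorem exists_dualFrame {V : Set (EuclideanSpace ℝ (Fin n))} (hV : IsOpen V)
    {w : Fin n → EuclideanSpace ℝ (Fin n) → (EuclideanSpace ℝ (Fin n) →L[ℝ] ℝ)}
    (hw : ∀ i, ContDiffOn ℝ ∞ (w i) V) (hli : ∀ x ∈ V, LinearIndependent ℝ fun i => w i x) :
    ∃ e : Fin n → EuclideanSpace ℝ (Fin n) → EuclideanSpace ℝ (Fin n),
      (∀ j, ContDiffOn ℝ ∞ (e j) V) ∧
      ∀ x ∈ V, ∀ i j, w i x (e j x) = if i = j then 1 else 0 := by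
  set B : EuclideanSpace ℝ (Fin n) → EuclideanSpace ℝ (Fin n) →L[ℝ] (Fin n → ℝ) :=
    fun x => ContinuousLinearMap.pi fun i => w i x with hB
  have hBs : ContDiffOn ℝ ∞ B V := by
    rw [contDiffOn_clm_apply]
    intro X
    rw [contDiffOn_pi]
    intro i
    exact (hw i).clm_apply contDiffOn_const
  refine ⟨fun j x => (B x).inverse (Pi.single j 1), fun j x hx => ?_, fun x hx i j => ?_⟩
  · obtain ⟨e, he⟩ := exists_equiv_pi_of_linearIndependent (hli x hx)
    have h1 : ContDiffAt ℝ ∞ ContinuousLinearMap.inverse (B x) := by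
      rw [hB]; dsimp only; rw [← he]; exact contDiffAt_map_inverse e
    have h2 := h1.comp x (hBs.contDiffAt (hV.mem_nhds hx))
    exact (h2.clm_apply contDiffAt_const).contDiffWithinAt
  · obtain ⟨e, he⟩ := exists_equiv_pi_of_linearIndependent (hli x hx)
    have h1 : B x = e := he.symm
    have h2 : B x ((B x).inverse (Pi.single j 1)) i = if i = j then 1 else 0 := by
      rw [h1, ContinuousLinearMap.inverse_equiv]
      simp [Pi.single_apply]
    exact h2

/-- The rational normal curve `l ↦ ω(l)` of the coframe `w`, as a function of the point and of
the affine parameter. -/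
def curveForm (w : Fin n → EuclideanSpace ℝ (Fin n) → (EuclideanSpace ℝ (Fin n) →L[ℝ] ℝ))
    (q : EuclideanSpace ℝ (Fin n) × ℝ) : EuclideanSpace ℝ (Fin n) →L[ℝ] ℝ :=
  ∑ i : Fin n, q.2 ^ (i : ℕ) • w i q.1

/-- The derivative of `curveForm` in the affine parameter. -/
def curveFormDeriv (w : Fin n → EuclideanSpace ℝ (Fin n) → (EuclideanSpace ℝ (Fin n) →L[ℝ] ℝ))
    (q : EuclideanSpace ℝ (Fin n) × ℝ) : EuclideanSpace ℝ (Fin n) →L[ℝ] ℝ :=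
  ∑ i : Fin n, ((i : ℕ) * q.2 ^ ((i : ℕ) - 1) : ℝ) • w i q.1

variable {w : Fin n → EuclideanSpace ℝ (Fin n) → (EuclideanSpace ℝ (Fin n) →L[ℝ] ℝ)}
  {V : Set (EuclideanSpace ℝ (Fin n))}

theorem rnc_one_eq_curveForm (x : EuclideanSpace ℝ (Fin n)) (l : ℝ) :
    rnc (fun i => w i x) l 1 = curveForm w (x, l) := by
  simp [rnc, curveForm]

theorem contDiffOn_curveForm (hw : ∀ i, ContDiffOn ℝ ∞ (w i) V) :
    ContDiffOn ℝ ∞ (curveForm w) (V ×ˢ univ) :=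
  ContDiffOn.sum fun i _ => (contDiff_snd.pow _).contDiffOn.smul
    ((hw i).comp contDiffOn_fst fun _ hq => hq.1)

theorem contDiffOn_curveFormDeriv (hw : ∀ i, ContDiffOn ℝ ∞ (w i) V) :
    ContDiffOn ℝ ∞ (curveFormDeriv w) (V ×ˢ univ) :=
  ContDiffOn.sum fun i _ => (contDiff_const.mul (contDiff_snd.pow _)).contDiffOn.smul
    ((hw i).comp contDiffOn_fst fun _ hq => hq.1)

theorem fderiv_curveForm_snd {q : EuclideanSpace ℝ (Fin n) × ℝ}
    (hw : DifferentiableAt ℝ (curveForm w) q) :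
    fderiv ℝ (curveForm w) q (0, 1) = curveFormDeriv w q := by
  have h1 : HasDerivAt (fun l : ℝ => curveForm w (q.1, l)) (fderiv ℝ (curveForm w) q (0, 1)) q.2 :=
    HasFDerivAt.comp_hasDerivAt (f := fun l : ℝ => (q.1, l)) q.2 hw.hasFDerivAt
      ((hasDerivAt_const q.2 q.1).prodMk (hasDerivAt_id q.2))
  refine h1.unique ?_
  unfold curveForm curveFormDeriv
  exact HasDerivAt.fun_sum fun i _ => (hasDerivAt_pow (i : ℕ) q.2).smul_const (w i q.1)

theorem curveForm_apply_dual {x X : EuclideanSpace ℝ (Fin n)} {j : Fin n}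
    (h : ∀ i, w i x X = if i = j then 1 else 0) (l : ℝ) :
    curveForm w (x, l) X = l ^ (j : ℕ) := by
  simp [curveForm, h]

theorem curveFormDeriv_apply_dual {x X : EuclideanSpace ℝ (Fin n)} {j : Fin n}
    (h : ∀ i, w i x X = if i = j then 1 else 0) (l : ℝ) :
    curveFormDeriv w (x, l) X = (j : ℕ) * l ^ ((j : ℕ) - 1) := by
  simp [curveFormDeriv, h]

theorem rnc_eq_smul_rnc_one {F : Type*} [AddCommGroup F] [Module ℝ F] (ξ : Fin n → F) {s t : ℝ}
    (ht : t ≠ 0) : rnc ξ s t = t ^ (n - 1) • rnc ξ (s / t) 1 := by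
  simp only [rnc, Finset.smul_sum, smul_smul]
  refine Finset.sum_congr rfl fun i _ => ?_
  congr 1
  have : n - 1 = (n - 1 - (i : ℕ)) + i := by have := i.2; omega
  conv_rhs => rw [this, pow_add]
  rw [one_pow, mul_one, mul_assoc, ← mul_pow, mul_div_cancel₀ _ ht, mul_comm]

/-- Integrability of the curve of forms: `dω(l)`, for constant `l`, vanishes on the common kernel of
`ω(l)` and its `l`-derivative. It holds where a hypersurface touches `ker ω(l)` and has tangent
spaces `ker ω(l(y))`: the terms with the derivatives of `l` drop out on that kernel. -/
theorem fderiv_curveForm_symm_of_hypersurface (hn : 2 ≤ n) (hV : IsOpen V)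
    (hw : ∀ i, ContDiffOn ℝ ∞ (w i) V) (hli : ∀ x ∈ V, LinearIndependent ℝ fun i => w i x)
    {x : EuclideanSpace ℝ (Fin n)} (hx : x ∈ V) {l : ℝ} {g : EuclideanSpace ℝ (Fin n) → ℝ}
    (hg : ContDiffAt ℝ ∞ g x) (hgx : g x = 0) (hdg : fderiv ℝ g x ≠ 0) {c : ℝ} (hc : c ≠ 0)
    (hgc : fderiv ℝ g x = c • curveForm w (x, l))
    (hcone : ∀ᶠ y in 𝓝 x, g y = 0 → fderiv ℝ g y ∈ coneOver (rnc fun i => w i y))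
    {X Y : EuclideanSpace ℝ (Fin n)} (hX : curveForm w (x, l) X = 0)
    (hX' : curveFormDeriv w (x, l) X = 0) (hY : curveForm w (x, l) Y = 0)
    (hY' : curveFormDeriv w (x, l) Y = 0) :
    fderiv ℝ (curveForm w) (x, l) (X, 0) Y = fderiv ℝ (curveForm w) (x, l) (Y, 0) X := by
  obtain ⟨e, he, hwe⟩ := exists_dualFrame hV hw hli
  set i0 : Fin n := ⟨0, by omega⟩
  have hi0 : (i0 : ℕ) = 0 := rfl
  set i1 : Fin n := ⟨1, by omega⟩
  have hi1 : (i1 : ℕ) = 1 := rfl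
  have hdgs : ContDiffAt ℝ ∞ (fderiv ℝ g) x := hg.fderiv_right (by simp)
  have hes : ∀ j, ContDiffAt ℝ ∞ (e j) x := fun j => (he j).contDiffAt (hV.mem_nhds hx)
  -- `dg = c0 ω(c1 / c0)` along the hypersurface, as `ω(l)` takes the values `1` and `l` on the
  -- first two vectors of the dual frame
  set c0 : EuclideanSpace ℝ (Fin n) → ℝ := fun y => fderiv ℝ g y (e i0 y) with hc0
  set c1 : EuclideanSpace ℝ (Fin n) → ℝ := fun y => fderiv ℝ g y (e i1 y) with hc1
  have hc0s : ContDiffAt ℝ ∞ c0 x := hdgs.clm_apply (hes i0)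
  have hc1s : ContDiffAt ℝ ∞ c1 x := hdgs.clm_apply (hes i1)
  have hc0x : c0 x = c := by
    have := curveForm_apply_dual (fun i => hwe x hx i i0) l
    simp only [hc0, hgc, smul_apply, this, hi0, pow_zero, smul_eq_mul, mul_one]
  have hc1x : c1 x = c * l := by
    have := curveForm_apply_dual (fun i => hwe x hx i i1) l
    simp only [hc1, hgc, smul_apply, this, hi1, pow_one, smul_eq_mul]
  have hc0ne : c0 x ≠ 0 := by rw [hc0x]; exact hc
  set L : EuclideanSpace ℝ (Fin n) → ℝ := fun y => c1 y / c0 y with hL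
  have hLs : ContDiffAt ℝ ∞ L x := hc1s.div hc0s hc0ne
  have hLx : L x = l := by
    simp only [hL, hc0x, hc1x]
    field_simp
  have hO : IsOpen (V ×ˢ (univ : Set ℝ)) := hV.prod isOpen_univ
  have hΩs : ContDiffAt ℝ ∞ (curveForm w) (x, l) :=
    (contDiffOn_curveForm hw).contDiffAt (hO.mem_nhds ⟨hx, mem_univ _⟩)
  have hΩs' : ContDiffAt ℝ ∞ (curveForm w) (x, L x) := by rwa [hLx]
  have hWs : ContDiffAt ℝ ∞ (fun y => curveForm w (y, L y)) x :=
    ContDiffAt.comp (g := curveForm w) (f := fun y => (y, L y)) x hΩs' (contDiffAt_id.prodMk hLs)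
  have hprop : ∀ᶠ y in 𝓝 x, g y = 0 → fderiv ℝ g y = c0 y • curveForm w (y, L y) := by
    filter_upwards [hcone, hV.mem_nhds hx, hc0s.continuousAt.eventually_ne hc0ne]
      with y hy hyV hy0 hgy
    obtain ⟨r, s, t, hr, -, hrst⟩ := hy hgy
    have ht : t ≠ 0 := by
      rintro rfl
      apply hy0
      simp only [hc0, hrst, rnc, smul_apply, sum_apply,
        hwe y hyV]
      simp [hi0, show n - 1 ≠ 0 by omega]
    rw [rnc_eq_smul_rnc_one _ ht, rnc_one_eq_curveForm, smul_smul] at hrst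
    have h0 : c0 y = r * t ^ (n - 1) := by
      have := curveForm_apply_dual (fun i => hwe y hyV i i0) (s / t)
      simp only [hc0, hrst, smul_apply, this, hi0, pow_zero, smul_eq_mul,
        mul_one]
    have h1 : c1 y = r * t ^ (n - 1) * (s / t) := by
      have := curveForm_apply_dual (fun i => hwe y hyV i i1) (s / t)
      simp only [hc1, hrst, smul_apply, this, hi1, pow_one, smul_eq_mul]
    have h2 : L y = s / t := by
      rw [h0] at hy0
      simp only [hL, h0, h1]
      exact mul_div_cancel_left₀ _ hy0
    rw [h0, h2, hrst]
  have hder : ∀ Z T : EuclideanSpace ℝ (Fin n), curveFormDeriv w (x, l) T = 0 →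
      fderiv ℝ (fun y => curveForm w (y, L y)) x Z T =
        fderiv ℝ (curveForm w) (x, l) (Z, 0) T := by
    intro Z T hT
    have h1 : HasFDerivAt (fun y => curveForm w (y, L y))
        ((fderiv ℝ (curveForm w) (x, L x)).comp
          ((ContinuousLinearMap.id ℝ _).prod (fderiv ℝ L x))) x :=
      HasFDerivAt.comp (f := fun y => (y, L y)) x (hΩs'.differentiableAt (by simp)).hasFDerivAt
        ((hasFDerivAt_id x).prodMk (hLs.differentiableAt (by simp)).hasFDerivAt)
    rw [h1.fderiv, hLx]
    have h2 : ((ContinuousLinearMap.id ℝ _).prod (fderiv ℝ L x)) Z =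
        (Z, (0 : ℝ)) + fderiv ℝ L x Z • ((0 : EuclideanSpace ℝ (Fin n)), (1 : ℝ)) := by
      ext <;> simp
    rw [ContinuousLinearMap.comp_apply, h2, map_add, map_smul,
      fderiv_curveForm_snd (hΩs.differentiableAt (by simp)), add_apply,
      smul_apply, hT, smul_zero, add_zero]
  rw [← hder X Y hY', ← hder Y X hX']
  exact fderiv_symm_of_proportional hg hgx hdg hc0s hWs hprop
    (by rw [hgc, smul_apply, hX, smul_zero])
    (by rw [hgc, smul_apply, hY, smul_zero])

end Coframe

/-! ### Foliations by α-manifolds -/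

section AlphaFoliation

variable {n : ℕ} {M : Type*} [TopologicalSpace M] [ChartedSpace (EuclideanSpace ℝ (Fin n)) M]
  [IsManifold (𝓡 n) ∞ M] {φ : OpenPartialHomeomorph M (EuclideanSpace ℝ (Fin n))}

/-- For an involutive structure, every value `l₀` at a point extends to a function `Λ` for which the
hyperplanes `ker ω(Λ)` are tangent to the level sets of a function. -/
theorem GL2Structure.IsInvolutive.exists_function_fderiv_eq_smul_curveForm (hn : 2 ≤ n)
    {S : GL2Structure n M} (hS : S.IsInvolutive) (hφ : φ ∈ IsManifold.maximalAtlas (𝓡 n) ∞ M)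
    {V : Set (EuclideanSpace ℝ (Fin n))} (hV : IsOpen V) (hVφ : V ⊆ φ.target)
    {w : Fin n → EuclideanSpace ℝ (Fin n) → (EuclideanSpace ℝ (Fin n) →L[ℝ] ℝ)}
    (hw : ∀ i, ContDiffOn ℝ ∞ (w i) V)
    (hwV : ∀ x ∈ V, LinearIndependent ℝ (fun i => w i x) ∧
      chartCone S φ x = coneOver (rnc fun i => w i x))
    {x₀ : EuclideanSpace ℝ (Fin n)} (hx₀ : x₀ ∈ V) (l₀ : ℝ) :
    ∃ (U : Set (EuclideanSpace ℝ (Fin n))) (f Λ : EuclideanSpace ℝ (Fin n) → ℝ), IsOpen U ∧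
      x₀ ∈ U ∧ U ⊆ V ∧ ContDiffOn ℝ ∞ f U ∧ ContinuousOn Λ U ∧ Λ x₀ = l₀ ∧
      ∀ x ∈ U, ∃ r : ℝ, r ≠ 0 ∧ fderiv ℝ f x = r • curveForm w (x, Λ x) := by
  have hO : IsOpen (V ×ˢ (univ : Set ℝ)) := hV.prod isOpen_univ
  obtain ⟨e, he, hwe⟩ := exists_dualFrame hV hw fun x hx => (hwV x hx).1
  set i0 : Fin n := ⟨0, by omega⟩
  have hi0 : (i0 : ℕ) = 0 := rfl
  set i1 : Fin n := ⟨1, by omega⟩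
  have hi1 : (i1 : ℕ) = 1 := rfl
  have hΩ0 : ∀ q ∈ V ×ˢ (univ : Set ℝ), curveForm w q (e i0 q.1) = 1 := fun q hq => by
    simpa [hi0] using curveForm_apply_dual (fun i => hwe q.1 hq.1 i i0) q.2
  have hΩ1 : ∀ q ∈ V ×ˢ (univ : Set ℝ), curveForm w q (e i1 q.1) = q.2 := fun q hq => by
    simpa [hi1] using curveForm_apply_dual (fun i => hwe q.1 hq.1 i i1) q.2
  have hΩ0' : ∀ q ∈ V ×ˢ (univ : Set ℝ), curveFormDeriv w q (e i0 q.1) = 0 := fun q hq => by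
    simpa [hi0] using curveFormDeriv_apply_dual (fun i => hwe q.1 hq.1 i i0) q.2
  have hΩ1' : ∀ q ∈ V ×ˢ (univ : Set ℝ), curveFormDeriv w q (e i1 q.1) = 1 := fun q hq => by
    simpa [hi1] using curveFormDeriv_apply_dual (fun i => hwe q.1 hq.1 i i1) q.2
  have hes : ∀ j, ContDiffOn ℝ ∞ (fun q : EuclideanSpace ℝ (Fin n) × ℝ => e j q.1)
      (V ×ˢ (univ : Set ℝ)) := fun j => (he j).comp contDiffOn_fst fun _ hq => hq.1
  obtain ⟨U, f, Λ, hU, hxU, hf, hΛ, hΛ0, h⟩ := exists_function_fderiv_proportional hO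
    (x₀ := x₀) (l₀ := l₀) ⟨hx₀, mem_univ _⟩ (contDiffOn_curveForm hw)
    (contDiffOn_curveFormDeriv hw) (e := fun q => e i1 q.1 - q.2 • e i0 q.1)
    (e' := fun q => e i0 q.1) ((hes i1).sub (contDiffOn_snd.smul (hes i0))) (hes i0)
    (fun q hq => fderiv_curveForm_snd
      (((contDiffOn_curveForm hw).contDiffAt (hO.mem_nhds hq)).differentiableAt (by simp)))
    (fun q hq => by simp [hΩ0 q hq, hΩ1 q hq]) (fun q hq => by simp [hΩ0' q hq, hΩ1' q hq])
    hΩ0 hΩ0' (by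
      rintro ⟨x, l⟩ hq X Y hX hX' hY hY'
      have hmem : curveForm w (x, l) ∈ chartCone S φ x := by
        rw [(hwV x hq.1).2]
        exact ⟨1, l, 1, one_ne_zero, Or.inr one_ne_zero, by rw [one_smul, rnc_one_eq_curveForm]⟩
      obtain ⟨g, hg, hgx, hdg, ⟨c, hc, hgc⟩, hcone⟩ :=
        hS.exists_function_in_chart hφ (hVφ hq.1) hmem
      refine fderiv_curveForm_symm_of_hypersurface hn hV hw (fun x hx => (hwV x hx).1) hq.1 hg hgx
        hdg hc hgc ?_ hX hX' hY hY'
      filter_upwards [hcone, hV.mem_nhds hq.1] with y hy hyV hgy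
      rw [← (hwV y hyV).2]
      exact hy hgy)
  exact ⟨U, f, Λ, hU, hxU, fun x hx => (h x hx).1.1, hf, hΛ, hΛ0, fun x hx => (h x hx).2⟩

end AlphaFoliation

/-! ### Changes of chart -/

section ChangeOfChart

variable {n : ℕ} {M : Type*} [TopologicalSpace M] [ChartedSpace (EuclideanSpace ℝ (Fin n)) M]

theorem trans_mem_maximalAtlas {ψ : OpenPartialHomeomorph M (EuclideanSpace ℝ (Fin n))}
    (hψ : ψ ∈ IsManifold.maximalAtlas (𝓡 n) ∞ M)
    {e : OpenPartialHomeomorph (EuclideanSpace ℝ (Fin n)) (EuclideanSpace ℝ (Fin n))}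
    (he : ContDiffOn ℝ ∞ e e.source) (he' : ContDiffOn ℝ ∞ e.symm e.target) :
    ψ.trans e ∈ IsManifold.maximalAtlas (𝓡 n) ∞ M := by
  have hmem : e ∈ contDiffGroupoid ∞ (𝓡 n) := by
    rw [contDiffGroupoid, mem_groupoid_of_pregroupoid]
    constructor
    · change ContDiffOn ℝ ∞ _ _
      simpa using he
    · change ContDiffOn ℝ ∞ _ _
      simpa using he'
  have hmem' := (contDiffGroupoid ∞ (𝓡 n)).symm hmem
  rw [IsManifold.maximalAtlas, mem_maximalAtlas_iff] at hψ ⊢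
  intro e' he'
  obtain ⟨h1, h2⟩ := hψ e' he'
  constructor
  · rw [OpenPartialHomeomorph.trans_symm_eq_symm_trans_symm, OpenPartialHomeomorph.trans_assoc]
    exact (contDiffGroupoid ∞ (𝓡 n)).trans hmem' h1
  · rw [← OpenPartialHomeomorph.trans_assoc]
    exact (contDiffGroupoid ∞ (𝓡 n)).trans h2 hmem

variable [IsManifold (𝓡 n) ∞ M] {φ : OpenPartialHomeomorph M (EuclideanSpace ℝ (Fin n))}

/-- A parametrisation of the cone in a chart is the same as a parametrisation of the cone on the
manifold by pulled back covectors. -/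
theorem chartCone_eq_coneOver_iff {S : GL2Structure n M}
    (hφ : φ ∈ IsManifold.maximalAtlas (𝓡 n) ∞ M) {x : EuclideanSpace ℝ (Fin n)}
    (hx : x ∈ φ.target) {γ : ℝ → ℝ → (EuclideanSpace ℝ (Fin n) →L[ℝ] ℝ)} :
    chartCone S φ x = coneOver γ ↔
      S.cone (φ.symm x) = coneOver fun s t : ℝ =>
        ((γ s t).comp (mfderiv (𝓡 n) (𝓡 n) φ (φ.symm x)) :
          TangentSpace (𝓡 n) (φ.symm x) →L[ℝ] ℝ) := by
  have key : ∀ η : EuclideanSpace ℝ (Fin n) →L[ℝ] ℝ, η ∈ coneOver γ ↔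
      (η.comp (mfderiv (𝓡 n) (𝓡 n) φ (φ.symm x)) : TangentSpace (𝓡 n) (φ.symm x) →L[ℝ] ℝ) ∈
        coneOver fun s t : ℝ =>
          ((γ s t).comp (mfderiv (𝓡 n) (𝓡 n) φ (φ.symm x)) :
            TangentSpace (𝓡 n) (φ.symm x) →L[ℝ] ℝ) := by
    intro η
    refine exists_congr fun r => exists_congr fun s => exists_congr fun t =>
      and_congr_right fun _ => and_congr_right fun _ => ?_
    rw [comp_mfderiv_chart_eq_iff hφ hx]
    have : (r • ((γ s t).comp (mfderiv (𝓡 n) (𝓡 n) φ (φ.symm x)) :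
        TangentSpace (𝓡 n) (φ.symm x) →L[ℝ] ℝ)).comp (mfderiv (𝓡 n) (𝓡 n) φ.symm x) =
        r • γ s t := by
      refine ContinuousLinearMap.ext fun X => ?_
      exact congrArg (fun Z => r • γ s t Z) (mfderiv_chart_symm_apply hφ hx X)
    rw [this]
  constructor
  · intro h
    ext ξ
    obtain ⟨η, rfl⟩ : ∃ η : EuclideanSpace ℝ (Fin n) →L[ℝ] ℝ,
        η.comp (mfderiv (𝓡 n) (𝓡 n) φ (φ.symm x)) = ξ :=
      ⟨ξ.comp (mfderiv (𝓡 n) (𝓡 n) φ.symm x), (comp_mfderiv_chart_eq_iff hφ hx).2 rfl⟩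
    rw [← key, ← h]
    rfl
  · intro h
    ext η
    rw [key, ← h]
    rfl

end ChangeOfChart

/-! ### Existence of the normal form -/

section NormalFormExistence

variable {n : ℕ} {M : Type*} [TopologicalSpace M] [ChartedSpace (EuclideanSpace ℝ (Fin n)) M]
  [IsManifold (𝓡 n) ∞ M]

theorem hasFDerivAt_toLp_pi {f : Fin n → EuclideanSpace ℝ (Fin n) → ℝ}
    {x : EuclideanSpace ℝ (Fin n)} (hf : ∀ k, DifferentiableAt ℝ (f k) x) :
    HasFDerivAt (fun y => WithLp.toLp 2 fun k => f k y)
      ((PiLp.continuousLinearEquiv 2 ℝ fun _ : Fin n => ℝ).symm.toContinuousLinearMap.comp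
        (ContinuousLinearMap.pi fun k => fderiv ℝ (f k) x)) x :=
  ((PiLp.continuousLinearEquiv 2 ℝ fun _ : Fin n => ℝ).symm.toContinuousLinearMap.hasFDerivAt).comp
    x (hasFDerivAt_pi.2 fun k => (hf k).hasFDerivAt)

/-- In coordinates `z` given by functions `f k`, the differential of `u` is `∑ ∂u/∂zᵏ df k`. -/
theorem fderiv_eq_sum_pd_smul {f : Fin n → EuclideanSpace ℝ (Fin n) → ℝ}
    {u : EuclideanSpace ℝ (Fin n) → ℝ} {σ : EuclideanSpace ℝ (Fin n) → EuclideanSpace ℝ (Fin n)}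
    {x : EuclideanSpace ℝ (Fin n)} (hf : ∀ k, DifferentiableAt ℝ (f k) x)
    (hu : DifferentiableAt ℝ u x)
    (hσ : DifferentiableAt ℝ σ (WithLp.toLp 2 fun k => f k x))
    (hinv : ∀ᶠ y in 𝓝 x, σ (WithLp.toLp 2 fun k => f k y) = y) :
    fderiv ℝ u x = ∑ k, pd k (u ∘ σ) (WithLp.toLp 2 fun k => f k x) • fderiv ℝ (f k) x := by
  have hσx : σ (WithLp.toLp 2 fun k => f k x) = x := hinv.self_of_nhds
  have h1 := hasFDerivAt_toLp_pi hf
  have hu' : HasFDerivAt u (fderiv ℝ u x) (σ (WithLp.toLp 2 fun k => f k x)) := by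
    rw [hσx]; exact hu.hasFDerivAt
  have h2 : HasFDerivAt (u ∘ σ) ((fderiv ℝ u x).comp (fderiv ℝ σ (WithLp.toLp 2 fun k => f k x)))
      (WithLp.toLp 2 fun k => f k x) := hu'.comp _ hσ.hasFDerivAt
  have h3 := h2.comp x h1
  have h4 : HasFDerivAt u (fderiv ℝ u x) x := hu.hasFDerivAt
  have h5 := h4.unique (h3.congr_of_eventuallyEq (by
    filter_upwards [hinv] with y hy
    simp only [Function.comp, hy]))
  ext X
  have h6 : (WithLp.toLp 2 fun k => fderiv ℝ (f k) x X) =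
      ∑ k, fderiv ℝ (f k) x X • EuclideanSpace.single k (1 : ℝ) := by
    ext j
    simp [Pi.single_apply]
  have h7 : fderiv ℝ u x X = fderiv ℝ (u ∘ σ) (WithLp.toLp 2 fun k => f k x)
      (WithLp.toLp 2 fun k => fderiv ℝ (f k) x X) := by
    rw [h2.fderiv]
    exact DFunLike.congr_fun h5 X
  rw [h7, h6, map_sum, sum_apply]
  refine Finset.sum_congr rfl fun k _ => ?_
  rw [map_smul, smul_apply, pd, smul_eq_mul, smul_eq_mul, mul_comm]

/-- The normal form of an involutive structure. Foliations by α-manifolds through `n + 2` distinct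
values of the parameter at the given point are level sets of functions; `n` of them serve as
coordinates, the other two as `u` and `v`. -/
theorem GL2Structure.IsInvolutive.exists_hasNormalForm_of_two_le (hn : 2 ≤ n)
    {S : GL2Structure n M} (hS : S.IsInvolutive) (y₀ : M) :
    ∃ (φ : OpenPartialHomeomorph M (EuclideanSpace ℝ (Fin n)))
      (u v : EuclideanSpace ℝ (Fin n) → ℝ), y₀ ∈ φ.source ∧ S.HasNormalForm φ u v := by
  set ψ := chartAt (EuclideanSpace ℝ (Fin n)) y₀ with hψdef
  have hψ : ψ ∈ IsManifold.maximalAtlas (𝓡 n) ∞ M := IsManifold.chart_mem_maximalAtlas y₀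
  have hy₀ : y₀ ∈ ψ.source := mem_chart_source _ y₀
  set x₀ := ψ y₀ with hx₀def
  obtain ⟨V, hV, hx₀, hVψ, w, hw, hwV⟩ := S.exists_coframe_in_chart hψ (ψ.map_source hy₀)
  choose U f Λ hU hxU hUV hf hΛ hΛ0 hprop using
    hS.exists_function_fderiv_eq_smul_curveForm hn hψ hV hVψ hw hwV hx₀
  -- the parameter values `0, …, n - 1` give the coordinates, `n` and `n + 1` give `u` and `v`
  set p : Fin n → EuclideanSpace ℝ (Fin n) → ℝ := fun k => Λ (k : ℕ) with hp
  have hcont : ∀ l, ContinuousAt (Λ l) x₀ := fun l =>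
    (hΛ l).continuousAt ((hU l).mem_nhds (hxU l))
  have hne : ∀ l l', l ≠ l' → ∀ᶠ x in 𝓝 x₀, Λ l x ≠ Λ l' x := fun l l' h =>
    (((hcont l).sub (hcont l')).eventually_ne (by rwa [Pi.sub_apply, hΛ0, hΛ0, sub_ne_zero])).mono
      fun _ => sub_ne_zero.1
  have hgood : ∀ᶠ x in 𝓝 x₀, (∀ k : Fin n, x ∈ U (k : ℕ)) ∧ x ∈ U n ∧ x ∈ U (n + 1) ∧
      (∀ k k' : Fin n, k ≠ k' → p k x ≠ p k' x) ∧ (∀ k, Λ n x ≠ p k x) ∧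
      (∀ k, Λ (n + 1) x ≠ p k x) ∧ Λ n x ≠ Λ (n + 1) x := by
    refine (eventually_all.2 fun k => (hU _).eventually_mem (hxU _)).and
      (((hU _).eventually_mem (hxU _)).and (((hU _).eventually_mem (hxU _)).and
        ((eventually_all.2 fun k => eventually_all.2 fun k' => ?_).and
        ((eventually_all.2 fun k => ?_).and ((eventually_all.2 fun k => ?_).and ?_)))))
    · by_cases hk : k = k'
      · simp [hk]
      · filter_upwards [hne (k : ℕ) (k' : ℕ) (by
          intro h; exact hk (Fin.ext (Nat.cast_injective h)))] with x hx _ using hx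
    · refine hne _ _ ?_
      have : (k : ℕ) < n := k.2
      exact_mod_cast this.ne'
    · refine hne _ _ ?_
      have : (k : ℕ) < n + 1 := k.2.trans (Nat.lt_succ_self n)
      exact_mod_cast this.ne'
    · exact hne _ _ (by simp)
  obtain ⟨W, hWgood, hW, hxW⟩ := mem_nhds_iff.1 hgood
  have hWV : W ⊆ V := fun x hx => hUV _ (hWgood hx).2.1
  have hfd : ∀ l, W ⊆ U l → ∀ x ∈ W, DifferentiableAt ℝ (f l) x := fun l hl x hx =>
    ((hf l).contDiffAt ((hU l).mem_nhds (hl hx))).differentiableAt (by simp)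
  have hfk : ∀ (k : Fin n), ∀ x ∈ W, DifferentiableAt ℝ (f (k : ℕ)) x := fun k =>
    hfd _ fun x hx => (hWgood hx).1 k
  set Φ : EuclideanSpace ℝ (Fin n) → EuclideanSpace ℝ (Fin n) :=
    fun x => WithLp.toLp 2 fun k : Fin n => f (k : ℕ) x with hΦdef
  have hΦ : ContDiffOn ℝ ∞ Φ W := by
    refine (PiLp.continuousLinearEquiv 2 ℝ fun _ : Fin n => ℝ).symm.contDiff.comp_contDiffOn
      (contDiffOn_pi.2 fun k => (hf _).mono fun x hx => (hWgood hx).1 k)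
  have hli : ∀ x ∈ W, LinearIndependent ℝ fun k : Fin n => fderiv ℝ (f (k : ℕ)) x := by
    intro x hx
    choose r hr hrk using fun k : Fin n => hprop (k : ℕ) x ((hWgood hx).1 k)
    have h1 : LinearIndependent ℝ fun k : Fin n => rnc (fun i => w i x) (p k x) 1 :=
      linearIndependent_rnc (fun k k' h => by
        by_contra hk; exact (hWgood hx).2.2.2.1 k k' hk h) (hwV x (hWV hx)).1
    have h2 := h1.units_smul fun k => Units.mk0 (r k) (hr k)
    convert h2 using 1
    ext1 k
    rw [hrk, ← rnc_one_eq_curveForm]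
    rfl
  obtain ⟨E, hE⟩ := exists_equiv_pi_of_linearIndependent (hli x₀ hxW)
  have hΦ' : HasFDerivAt Φ ((E.trans (PiLp.continuousLinearEquiv 2 ℝ fun _ : Fin n => ℝ).symm :
      EuclideanSpace ℝ (Fin n) ≃L[ℝ] EuclideanSpace ℝ (Fin n)) :
      EuclideanSpace ℝ (Fin n) →L[ℝ] EuclideanSpace ℝ (Fin n)) x₀ := by
    have h1 := hasFDerivAt_toLp_pi fun k => hfk k x₀ hxW
    rw [← hE] at h1
    exact h1
  obtain ⟨e, hxe, heW, heΦ, hes⟩ := exists_smooth_localInverse hW hxW hΦ hΦ'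
  have hes' : ∀ x ∈ e.source, ContDiffAt ℝ ∞ e.symm (Φ x) := by
    intro x hx
    refine hes.contDiffAt (e.open_target.mem_nhds ?_)
    rw [← heΦ]
    exact e.map_source hx
  have hinv : ∀ x ∈ e.source, ∀ᶠ y in 𝓝 x, e.symm (Φ y) = y := by
    intro x hx
    filter_upwards [e.open_source.mem_nhds hx] with y hy
    rw [← heΦ]
    exact e.left_inv hy
  set u := f n ∘ e.symm with hu
  set v := f (n + 1) ∘ e.symm with hv
  have hmain : ∀ x ∈ e.source, ((∀ k, pd k u (Φ x) ≠ 0) ∧ (∀ k, pd k v (Φ x) ≠ 0) ∧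
      (∀ i j, i ≠ j → ratio u v i (Φ x) ≠ ratio u v j (Φ x)) ∧
      chartCone S ψ x = coneOver fun s t => ∑ k : Fin n,
        ((∏ j ∈ Finset.univ.erase k, (s - t * ratio u v j (Φ x))) * pd k u (Φ x)) •
          fderiv ℝ (f (k : ℕ)) x) := by
    intro x hx
    have hxW' := heW hx
    obtain ⟨h1, h2, h3, h4, h5, h6, h7⟩ := hWgood hxW'
    choose r hr hrk using fun k : Fin n => hprop (k : ℕ) x (h1 k)
    obtain ⟨ru, hru, hru'⟩ := hprop n x h2
    obtain ⟨rv, hrv, hrv'⟩ := hprop (n + 1) x h3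
    have hinj : Function.Injective fun k => p k x := fun k k' h => by
      by_contra hk; exact h4 k k' hk h
    have hmu := fderiv_eq_sum_pd_smul (fun k => hfk k x hxW')
      (hfd n (fun x hx => (hWgood hx).2.1) x hxW') ((hes' x hx).differentiableAt (by simp))
      (hinv x hx)
    have hmv := fderiv_eq_sum_pd_smul (fun k => hfk k x hxW')
      (hfd (n + 1) (fun x hx => (hWgood hx).2.2.1) x hxW')
      ((hes' x hx).differentiableAt (by simp)) (hinv x hx)
    have := coneOver_rnc_eq hinj h5 h6 h7 (hwV x (hWV hxW')).1 hr hru hrv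
      (ξ := fun k : Fin n => fderiv ℝ (f (k : ℕ)) x)
      (fun k => by rw [rnc_one_eq_curveForm]; exact hrk k)
      (by rw [rnc_one_eq_curveForm]; exact hru') (by rw [rnc_one_eq_curveForm]; exact hrv')
      hmu hmv
    rw [(hwV x (hWV hxW')).2]
    exact this
  have hesrc : ContDiffOn ℝ ∞ e e.source := by
    rw [heΦ]; exact hΦ.mono heW
  refine ⟨ψ.trans e, u, v, ?_, trans_mem_maximalAtlas hψ hesrc hes, ⟨?_, ?_, ?_⟩, ?_⟩
  · rw [OpenPartialHomeomorph.trans_source]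
    exact ⟨hy₀, hxe⟩
  · exact (hf n).comp (hes.mono fun z hz => hz.1)
      fun z hz => (hWgood (heW (e.map_target hz.1))).2.1
  · exact (hf (n + 1)).comp (hes.mono fun z hz => hz.1)
      fun z hz => (hWgood (heW (e.map_target hz.1))).2.2.1
  · intro z hz
    have h := hmain _ (e.map_target hz.1)
    rw [← heΦ, e.right_inv hz.1] at h
    exact ⟨h.1, h.2.1, h.2.2.1⟩
  · rintro y ⟨hyψ, hye⟩
    obtain ⟨x, hxψ, rfl⟩ : ∃ x ∈ ψ.target, ψ.symm x = y :=
      ⟨ψ y, ψ.map_source hyψ, ψ.left_inv hyψ⟩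
    have hxe' : x ∈ e.source := by
      have h : ψ (ψ.symm x) ∈ e.source := hye
      rwa [ψ.right_inv hxψ] at h
    rw [(chartCone_eq_coneOver_iff hψ hxψ).1 (hmain x hxe').2.2.2]
    have hpt : ψ.trans e (ψ.symm x) = Φ x := by
      rw [OpenPartialHomeomorph.coe_trans, Function.comp, ψ.right_inv hxψ, heΦ]
    have hΦx : HasFDerivAt Φ _ x := hasFDerivAt_toLp_pi fun k => hfk k x (heW hxe')
    have hder : ∀ X, mfderiv (𝓡 n) (𝓡 n) (ψ.trans e) (ψ.symm x) X =
        fderiv ℝ Φ x (mfderiv (𝓡 n) (𝓡 n) ψ (ψ.symm x) X) := by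
      intro X
      rw [OpenPartialHomeomorph.coe_trans, heΦ]
      have hΦm : MDifferentiableAt (𝓡 n) (𝓡 n) Φ (ψ (ψ.symm x)) := by
        rw [ψ.right_inv hxψ]
        exact hΦx.differentiableAt.mdifferentiableAt
      rw [mfderiv_comp_apply _ hΦm ((mdifferentiable_of_mem_maximalAtlas hψ).mdifferentiableAt
        (ψ.map_target hxψ)), mfderiv_eq_fderiv, ψ.right_inv hxψ]
      rfl
    congr 1
    funext s t
    refine ContinuousLinearMap.ext fun X => ?_
    have key : ∀ Z, clearedForm u v s t (Φ x) (fderiv ℝ Φ x Z) = (∑ k : Fin n,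
        ((∏ j ∈ Finset.univ.erase k, (s - t * ratio u v j (Φ x))) * pd k u (Φ x)) •
          fderiv ℝ (f (k : ℕ)) x) Z := by
      intro Z
      rw [hΦx.fderiv, clearedForm, sum_apply, sum_apply]
      rfl
    change _ = clearedForm u v s t (ψ.trans e (ψ.symm x))
      (mfderiv (𝓡 n) (𝓡 n) (ψ.trans e) (ψ.symm x) X)
    rw [hder, hpt]
    exact (key _).symm

/-- In dimension one every coordinate serves as `u` and `v`: the cone consists of all nonzero
covectors. -/
theorem GL2Structure.exists_hasNormalForm_of_eq_one (hn : n = 1) (S : GL2Structure n M) (y₀ : M) :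
    ∃ (φ : OpenPartialHomeomorph M (EuclideanSpace ℝ (Fin n)))
      (u v : EuclideanSpace ℝ (Fin n) → ℝ), y₀ ∈ φ.source ∧ S.HasNormalForm φ u v := by
  subst hn
  set ψ := chartAt (EuclideanSpace ℝ (Fin 1)) y₀
  have hψ : ψ ∈ IsManifold.maximalAtlas (𝓡 1) ∞ M := IsManifold.chart_mem_maximalAtlas y₀
  set u : EuclideanSpace ℝ (Fin 1) → ℝ :=
    ⇑(EuclideanSpace.proj (𝕜 := ℝ) (0 : Fin 1) : EuclideanSpace ℝ (Fin 1) →L[ℝ] ℝ) with hu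
  have hpd : ∀ i x, pd i u x = 1 := by
    intro i x
    rw [pd, hu, ContinuousLinearMap.fderiv, Subsingleton.elim i 0]
    simp
  have hus : ContDiff ℝ ∞ u := (EuclideanSpace.proj (𝕜 := ℝ) (0 : Fin 1)).contDiff
  refine ⟨ψ, u, u, mem_chart_source _ y₀, hψ, ⟨hus.contDiffOn, hus.contDiffOn, fun x _ =>
    ⟨fun i => by simp [hpd], fun i => by simp [hpd],
      fun i j hij => absurd (Subsingleton.elim i j) hij⟩⟩, fun y hy => ?_⟩
  obtain ⟨x, hx, rfl⟩ : ∃ x ∈ ψ.target, ψ.symm x = y := ⟨ψ y, ψ.map_source hy, ψ.left_inv hy⟩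
  obtain ⟨V, hV, hxV, -, w, -, hwV⟩ := S.exists_coframe_in_chart hψ hx
  obtain ⟨hli, hcone⟩ := hwV x hxV
  have hall : ∀ γ : EuclideanSpace ℝ (Fin 1) →L[ℝ] ℝ, γ ≠ 0 →
      coneOver (fun _ _ : ℝ => γ) = {η | η ≠ 0} := by
    intro γ hγ
    ext η
    constructor
    · rintro ⟨r, -, -, hr, -, rfl⟩
      exact smul_ne_zero hr hγ
    · intro hη
      have hval : ∀ ζ : EuclideanSpace ℝ (Fin 1) →L[ℝ] ℝ, ∀ X,
          ζ X = X 0 * ζ (EuclideanSpace.single 0 1) := by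
        intro ζ X
        have : X = X 0 • EuclideanSpace.single 0 (1 : ℝ) := by
          ext i
          rw [Subsingleton.elim i 0]
          simp
        conv_lhs => rw [this, map_smul, smul_eq_mul]
      obtain ⟨c, hc, h⟩ := exists_eq_smul_of_ker_le (ξ := γ) (η := η) hη fun X hX => by
        rw [hval] at hX ⊢
        rcases mul_eq_zero.1 hX with h | h
        · rw [h, zero_mul]
        · refine absurd (ContinuousLinearMap.ext fun Z => ?_) hγ
          rw [hval, h, mul_zero]
          rfl
      exact ⟨c⁻¹, 1, 1, inv_ne_zero hc, Or.inl one_ne_zero, by rw [h, inv_smul_smul₀ hc]⟩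
  have h1 : coneOver (rnc fun i => w i x) = coneOver fun _ _ => w 0 x := by
    congr 1
    funext s t
    simp [rnc]
  have h2 : (fun s t => clearedForm u u s t x) = fun _ _ =>
      EuclideanSpace.proj (𝕜 := ℝ) (0 : Fin 1) := by
    funext s t
    simp [clearedForm, hpd]
  have h3 : chartCone S ψ x = coneOver fun s t => clearedForm u u s t x := by
    rw [hcone, h1, h2, hall _ (hli.ne_zero 0), hall]
    intro h
    have := DFunLike.congr_fun h (EuclideanSpace.single 0 (1 : ℝ))
    simp at this
  rw [(chartCone_eq_coneOver_iff hψ hx).1 h3, ψ.right_inv hx]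

end NormalFormExistence

/-! ### The function `λ` of an α-manifold in normal form -/

section SystemFromInvolutivity

variable {n : ℕ} {u v : EuclideanSpace ℝ (Fin n) → ℝ} {x : EuclideanSpace ℝ (Fin n)}

theorem clearedForm_single (s t : ℝ) (i : Fin n) :
    clearedForm u v s t x (EuclideanSpace.single i 1) =
      (∏ j ∈ Finset.univ.erase i, (s - t * ratio u v j x)) * pd i u x := by
  rw [clearedForm, sum_apply, Finset.sum_eq_single i]
  · simp
  · intro j _ hj
    simp [hj]
  · simp

theorem normalForm_single (l : ℝ) (i : Fin n) :
    normalForm u v l x (EuclideanSpace.single i 1) = pd i u x / (l - ratio u v i x) := by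
  rw [normalForm, sum_apply, Finset.sum_eq_single i]
  · simp
  · intro j _ hj
    simp [hj]
  · simp

/-- The cleared form is homogeneous of degree `n - 1` in the parameter. -/
theorem clearedForm_eq_smul_clearedForm_one {s t : ℝ} (ht : t ≠ 0) :
    clearedForm u v s t x = t ^ (n - 1) • clearedForm u v (s / t) 1 x := by
  rw [clearedForm, clearedForm, Finset.smul_sum]
  refine Finset.sum_congr rfl fun i _ => ?_
  have hcard : (Finset.univ.erase i).card = n - 1 := by simp
  rw [smul_smul, ← mul_assoc, ← hcard, ← Finset.prod_const, ← Finset.prod_mul_distrib]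
  congr 2
  refine Finset.prod_congr rfl fun j _ => ?_
  field_simp

/-- The parameter `l` is recovered from two coefficients `c / (l - a)` and `c / (l - b)` of the
normal form. -/
theorem eq_of_two_residues {a b l c : ℝ} (hab : a ≠ b) (ha : l ≠ a) (hb : l ≠ b) (hc : c ≠ 0) :
    c / (l - a) - c / (l - b) ≠ 0 ∧
      (a * (c / (l - a)) - b * (c / (l - b))) / (c / (l - a) - c / (l - b)) = l := by
  have ha' := sub_ne_zero.2 ha
  have hb' := sub_ne_zero.2 hb
  have h : c / (l - a) - c / (l - b) = c * (a - b) / ((l - a) * (l - b)) := by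
    field_simp
    ring
  have h0 : c / (l - a) - c / (l - b) ≠ 0 := by
    rw [h]
    exact div_ne_zero (mul_ne_zero hc (sub_ne_zero.2 hab)) (mul_ne_zero ha' hb')
  refine ⟨h0, ?_⟩
  rw [div_eq_iff h0]
  field_simp
  ring

/-- If `dw` vanishes on `ker w` at `x` then `dw ∧ w` vanishes there. -/
theorem dWedgeCoeff_eq_zero {w : EuclideanSpace ℝ (Fin n) → (EuclideanSpace ℝ (Fin n) →L[ℝ] ℝ)}
    (hw : DifferentiableAt ℝ w x) {i j k : Fin n} (hk : w x (EuclideanSpace.single k 1) ≠ 0)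
    (h : ∀ X Y, w x X = 0 → w x Y = 0 → fderiv ℝ w x X Y = fderiv ℝ w x Y X) :
    dWedgeCoeff w i j k x = 0 := by
  rw [dWedgeCoeff, extD_eq hw, extD_eq hw, extD_eq hw]
  generalize EuclideanSpace.single i (1 : ℝ) = X at *
  generalize EuclideanSpace.single j (1 : ℝ) = Y at *
  generalize EuclideanSpace.single k (1 : ℝ) = Z at *
  -- `w x Z • X - w x X • Z` is the projection of `X` to `ker w x` along `Z`, scaled
  have h1 := h (w x Z • X - w x X • Z) (w x Z • Y - w x Y • Z)
    (by simp only [map_sub, map_smul, smul_eq_mul]; ring)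
    (by simp only [map_sub, map_smul, smul_eq_mul]; ring)
  simp only [map_sub, map_smul, sub_apply, smul_apply, smul_eq_mul] at h1
  refine mul_left_cancel₀ hk ?_
  linear_combination h1

/-- A hypersurface whose conormals are the forms of the curve, and which is conormal to `ω(l)` at
`x`, provides a function `λ` with `λ(x) = l` for which `dω ∧ ω` vanishes at `x`. -/
theorem exists_integrabilityCoeff_eq_zero_of_hypersurface (hn : 2 ≤ n) (hu : ContDiffAt ℝ ∞ u x)
    (hv : ContDiffAt ℝ ∞ v x) (hui : ∀ i, pd i u x ≠ 0) (hvi : ∀ i, pd i v x ≠ 0)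
    (hdist : ∀ i j, i ≠ j → ratio u v i x ≠ ratio u v j x) {l : ℝ}
    (hl : ∀ i, l ≠ ratio u v i x) {g : EuclideanSpace ℝ (Fin n) → ℝ} (hg : ContDiffAt ℝ ∞ g x)
    (hgx : g x = 0) {c : ℝ} (hc : c ≠ 0) (hgc : fderiv ℝ g x = c • normalForm u v l x)
    (hcone : ∀ᶠ y in 𝓝 x, g y = 0 → fderiv ℝ g y ∈ coneOver fun s t => clearedForm u v s t y) :
    ∃ lam : EuclideanSpace ℝ (Fin n) → ℝ, ContDiffAt ℝ ∞ lam x ∧ lam x = l ∧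
      ∀ i j k, integrabilityCoeff u v lam i j k x = 0 := by
  set i0 : Fin n := ⟨0, by omega⟩
  set i1 : Fin n := ⟨1, by omega⟩
  have h01 : i0 ≠ i1 := by simp [i0, i1, Fin.ext_iff]
  -- if `dg = c ω(l)` then `G i = c / (l - a_i)`, so that two of them determine `l` and `c`
  set G : Fin n → EuclideanSpace ℝ (Fin n) → ℝ := fun i y => pd i g y / pd i u y with hG
  have hGs : ∀ i, ContDiffAt ℝ ∞ (G i) x := fun i => (smooth_pd hg i).div (smooth_pd hu i) (hui i)
  have hGval : ∀ {y : EuclideanSpace ℝ (Fin n)} {l c : ℝ}, (∀ i, pd i u y ≠ 0) →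
      fderiv ℝ g y = c • normalForm u v l y → ∀ i, G i y = c / (l - ratio u v i y) := by
    intro y l c hy h i
    simp only [hG]
    rw [pd, h, smul_apply, normalForm_single, smul_eq_mul]
    have := hy i
    field_simp
  have hGx := hGval hui hgc
  set lam : EuclideanSpace ℝ (Fin n) → ℝ := fun y =>
    (ratio u v i0 y * G i0 y - ratio u v i1 y * G i1 y) / (G i0 y - G i1 y) with hlam
  have hres := eq_of_two_residues (hdist i0 i1 h01) (hl i0) (hl i1) hc
  have hlamx : lam x = l := by
    simp only [hlam, hGx]
    exact hres.2
  have has : ∀ i, ContDiffAt ℝ ∞ (ratio u v i) x := fun i => smooth_ratio hu hv (hvi i)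
  have hlams : ContDiffAt ℝ ∞ lam x := by
    refine (((has i0).mul (hGs i0)).sub ((has i1).mul (hGs i1))).div
      ((hGs i0).sub (hGs i1)) ?_
    simp only [hGx]
    exact hres.1
  have hl' : ∀ i, lam x ≠ ratio u v i x := fun i => by rw [hlamx]; exact hl i
  have hWs : ContDiffAt ℝ ∞ (fun y => normalForm u v (lam y) y) x :=
    smooth_normalForm hu hv hlams hvi hl'
  set C : EuclideanSpace ℝ (Fin n) → ℝ := fun y => G i0 y * (lam y - ratio u v i0 y) with hC
  have hCs : ContDiffAt ℝ ∞ C x := (hGs i0).mul (hlams.sub (has i0))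
  have hG0 : ∀ i, G i x ≠ 0 := fun i => by
    rw [hGx]
    exact div_ne_zero hc (sub_ne_zero.2 (hl i))
  have hG01 : G i0 x - G i1 x ≠ 0 := by
    simp only [hGx]
    exact hres.1
  have hprop : ∀ᶠ y in 𝓝 x, g y = 0 → fderiv ℝ g y = C y • normalForm u v (lam y) y := by
    have hev1 : ∀ᶠ y in 𝓝 x, ∀ i, pd i u y ≠ 0 := eventually_all.2 fun i =>
      (smooth_pd hu i).continuousAt.eventually_ne (hui i)
    have hev2 : ∀ᶠ y in 𝓝 x, G i0 y - G i1 y ≠ 0 :=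
      ((hGs i0).sub (hGs i1)).continuousAt.eventually_ne hG01
    have hev3 : ∀ᶠ y in 𝓝 x, ratio u v i0 y - ratio u v i1 y ≠ 0 :=
      ((has i0).sub (has i1)).continuousAt.eventually_ne (sub_ne_zero.2 (hdist i0 i1 h01))
    filter_upwards [hcone, hev1, hev2, hev3, (hGs i0).continuousAt.eventually_ne (hG0 i0),
      (hGs i1).continuousAt.eventually_ne (hG0 i1)] with y hy huy h2 h3 hGy0 hGy1 hgy
    obtain ⟨r, s, t, hr, -, hrst⟩ := hy hgy
    have hGy : ∀ i, G i y = r * ∏ j ∈ Finset.univ.erase i, (s - t * ratio u v j y) := by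
      intro i
      simp only [hG]
      rw [pd, hrst, smul_apply, clearedForm_single, smul_eq_mul]
      have := huy i
      field_simp
    -- the conormal is not one of the coordinate directions, since `G i0` and `G i1` do not vanish
    have hst : ∀ j, s - t * ratio u v j y ≠ 0 := by
      intro j hj
      by_cases hj0 : j = i0
      · refine hGy1 ?_
        rw [hGy, Finset.prod_eq_zero (i := j) (by simp [hj0, h01]) hj, mul_zero]
      · refine hGy0 ?_
        rw [hGy, Finset.prod_eq_zero (i := j) (by simp [hj0]) hj, mul_zero]
    have ht : t ≠ 0 := by
      rintro rfl
      refine h2 ?_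
      simp [hGy]
    have hσ : ∀ j, s / t ≠ ratio u v j y := by
      intro j hj
      refine hst j ?_
      rw [← hj, mul_div_cancel₀ _ ht, sub_self]
    dsimp only at hrst
    rw [clearedForm_eq_smul_clearedForm_one ht, clearedForm_eq_smul_normalForm hσ, smul_smul,
      smul_smul] at hrst
    set c' := r * t ^ (n - 1) * ∏ i, (s / t - ratio u v i y)
    have hc' : c' ≠ 0 := mul_ne_zero (mul_ne_zero hr (pow_ne_zero _ ht))
      (Finset.prod_ne_zero_iff.2 fun j _ => sub_ne_zero.2 (hσ j))
    have hGy' := hGval huy hrst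
    have hlamy : lam y = s / t := by
      simp only [hlam, hGy']
      exact (eq_of_two_residues (sub_ne_zero.1 h3) (hσ i0) (hσ i1) hc').2
    have hCy : C y = c' := by
      simp only [hC, hlamy, hGy']
      exact div_mul_cancel₀ _ (sub_ne_zero.2 (hσ i0))
    rw [hCy, hlamy]
    exact hrst
  have hx0 : ∀ k, normalForm u v (lam x) x (EuclideanSpace.single k 1) ≠ 0 := fun k => by
    rw [normalForm_single]
    exact div_ne_zero (hui k) (sub_ne_zero.2 (hl' k))
  have hdg : fderiv ℝ g x ≠ 0 := by
    intro h
    refine hx0 i0 ?_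
    have h4 := DFunLike.congr_fun hgc (EuclideanSpace.single i0 1)
    rw [h, smul_apply, smul_eq_mul] at h4
    rw [hlamx]
    exact (mul_eq_zero.1 h4.symm).resolve_left hc
  refine ⟨lam, hlams, hlamx, fun i j k => ?_⟩
  refine dWedgeCoeff_eq_zero (hWs.differentiableAt (by simp)) (hx0 k) fun X Y hX hY => ?_
  rw [hlamx] at hX hY
  exact fderiv_symm_of_proportional hg hgx hdg hCs hWs hprop
    (by rw [hgc, smul_apply, hX, smul_zero]) (by rw [hgc, smul_apply, hY, smul_zero])

end SystemFromInvolutivity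

/-! ### The system for involutive structures -/

section Involutive

variable {n : ℕ} {M : Type*} [TopologicalSpace M] [ChartedSpace (EuclideanSpace ℝ (Fin n)) M]
  [IsManifold (𝓡 n) ∞ M]

/-- For an involutive structure in normal form, every value of `λ` at `x` extends to a function `λ`
with `dω ∧ ω = 0` at `x`, namely the parameter of the tangent hyperplanes of an α-manifold; hence
the system holds. -/
theorem GL2Structure.HasNormalForm.systemAt {S : GL2Structure n M}
    {φ : OpenPartialHomeomorph M (EuclideanSpace ℝ (Fin n))}
    {u v : EuclideanSpace ℝ (Fin n) → ℝ} (h : S.HasNormalForm φ u v) (hS : S.IsInvolutive)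
    {x : EuclideanSpace ℝ (Fin n)} (hx : x ∈ φ.target) : SystemAt u v x := by
  obtain ⟨hφ, ⟨hu, hv, huv⟩, hcone⟩ := h
  -- the system is empty unless there are distinct indices
  rcases lt_or_ge n 2 with hn | hn
  · intro i j k m hij
    exact absurd (Fin.ext (by have := i.2; have := j.2; omega)) hij
  have hcone' : ∀ y ∈ φ.target, chartCone S φ y = coneOver fun s t => clearedForm u v s t y := by
    intro y hy
    have := hcone _ (φ.map_target hy)
    rw [φ.right_inv hy] at this
    exact (chartCone_eq_coneOver_iff hφ hy).2 this
  have hnhds := φ.open_target.mem_nhds hx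
  obtain ⟨hui, hvi, hdist⟩ := huv x hx
  refine systemAt_of_forall_combination (hu.contDiffAt hnhds) (hv.contDiffAt hnhds) hui hvi
    fun l hl κ hκ => eq_zero_of_isDerivativeFreeCombination hκ ?_
  have hprod : ∏ i, (l - ratio u v i x) ≠ 0 :=
    Finset.prod_ne_zero_iff.2 fun j _ => sub_ne_zero.2 (hl j)
  have hmem : normalForm u v l x ∈ chartCone S φ x := by
    rw [hcone' x hx]
    refine ⟨(∏ i, (l - ratio u v i x))⁻¹, l, 1, inv_ne_zero hprod, Or.inr one_ne_zero, ?_⟩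
    dsimp only
    rw [clearedForm_eq_smul_normalForm hl, inv_smul_smul₀ hprod]
  obtain ⟨g, hg, hgx, -, ⟨c, hc, hgc⟩, hev⟩ := hS.exists_function_in_chart hφ hx hmem
  refine exists_integrabilityCoeff_eq_zero_of_hypersurface hn (hu.contDiffAt hnhds)
    (hv.contDiffAt hnhds) hui hvi hdist hl hg hgx hc hgc ?_
  filter_upwards [hev, hnhds] with y hy hyφ hgy
  rw [← hcone' y hyφ]
  exact hy hgy

end Involutive

end ParaconformalGeometry

end

open ParaconformalGeometry in
theorem proposition1 (n : ℕ) (hn : 1 ≤ n) :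
    -- every involutive structure has the normal form locally, and in every such form
    -- the functions `u`, `v` satisfy the system
    (∀ (M : Type*) [TopologicalSpace M] [ChartedSpace (EuclideanSpace ℝ (Fin n)) M]
        [IsManifold (𝓡 n) ∞ M] (S : GL2Structure n M), S.IsInvolutive →
      (∀ x₀ : M, ∃ (φ : OpenPartialHomeomorph M (EuclideanSpace ℝ (Fin n)))
          (u v : EuclideanSpace ℝ (Fin n) → ℝ), x₀ ∈ φ.source ∧ S.HasNormalForm φ u v) ∧
      (∀ (φ : OpenPartialHomeomorph M (EuclideanSpace ℝ (Fin n)))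
          (u v : EuclideanSpace ℝ (Fin n) → ℝ), S.HasNormalForm φ u v →
        ∀ x ∈ φ.target, SystemAt u v x)) ∧
    -- the system is the result of eliminating the derivatives of `λ` from `dω(λ) ∧ ω(λ) = 0`
    (∀ (U : Set (EuclideanSpace ℝ (Fin n))) (u v : EuclideanSpace ℝ (Fin n) → ℝ),
      IsOpen U → Admissible u v U → ∀ x ∈ U,
        (∀ ℓ : ℝ, (∀ i, ℓ ≠ ratio u v i x) →
          clearedForm u v ℓ 1 x = (∏ i, (ℓ - ratio u v i x)) • normalForm u v ℓ x) ∧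
        ((∀ ℓ : ℝ, (∀ i, ℓ ≠ ratio u v i x) →
            ∀ κ : ℝ, IsDerivativeFreeCombination u v x ℓ κ → κ = 0) ↔ SystemAt u v x) ∧
        ((∀ ℓ : ℝ, (∀ i, ℓ ≠ ratio u v i x) →
            ∃ lam : EuclideanSpace ℝ (Fin n) → ℝ, ContDiffAt ℝ ∞ lam x ∧ lam x = ℓ ∧
              ∀ i j k, integrabilityCoeff u v lam i j k x = 0) ↔ SystemAt u v x)) := by
  constructor
  · intro M _ _ _ S hS
    refine ⟨fun y₀ => ?_, fun φ u v h x hx => h.systemAt hS hx⟩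
    rcases hn.eq_or_lt with h | h
    · exact S.exists_hasNormalForm_of_eq_one h.symm y₀
    · exact hS.exists_hasNormalForm_of_two_le h y₀
  · intro U u v hU ⟨hu, hv, huv⟩ x hx
    obtain ⟨hui, hvi, hdist⟩ := huv x hx
    have hux := hu.contDiffAt (hU.mem_nhds hx)
    have hvx := hv.contDiffAt (hU.mem_nhds hx)
    refine ⟨fun l hl => clearedForm_eq_smul_normalForm hl, ⟨fun h => ?_, fun h l hl κ hκ => ?_⟩,
      ⟨fun h => ?_, fun h l hl => ?_⟩⟩
    · exact systemAt_of_forall_combination hux hvx hui hvi h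
    · exact eq_zero_of_isDerivativeFreeCombination hκ
        (exists_integrabilityCoeff_eq_zero hux hvx hui hvi hdist h hl)
    · exact systemAt_of_forall_combination hux hvx hui hvi fun l hl κ hκ =>
        eq_zero_of_isDerivativeFreeCombination hκ (h l hl)
    · exact exists_integrabilityCoeff_eq_zero hux hvx hui hvi hdist h hl
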